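/- Let $G$ be a finite simple graph with vertex set $W$ and edge set $E(G)$, let $\mathcal A_G=\{\,\{z_i-z_j=0\} : \{i,j\}\in E(G)\,\}$ be the corresponding graphic arrangement in $\mathbb C^{W}$, and let $\mathbb k$ be a field. Let $E$ be the exterior algebra over $\mathbb k$ on degree-one generators $e_H$, $H\in\mathcal A_G$, with the antiderivation $\partial$ given by $\partial(1)=0$, $\partial(e_H)=1$, let $$I=\Big(\partial e_{\mathcal B} \;\Big|\; \mathcal B\subseteq\mathcal A_G,\ \operatorname{codim}\bigcap_{H\in\mathcal B}H<|\mathcal B|\Big)$$ be the Orlik–Solomon ideal, and let $A=E/I$ be the Orlik–Solomon algebra with the induced grading. Then the following are equivalent: 1. $\mathcal A_G$ is supersolvable, i.e. its intersection lattice (all intersections of hyperplanes of $\mathcal A_G$, ordered by reverse inclusion) has a maximal chain of modular elements, where $x$ is modular if $z\vee(x\wedge y)=(z\vee x)\wedge y$ for all $z\le y$; 2. $A$ is Koszul, i.e. $\operatorname{Ext}^i_A(\mathbb k,\mathbb k)_j=0$ for all $i\ne j$; 3. $A$ is quadratic, i.e. $I$ is generated by its elements of degree $2$. -/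

import Mathlib

noncomputable section

/-! ### Modular elements and supersolvable lattices -/

/-- An element `x` of a lattice is modular if `(x, y)` is a modular pair for every `y`, i.e.
`z ∨ (x ∧ y) = (z ∨ x) ∧ y` whenever `z ≤ y`. -/
def IsModularElement {L : Type*} [Lattice L] (x : L) : Prop :=
  ∀ y z : L, z ≤ y → z ⊔ (x ⊓ y) = (z ⊔ x) ⊓ y

/-! ### Central hyperplane arrangements -/

/-- A (finite) central arrangement of linear hyperplanes in the complex vector space `V`. -/
structure CentralArrangement (V : Type*) [AddCommGroup V] [Module ℂ V] where
  hyperplanes : Set (Submodule ℂ V)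
  finite : hyperplanes.Finite
  isCoatom : ∀ H ∈ hyperplanes, IsCoatom H

namespace CentralArrangement

variable {V : Type*} [AddCommGroup V] [Module ℂ V]

/-- The flats of an arrangement: the intersections of subsets of the arrangement
(the empty intersection being `V`). -/
def Flat (𝒜 : CentralArrangement V) : Type _ :=
  {X : Submodule ℂ V // ∃ ℬ ⊆ 𝒜.hyperplanes, X = sInf ℬ}

namespace Flat

variable {𝒜 : CentralArrangement V}

/-- Flats are ordered by reverse inclusion. -/
instance : PartialOrder 𝒜.Flat where
  le X Y := Y.1 ≤ X.1
  le_refl X := le_refl X.1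
  le_trans _ _ _ h₁ h₂ := le_trans (α := Submodule ℂ V) h₂ h₁
  le_antisymm _ _ h₁ h₂ := Subtype.ext (le_antisymm (α := Submodule ℂ V) h₂ h₁)

/-- The intersection lattice: the join of two flats is their intersection, their meet is the
intersection of all hyperplanes of the arrangement that contain both. -/
instance : Lattice 𝒜.Flat where
  sup X Y := ⟨X.1 ⊓ Y.1, by
    obtain ⟨_, B, hB, rfl⟩ := X
    obtain ⟨_, C, hC, rfl⟩ := Y
    exact ⟨B ∪ C, Set.union_subset hB hC, sInf_union.symm⟩⟩
  inf X Y := ⟨sInf {H | H ∈ 𝒜.hyperplanes ∧ X.1 ≤ H ∧ Y.1 ≤ H}, _, fun _ h => h.1, rfl⟩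
  le_sup_left X Y := inf_le_left (a := X.1) (b := Y.1)
  le_sup_right X Y := inf_le_right (a := X.1) (b := Y.1)
  sup_le _ _ _ h₁ h₂ := le_inf (α := Submodule ℂ V) h₁ h₂
  inf_le_left _ _ := le_sInf (α := Submodule ℂ V) fun _ h => h.2.1
  inf_le_right _ _ := le_sInf (α := Submodule ℂ V) fun _ h => h.2.2
  le_inf X Y Z h₁ h₂ := by
    obtain ⟨_, B, hB, rfl⟩ := X
    exact le_sInf (α := Submodule ℂ V) fun H hH => sInf_le (α := Submodule ℂ V)
      ⟨hB hH, le_trans (α := Submodule ℂ V) h₁ (sInf_le hH),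
        le_trans (α := Submodule ℂ V) h₂ (sInf_le hH)⟩

end Flat

/-- An arrangement is supersolvable if its intersection lattice has a maximal chain
consisting of modular elements. -/
def IsSupersolvable (𝒜 : CentralArrangement V) : Prop :=
  ∃ Δ : Flag 𝒜.Flat, ∀ X ∈ Δ, IsModularElement X

end CentralArrangement

/-! ### Quotients of graded algebras by homogeneous two-sided ideals -/

section GradedQuotient

open scoped DirectSum

variable {k E : Type*} [CommRing k] [Ring E] [Algebra k E]

/-- The image of a family of submodules in the quotient by a two-sided ideal. -/
def quotientGrading (ℰ : ℕ → Submodule k E) (I : TwoSidedIdeal E) (i : ℕ) :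
    Submodule k I.ringCon.Quotient :=
  (ℰ i).map (I.ringCon.mkₐ (α := k)).toLinearMap

instance quotientGrading.gradedMonoid (ℰ : ℕ → Submodule k E) [SetLike.GradedMonoid ℰ]
    (I : TwoSidedIdeal E) : SetLike.GradedMonoid (quotientGrading ℰ I) where
  one_mem := ⟨1, SetLike.one_mem_graded ℰ, map_one (I.ringCon.mkₐ (α := k))⟩
  mul_mem := by
    rintro i j _ _ ⟨x, hx, rfl⟩ ⟨y, hy, rfl⟩
    exact ⟨x * y, SetLike.mul_mem_graded hx hy, map_mul (I.ringCon.mkₐ (α := k)) x y⟩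

/-- The degree-wise quotient map. -/
def quotientGrading.directSumMap (ℰ : ℕ → Submodule k E) [GradedAlgebra ℰ]
    (I : TwoSidedIdeal E) : (⨁ i, ℰ i) →ₐ[k] (⨁ i, quotientGrading ℰ I i) :=
  DirectSum.toAlgebra k (fun i => ℰ i)
    (fun i => (DirectSum.lof k ℕ (fun i => quotientGrading ℰ I i) i) ∘ₗ
      ((I.ringCon.mkₐ (α := k)).toLinearMap.restrict fun _ hx => Submodule.mem_map_of_mem hx))
    (congrArg (DirectSum.of (fun i => quotientGrading ℰ I i) 0)
        (Subtype.ext (map_one (I.ringCon.mkₐ (α := k)))))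
    (by
      intro i j x y
      refine Eq.trans ?_ (DirectSum.of_mul_of _ _).symm
      exact congrArg (DirectSum.of (fun i => quotientGrading ℰ I i) (i + j))
        (Subtype.ext (map_mul (I.ringCon.mkₐ (α := k)) x.1 y.1)))

/-- The quotient map followed by the decomposition into graded pieces. -/
def quotientGrading.decomposeMap (ℰ : ℕ → Submodule k E) [GradedAlgebra ℰ]
    (I : TwoSidedIdeal E) : E →ₐ[k] (⨁ i, quotientGrading ℰ I i) :=
  (quotientGrading.directSumMap ℰ I).comp (DirectSum.decomposeAlgEquiv ℰ).toAlgHom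

theorem quotientGrading.decomposeMap_coe (ℰ : ℕ → Submodule k E) [GradedAlgebra ℰ]
    (I : TwoSidedIdeal E) (i : ℕ) (x : ℰ i) :
    decomposeMap ℰ I x.1 = DirectSum.of (fun i => quotientGrading ℰ I i) i
      ⟨I.ringCon.mkₐ (α := k) x.1, Submodule.mem_map_of_mem x.2⟩ := by
  change directSumMap ℰ I (DirectSum.decompose ℰ x.1) = _
  rw [DirectSum.decompose_coe]
  exact DirectSum.toAddMonoid_of _ _ _

theorem quotientGrading.le_ker (ℰ : ℕ → Submodule k E) [GradedAlgebra ℰ]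
    (s : Set E) (hs : ∀ x ∈ s, ∃ i, x ∈ ℰ i) (I : TwoSidedIdeal E)
    (hI : I = TwoSidedIdeal.span s) :
    I.ringCon ≤ RingCon.ker (decomposeMap ℰ I).toRingHom := by
  have hI' : I ≤ TwoSidedIdeal.ker (decomposeMap ℰ I).toRingHom := by
    nth_rw 1 [hI]
    refine TwoSidedIdeal.span_le.2 fun x hx => ?_
    obtain ⟨i, hi⟩ := hs x hx
    rw [SetLike.mem_coe, TwoSidedIdeal.mem_ker]
    have h0 : I.ringCon.mkₐ (α := k) x = 0 := by
      have hxI : x ∈ I := hI ▸ TwoSidedIdeal.subset_span hx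
      exact (RingCon.eq _).2 ((TwoSidedIdeal.mem_iff _ _).1 hxI)
    refine (decomposeMap_coe ℰ I i ⟨x, hi⟩).trans ?_
    rw [← map_zero (DirectSum.of (fun i => quotientGrading ℰ I i) i)]
    exact congrArg _ (Subtype.ext h0)
  intro x y hxy
  have := hI' ((TwoSidedIdeal.rel_iff I x y).1 hxy)
  rw [TwoSidedIdeal.mem_ker, map_sub, sub_eq_zero] at this
  exact this

/-- The quotient of a graded algebra by a two-sided ideal with homogeneous generators is graded
by the images of the graded pieces. -/
@[reducible] def quotientGrading.gradedAlgebra (ℰ : ℕ → Submodule k E) [GradedAlgebra ℰ]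
    (s : Set E) (hs : ∀ x ∈ s, ∃ i, x ∈ ℰ i) (I : TwoSidedIdeal E)
    (hI : I = TwoSidedIdeal.span s) : GradedAlgebra (quotientGrading ℰ I) :=
  GradedAlgebra.ofAlgHom _ (I.ringCon.liftₐ (decomposeMap ℰ I) (le_ker ℰ s hs I hI))
    (by
      refine RingCon.Quotient.hom_extₐ (AlgHom.ext fun x => ?_)
      change DirectSum.coeAlgHom (quotientGrading ℰ I) (decomposeMap ℰ I x) =
        I.ringCon.mkₐ (α := k) x
      induction x using DirectSum.Decomposition.inductionOn ℰ with
      | zero => simp only [map_zero]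
      | homogeneous x => rw [decomposeMap_coe, DirectSum.coeAlgHom_of]
      | add x y hx hy => simp only [map_add, hx, hy])
    (by
      rintro i ⟨_, x, hx, rfl⟩
      exact decomposeMap_coe ℰ I i ⟨x, hx⟩)

end GradedQuotient

/-! ### The Orlik–Solomon algebra -/

namespace CentralArrangement

open scoped ExteriorAlgebra

variable {V : Type*} [AddCommGroup V] [Module ℂ V]

section OrlikSolomon

variable (k : Type*) [Field k] (𝒜 : CentralArrangement V)

/-- The exterior algebra on generators `e_H`, one for each hyperplane `H`. -/
abbrev Exterior : Type _ := ExteriorAlgebra k (𝒜.hyperplanes →₀ k)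

/-- The derivation `∂` of the exterior algebra: the antiderivation with `∂ 1 = 0`, `∂ e_H = 1`
and `∂ (e_H y) = y - e_H ∂ y`. -/
def boundary : 𝒜.Exterior k →ₗ[k] 𝒜.Exterior k :=
  CliffordAlgebra.contractLeft (Q := (0 : QuadraticForm k (𝒜.hyperplanes →₀ k)))
    (Finsupp.linearCombination k fun _ => (1 : k))

/-- The product `e_ℬ = e_{S 0} ⋯ e_{S (m - 1)}`. -/
def monomial {m : ℕ} (S : Fin m → 𝒜.hyperplanes) : 𝒜.Exterior k :=
  ExteriorAlgebra.ιMulti k m fun i => Finsupp.single (S i) 1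

/-- The elements `∂ e_ℬ`, where `ℬ` is a dependent set of hyperplanes (listed without repetition
in some order; another order only changes the sign), i.e. `codim ⋂ ℬ < |ℬ|`. -/
def osGenerators : Set (𝒜.Exterior k) :=
  {x | ∃ (m : ℕ) (S : Fin m → 𝒜.hyperplanes), Function.Injective S ∧
    Module.finrank ℂ (V ⧸ (⨅ i, (S i : Submodule ℂ V))) < m ∧
    x = 𝒜.boundary k (𝒜.monomial k S)}

/-- The Orlik–Solomon ideal. -/
def osIdeal : TwoSidedIdeal (𝒜.Exterior k) := TwoSidedIdeal.span (𝒜.osGenerators k)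

/-- The Orlik–Solomon algebra. -/
abbrev OSAlgebra : Type _ := (𝒜.osIdeal k).ringCon.Quotient

/-- The grading of the Orlik–Solomon algebra induced by that of the exterior algebra. -/
abbrev osGrading : ℕ → Submodule k (𝒜.OSAlgebra k) :=
  quotientGrading (fun i => ⋀[k]^i (𝒜.hyperplanes →₀ k)) (𝒜.osIdeal k)

theorem boundary_ιMulti_mem (m : ℕ) (v : Fin m → 𝒜.hyperplanes →₀ k) :
    𝒜.boundary k (ExteriorAlgebra.ιMulti k m v) ∈ ⋀[k]^(m - 1) (𝒜.hyperplanes →₀ k) := by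
  induction m with
  | zero =>
    rw [ExteriorAlgebra.ιMulti_zero_apply, boundary, CliffordAlgebra.contractLeft_one]
    exact zero_mem _
  | succ m ih =>
    rw [ExteriorAlgebra.ιMulti_succ_apply, boundary]
    erw [CliffordAlgebra.contractLeft_ι_mul]
    refine Submodule.sub_mem _ (Submodule.smul_mem _ _ ?_) ?_
    · exact ExteriorAlgebra.ιMulti_range k m (Set.mem_range_self _)
    · cases m with
      | zero =>
        rw [ExteriorAlgebra.ιMulti_zero_apply, CliffordAlgebra.contractLeft_one, mul_zero]
        exact zero_mem _
      | succ m =>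
        rw [Nat.add_sub_cancel, ExteriorAlgebra.exteriorPower, pow_succ']
        exact Submodule.mul_mem_mul (LinearMap.mem_range_self _ _) (ih _)

instance osGradedAlgebra : GradedAlgebra (𝒜.osGrading k) :=
  quotientGrading.gradedAlgebra _ (𝒜.osGenerators k)
    (by
      rintro _ ⟨m, S, -, -, rfl⟩
      exact ⟨m - 1, 𝒜.boundary_ιMulti_mem k m _⟩)
    _ rfl

/-- The Orlik–Solomon algebra is quadratic if the Orlik–Solomon ideal is generated by its
elements of degree two. -/
def IsQuadratic : Prop :=
  𝒜.osIdeal k = TwoSidedIdeal.span {x | x ∈ 𝒜.osIdeal k ∧ x ∈ ⋀[k]^2 (𝒜.hyperplanes →₀ k)}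

end OrlikSolomon

end CentralArrangement

/-! ### Koszul algebras

For an augmented graded algebra `A = k ⊕ A₊` over a field, the reduced bar resolution
`A ⊗ A₊^{⊗ n}` of the `A`-module `k` gives the complex `Hom_A (A ⊗ A₊^{⊗ n}, k)`, that is, the
complex of `n`-multilinear forms on `A₊`, with differential
`(d f) (a₀, …, aₙ) = ∑ⱼ (-1)^(j+1) f (a₀, …, aⱼ aⱼ₊₁, …, aₙ)`
(the two outer terms vanish because `A₊` acts as zero on `k`). Its cohomology is
`Ext_A (k, k)`, and the internal grading is the one induced by the grading of `A`. -/

namespace BarComplex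

variable {k A : Type*} [Field k] [Ring A] [Algebra k A]

section

variable (𝒜 : ℕ → Submodule k A) [GradedAlgebra 𝒜]

/-- The augmentation ideal `A₊ = ⨁_{i > 0} A_i`. -/
def plus : Submodule k A := (HomogeneousIdeal.irrelevant 𝒜).toIdeal.restrictScalars k

/-- Multiplication of `A` restricted to the augmentation ideal. -/
def mulPlus : plus 𝒜 →ₗ[k] plus 𝒜 →ₗ[k] plus 𝒜 :=
  LinearMap.mk₂ k (fun a b => ⟨a.1 * b.1, Ideal.mul_mem_left (HomogeneousIdeal.irrelevant 𝒜).toIdeal a.1 b.2⟩)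
    (fun _ _ _ => Subtype.ext (add_mul _ _ _))
    (fun _ _ _ => Subtype.ext (smul_mul_assoc _ _ _))
    (fun _ _ _ => Subtype.ext (mul_add _ _ _))
    (fun _ _ _ => Subtype.ext (mul_smul_comm _ _ _))

/-- The bar cochains of cohomological degree `n`. -/
abbrev Cochain (n : ℕ) : Type _ := MultilinearMap k (fun _ : Fin n => plus 𝒜) k

/-- `(a₀, …, aₙ) ↦ (a₀, …, aⱼ aⱼ₊₁, …, aₙ)`. -/
def merge {n : ℕ} (j : Fin n) (a : Fin (n + 1) → plus 𝒜) : Fin n → plus 𝒜 :=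
  Fin.contractNth j.castSucc (fun x y => mulPlus 𝒜 x y) a

end

variable {𝒜 : ℕ → Submodule k A} [GradedAlgebra 𝒜]

theorem merge_update {n : ℕ} (j : Fin n) [DecidableEq (Fin (n + 1))]
    (a : Fin (n + 1) → plus 𝒜) (p : Fin (n + 1)) :
    ∃ (q : Fin n) (φ : plus 𝒜 →ₗ[k] plus 𝒜), ∀ x,
      merge 𝒜 j (Function.update a p x) = Function.update (merge 𝒜 j a) q (φ x) := by
  rcases lt_trichotomy p.1 j.1 with h | h | h
  · refine ⟨⟨p.1, by omega⟩, LinearMap.id, fun x => funext fun i => ?_⟩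
    simp only [merge, Fin.contractNth, Function.update_apply, Fin.ext_iff, LinearMap.id_apply]
    grind
  · refine ⟨j, (mulPlus 𝒜).flip (a j.succ), fun x => funext fun i => ?_⟩
    simp only [merge, Fin.contractNth, Function.update_apply, Fin.ext_iff, LinearMap.flip_apply]
    grind
  · by_cases h' : p.1 = j.1 + 1
    · refine ⟨j, mulPlus 𝒜 (a j.castSucc), fun x => funext fun i => ?_⟩
      simp only [merge, Fin.contractNth, Function.update_apply, Fin.ext_iff]
      grind
    · refine ⟨⟨p.1 - 1, by omega⟩, LinearMap.id, fun x => funext fun i => ?_⟩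
      simp only [merge, Fin.contractNth, Function.update_apply, Fin.ext_iff, LinearMap.id_apply]
      grind

/-- The cochain `(a₀, …, aₙ) ↦ f (a₀, …, aⱼ aⱼ₊₁, …, aₙ)`. -/
def compMerge {n : ℕ} (f : Cochain 𝒜 n) (j : Fin n) : Cochain 𝒜 (n + 1) where
  toFun a := f (merge 𝒜 j a)
  map_update_add' a p x y := by
    obtain ⟨q, φ, h⟩ := merge_update j a p
    simp only [h, map_add, MultilinearMap.map_update_add]
  map_update_smul' a p c x := by
    obtain ⟨q, φ, h⟩ := merge_update j a p
    simp only [h, map_smul, MultilinearMap.map_update_smul]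

variable (𝒜)

/-- The differential of the bar cochain complex. -/
def d (n : ℕ) : Cochain 𝒜 n →ₗ[k] Cochain 𝒜 (n + 1) where
  toFun f := ∑ j : Fin n, (-1 : k) ^ (j.1 + 1) • compMerge f j
  map_add' f g := by
    rw [← Finset.sum_add_distrib]
    exact Finset.sum_congr rfl fun j _ => by rw [← smul_add]; rfl
  map_smul' c f := by
    rw [RingHom.id_apply, Finset.smul_sum]
    exact Finset.sum_congr rfl fun j _ => by rw [smul_comm]; rfl

/-- The cochains of internal degree `j`: those which vanish on every tuple of homogeneous
elements whose total degree is not `j`. -/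
def homogeneous (n j : ℕ) : Submodule k (Cochain 𝒜 n) where
  carrier := {f | ∀ (a : Fin n → plus 𝒜) (e : Fin n → ℕ), (∀ i, (a i : A) ∈ 𝒜 (e i)) →
    ∑ i, e i ≠ j → f a = 0}
  zero_mem' _ _ _ _ := rfl
  add_mem' hf hg a e h hj := by
    rw [add_apply, hf a e h hj, hg a e h hj, add_zero]
  smul_mem' c f hf a e h hj := by
    rw [smul_apply, hf a e h hj, smul_zero]

/-- Cocycles of bidegree `(n, j)`. -/
def cocycles (n j : ℕ) : Submodule k (Cochain 𝒜 n) :=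
  LinearMap.ker (d 𝒜 n) ⊓ homogeneous 𝒜 n j

/-- Coboundaries of bidegree `(n, j)`. -/
def coboundaries : (n j : ℕ) → Submodule k (Cochain 𝒜 n)
  | 0, _ => ⊥
  | n + 1, j => (homogeneous 𝒜 n j).map (d 𝒜 n)

/-- `Ext^n_A (k, k)_j`: the cocycles of bidegree `(n, j)` modulo the coboundaries. -/
def gradedExt (n j : ℕ) : Submodule k (Cochain 𝒜 n ⧸ coboundaries 𝒜 n j) :=
  (cocycles 𝒜 n j).map (coboundaries 𝒜 n j).mkQ

end BarComplex

/-- A graded algebra `A` is Koszul if `Ext^i_A (k, k)_j = 0` for `i ≠ j`. -/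
def IsKoszul {k A : Type*} [Field k] [Ring A] [Algebra k A] (𝒜 : ℕ → Submodule k A)
    [GradedAlgebra 𝒜] : Prop :=
  ∀ i j : ℕ, i ≠ j → BarComplex.gradedExt 𝒜 i j = ⊥

/-! ### Graphic arrangements -/

/-- The hyperplane `z_i = z_j`. -/
def diagonalHyperplane {W : Type*} (i j : W) : Submodule ℂ (W → ℂ) :=
  LinearMap.ker (LinearMap.proj (R := ℂ) (φ := fun _ : W => ℂ) i -
    LinearMap.proj (R := ℂ) (φ := fun _ : W => ℂ) j)

theorem isCoatom_diagonalHyperplane {W : Type*} {i j : W} (h : i ≠ j) :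
    IsCoatom (diagonalHyperplane i j) := by
  classical
  refine LinearMap.isCoatom_ker_of_surjective
    (LinearMap.surjective fun h0 => ?_)
  have := LinearMap.congr_fun h0 (Pi.single i 1)
  simp [h.symm] at this

/-- The arrangement `{z_i - z_j = 0 | i j an edge}` of a graph on the vertex set `W`. -/
def graphicArrangement {W : Type*} [Finite W] (G : SimpleGraph W) :
    CentralArrangement (W → ℂ) where
  hyperplanes := {H | ∃ i j, G.Adj i j ∧ H = diagonalHyperplane i j}
  finite := (Set.finite_range fun p : W × W => diagonalHyperplane p.1 p.2).subset <| by
    rintro _ ⟨i, j, -, rfl⟩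
    exact ⟨(i, j), rfl⟩
  isCoatom := by
    rintro _ ⟨i, j, h, rfl⟩
    exact isCoatom_diagonalHyperplane h.ne

end

/-!
Supersolvable implies Koszul, Koszul implies quadratic, and quadratic implies supersolvable. The
first two implications hold for all central arrangements, only the last one uses the graph.

*Supersolvable implies Koszul.* A maximal chain of modular flats partitions the hyperplanes into
levels (`CentralArrangement.Leveling`, `CentralArrangement.levelingOfFlag`): two distinct
hyperplanes of the same level meet inside a hyperplane of smaller level, and no hyperplane contains
the intersection of all hyperplanes of smaller level. Hence the Orlik–Solomon algebra `A` is built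
level by level: as a module over the part of smaller level it is free on `1` and the generators of
the new level. This is proved by constructing the corresponding module, on which the relations of
`A` hold. It follows that for suitable sets of generators the colon ideal of the left ideal
generated by a set with respect to one more generator is again generated by a set of generators.
Such a filtration by left ideals generated in degree one forces the resolution of `k` to be linear;
`BarComplex.isKoszul_of_colon` carries this out inside the bar complex, where "the module `A / L`
has a linear resolution" is the condition `BarComplex.LinearAt`, and
`CentralArrangement.Leveling.isKoszul` draws the conclusion.

*Koszul implies quadratic.* Suppose that in degrees `< j`, where `j ≥ 3`, the Orlik–Solomon ideal
`I` is generated by quadratic elements. A linear form `μ` on the degree `j` part of the exterior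
algebra that vanishes on the quadratically generated ideal gives a two-cocycle `(a, b) ↦ μ (a b)` of
the bar complex of internal degree `j`. It is a coboundary, since `Ext² (k, k)` has no component of
degree `j`, which says that `μ` factors through `A` and so vanishes on `I`
(`CentralArrangement.form_eq_zero`).

*Quadratic implies supersolvable.* Color some of the edges such that no triangle carries two
colors, and map the exterior algebra of the arrangement to the exterior algebra on the colors. The
dependent triples of hyperplanes are the triangles of the graph, so this map kills all quadratic
relations, hence the whole ideal if it is quadratic; on the other hand it does not kill the
monomial of a cycle with pairwise different colors, which lies in the ideal
(`GraphicArrangement.not_rainbow`). A shortest path between two nonadjacent neighbors of a vertex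
`v` that avoids the other neighbors of `v` would give such a coloring
(`GraphicArrangement.noDetour_of_isQuadratic`). Graphs without these detours are chordal: as in
Dirac's theorem they have a simplicial vertex, and removing these one after the other leads to
a perfect elimination order (`GraphicArrangement.exists_elimination_order`). The flats spanned by
its initial segments form a maximal chain of modular elements
(`GraphicArrangement.isSupersolvable_of_order`).
-/


/-! ### Linear filtrations and the bar complex -/

namespace BarComplex

variable {k A : Type*} [Field k] [Ring A] [Algebra k A] {𝒜 : ℕ → Submodule k A} [GradedAlgebra 𝒜]

/-- The cochain obtained by fixing the last argument. -/
def evalLast {n : ℕ} (f : Cochain 𝒜 (n + 1)) (y : plus 𝒜) : Cochain 𝒜 n :=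
  (LinearMap.applyₗ (R := k) y).compMultilinearMap (MultilinearMap.curryRight f)

@[simp] theorem evalLast_apply {n : ℕ} (f : Cochain 𝒜 (n + 1)) (y : plus 𝒜)
    (a : Fin n → plus 𝒜) : evalLast f y a = f (Fin.snoc a y) := rfl

theorem merge_castSucc_snoc {n : ℕ} (j : Fin n) (a : Fin (n + 1) → plus 𝒜) (y : plus 𝒜) :
    merge 𝒜 j.castSucc (Fin.snoc a y : Fin (n + 2) → plus 𝒜) =
      (Fin.snoc (merge 𝒜 j a) y : Fin (n + 1) → plus 𝒜) := by
  funext i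
  refine Fin.lastCases ?_ (fun i => ?_) i
  · rw [Fin.snoc_last, merge, Fin.contractNth_apply_of_gt _ _ _ _ (by simp),
      Fin.succ_last, Fin.snoc_last]
  · rw [Fin.snoc_castSucc]
    simp only [merge, Fin.contractNth, Fin.val_castSucc]
    rw [← Fin.castSucc_succ, Fin.snoc_castSucc, Fin.snoc_castSucc]

theorem merge_last_snoc {n : ℕ} (a : Fin (n + 1) → plus 𝒜) (y : plus 𝒜) :
    merge 𝒜 (Fin.last n) (Fin.snoc a y : Fin (n + 2) → plus 𝒜) =
      (Fin.snoc (Fin.init a) (mulPlus 𝒜 (a (Fin.last n)) y) : Fin (n + 1) → plus 𝒜) := by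
  funext i
  refine Fin.lastCases ?_ (fun i => ?_) i
  · rw [Fin.snoc_last, merge, Fin.contractNth_apply_of_eq _ _ _ _ (by simp),
      Fin.succ_last, Fin.snoc_last, Fin.snoc_castSucc]
  · rw [Fin.snoc_castSucc, merge, Fin.contractNth_apply_of_lt _ _ _ _ (by simp),
      Fin.snoc_castSucc]
    rfl

theorem d_apply {n : ℕ} (f : Cochain 𝒜 n) (a : Fin (n + 1) → plus 𝒜) :
    d 𝒜 n f a = ∑ j : Fin n, (-1 : k) ^ (j.1 + 1) * f (merge 𝒜 j a) := by
  change (∑ j : Fin n, (-1 : k) ^ (j.1 + 1) • compMerge f j) a = _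
  rw [sum_apply]
  rfl

/-- The recursive description of the bar differential: it separates the products which involve
the last argument from those which do not. -/
theorem d_snoc {n : ℕ} (f : Cochain 𝒜 (n + 1)) (a : Fin (n + 1) → plus 𝒜) (y : plus 𝒜) :
    d 𝒜 (n + 1) f (Fin.snoc a y) = d 𝒜 n (evalLast f y) a +
      (-1) ^ (n + 1) * f (Fin.snoc (Fin.init a) (mulPlus 𝒜 (a (Fin.last n)) y)) := by
  rw [d_apply, d_apply, Fin.sum_univ_castSucc]
  simp only [merge_castSucc_snoc, merge_last_snoc, Fin.val_castSucc, Fin.val_last, evalLast_apply]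

theorem mulPlus_assoc (a b c : plus 𝒜) :
    mulPlus 𝒜 (mulPlus 𝒜 a b) c = mulPlus 𝒜 a (mulPlus 𝒜 b c) :=
  Subtype.ext (mul_assoc _ _ _)

theorem d_d : ∀ {n : ℕ} (f : Cochain 𝒜 n), d 𝒜 (n + 1) (d 𝒜 n f) = 0
  | 0, f => by
    ext a
    rw [d_apply]
    simp [d_apply]
  | n + 1, f => by
    ext c
    obtain ⟨b, z, rfl⟩ : ∃ (b : Fin (n + 2) → plus 𝒜) (z : plus 𝒜), c = Fin.snoc b z :=
      ⟨Fin.init c, c (Fin.last _), (Fin.snoc_init_self c).symm⟩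
    obtain ⟨a, y, rfl⟩ : ∃ (a : Fin (n + 1) → plus 𝒜) (y : plus 𝒜), b = Fin.snoc a y :=
      ⟨Fin.init b, b (Fin.last _), (Fin.snoc_init_self b).symm⟩
    -- the cochain `(a₀, …, aₙ) ↦ f (a₀, …, aₙ z)`
    let R : Cochain 𝒜 (n + 1) := MultilinearMap.uncurryRight
      ((LinearMap.lcomp k k ((mulPlus 𝒜).flip z)).compMultilinearMap f.curryRight)
    have hR : ∀ (a : Fin n → plus 𝒜) (y : plus 𝒜),
        R (Fin.snoc a y) = f (Fin.snoc a (mulPlus 𝒜 y z)) := fun a y => by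
      simp [R, MultilinearMap.uncurryRight_apply]
    have hRe : ∀ y, evalLast R y = evalLast f (mulPlus 𝒜 y z) := fun y => by
      ext a; exact hR a y
    have h1 : evalLast (d 𝒜 (n + 1) f) z = d 𝒜 n (evalLast f z) + (-1 : k) ^ (n + 1) • R := by
      ext a
      rw [evalLast_apply, d_snoc, add_apply, smul_apply,
        ← hR, Fin.snoc_init_self, smul_eq_mul]
    rw [d_snoc, h1, map_add, d_d, zero_add, map_smul, smul_apply, d_snoc,
      Fin.snoc_last, Fin.init_snoc, d_snoc, hRe, hR, mulPlus_assoc, smul_eq_mul,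
      zero_apply]
    ring

/-- A cochain is determined by its values on homogeneous tuples. -/
theorem eq_zero_of_homogeneous : ∀ {n : ℕ} (f : Cochain 𝒜 n),
    (∀ (a : Fin n → plus 𝒜) (e : Fin n → ℕ), (∀ i, (a i : A) ∈ 𝒜 (e i)) → f a = 0) → f = 0
  | 0, f, h => by
    ext a
    exact h a (fun _ => 0) (fun i => i.elim0)
  | n + 1, f, h => by
    have key : ∀ y : plus 𝒜, ∀ e : ℕ, (y : A) ∈ 𝒜 e → evalLast f y = 0 := fun y e hy =>
      eq_zero_of_homogeneous _ fun a e' ha => h _ (Fin.snoc e' e) fun i => by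
        refine Fin.lastCases ?_ (fun i => ?_) i
        · simpa using hy
        · simpa using ha i
    ext c
    obtain ⟨a, y, rfl⟩ : ∃ (a : Fin n → plus 𝒜) (y : plus 𝒜), c = Fin.snoc a y :=
      ⟨Fin.init c, c (Fin.last _), (Fin.snoc_init_self c).symm⟩
    classical
    have hp : ∀ i, (DirectSum.decompose 𝒜 (y : A) i : A) ∈ plus 𝒜 := fun i =>
      (HomogeneousIdeal.irrelevant 𝒜).isHomogeneous i y.2
    have hy : y = ∑ i ∈ (DirectSum.decompose 𝒜 (y : A)).support, ⟨_, hp i⟩ := by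
      refine Subtype.ext ?_
      rw [AddSubmonoidClass.coe_finsetSum]
      exact (DirectSum.sum_support_decompose 𝒜 (y : A)).symm
    change f.curryRight a y = 0
    rw [hy, map_sum]
    refine Finset.sum_eq_zero fun i _ => ?_
    exact DFunLike.congr_fun (key ⟨_, hp i⟩ i (SetLike.coe_mem _)) a

theorem eq_zero_of_mem_plus {a : A} (h0 : a ∈ 𝒜 0) (h : a ∈ plus 𝒜) : a = 0 := by
  have := (HomogeneousIdeal.mem_irrelevant_iff 𝒜 a).1 h
  rwa [GradedRing.proj_apply, DirectSum.decompose_of_mem_same _ h0] at this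

theorem mem_plus_of_mem {a : A} {i : ℕ} (hi : 0 < i) (h : a ∈ 𝒜 i) : a ∈ plus 𝒜 :=
  HomogeneousIdeal.mem_irrelevant_of_mem 𝒜 hi h

variable (𝒜) in
/-- The `A`-module `A / L` has a linear resolution in cohomological degree `n + 1`, expressed in
the bar complex of `A`: a cochain `u` of bidegree off the diagonal whose differential vanishes
as soon as the last argument lies in the left ideal `L` is itself, up to a coboundary, a cochain
with this property. For `L = A₊` this says that `Ext^(n + 1) (k, k)` is concentrated on the
diagonal, for `L = 0` it is void. -/
def LinearAt (L : Submodule k A) (n : ℕ) : Prop :=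
  ∀ i, i ≠ n + 1 → ∀ u ∈ homogeneous 𝒜 (n + 1) i,
    (∀ a (y : plus 𝒜), (y : A) ∈ L → d 𝒜 (n + 1) u (Fin.snoc a y) = 0) →
    ∃ g ∈ homogeneous 𝒜 n i, ∀ a (y : plus 𝒜), (y : A) ∈ L → (u - d 𝒜 n g) (Fin.snoc a y) = 0

theorem linearAt_bot (n : ℕ) : LinearAt 𝒜 ⊥ n := fun i _ u _ _ =>
  ⟨0, zero_mem _, fun a y hy => by
    obtain rfl : y = 0 := Subtype.ext ((Submodule.mem_bot k).1 hy)
    exact MultilinearMap.map_coord_zero _ (Fin.last n) (Fin.snoc_last _ _)⟩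

theorem merge_homogeneous {n : ℕ} (j : Fin n) (a : Fin (n + 1) → plus 𝒜) (e : Fin (n + 1) → ℕ)
    (h : ∀ i, (a i : A) ∈ 𝒜 (e i)) (i : Fin n) :
    (merge 𝒜 j a i : A) ∈ 𝒜 (Fin.contractNth j.castSucc (· + ·) e i) := by
  unfold merge Fin.contractNth
  split_ifs
  · exact h _
  · exact SetLike.mul_mem_graded (h _) (h _)
  · exact h _

theorem sum_contractNth : ∀ {n : ℕ} (j : Fin n) (e : Fin (n + 1) → ℕ),
    ∑ i, Fin.contractNth j.castSucc (· + ·) e i = ∑ i, e i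
  | n + 1, j, e => by
    induction j using Fin.cases with
    | zero =>
      rw [Fin.sum_univ_succ, Fin.sum_univ_succ e, Fin.sum_univ_succ (fun i => e i.succ)]
      rw [Fin.contractNth_apply_of_eq _ _ _ _ (by simp)]
      simp only [← add_assoc]
      congr 1
    | succ j =>
      rw [Fin.sum_univ_succ, Fin.sum_univ_succ e, ← sum_contractNth j]
      congr 1
      refine Finset.sum_congr rfl fun i _ => ?_
      simp [Fin.contractNth]

theorem d_mem_homogeneous {n i : ℕ} {f : Cochain 𝒜 n} (hf : f ∈ homogeneous 𝒜 n i) :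
    d 𝒜 n f ∈ homogeneous 𝒜 (n + 1) i := fun a e h hi => by
  rw [d_apply]
  refine Finset.sum_eq_zero fun j _ => ?_
  rw [hf _ _ (merge_homogeneous j a e h) (by rwa [sum_contractNth]), mul_zero]

/-- The step of the induction along a filtration by ideals generated by linear forms: if
`I = I' + A x` with `x` of degree one, and `L = (I' : x)`, then the exact sequence
`0 → A / L (-1) → A / I' → A / I → 0` lets one pass from `A / L` and `A / I'` to `A / I`. -/
theorem LinearAt.step {n : ℕ} {I' I L : Submodule k A} {x : A} (hx : x ∈ 𝒜 1)
    (ε : A →ₗ[k] k) (hε1 : ε 1 = 1) (hε : ∀ a, a - ε a • 1 ∈ plus 𝒜) (hε0 : ∀ a ∈ plus 𝒜, ε a = 0)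
    (hI' : ∀ a, ∀ y ∈ I', a * y ∈ I') (hI'I : I' ≤ I) (hxI : x ∈ I)
    (hI : ∀ y ∈ I, ∃ y' ∈ I', ∃ a, y = y' + a * x)
    (hL : ∀ a ∈ L, a * x ∈ I') (hLp : L ≤ plus 𝒜)
    (θ : A →ₗ[k] A) (hθ : ∀ i, ∀ a ∈ 𝒜 (i + 1), θ a ∈ 𝒜 i)
    (hθI : ∀ y ∈ I', θ y ∈ L) (hθx : ∀ a, θ (a * x) - a ∈ L)
    (h₁ : LinearAt 𝒜 I' n) (h₂ : ∀ m, n = m + 1 → LinearAt 𝒜 L m) : LinearAt 𝒜 I n := by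
  intro i hi u hu hdu
  let X : plus 𝒜 := ⟨x, mem_plus_of_mem one_pos hx⟩
  obtain ⟨g, hg, hug⟩ := h₁ i hi u hu fun a y hy => hdu a y (hI'I hy)
  -- it suffices to correct `u - d g` so that it also vanishes when the last argument is `x`
  suffices H : ∃ h ∈ homogeneous 𝒜 n i,
      (∀ a (y : plus 𝒜), (y : A) ∈ I' → d 𝒜 n h (Fin.snoc a y) = 0) ∧
      ∀ a, (u - d 𝒜 n g - d 𝒜 n h) (Fin.snoc a X) = 0 by
    obtain ⟨h, hh, hhI, hhx⟩ := H
    refine ⟨g + h, add_mem hg hh, fun b y hy => ?_⟩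
    rw [map_add, ← sub_sub]
    set w := u - d 𝒜 n g - d 𝒜 n h with hw
    have hdw : d 𝒜 (n + 1) w = d 𝒜 (n + 1) u := by
      rw [hw, map_sub, map_sub, d_d, d_d, sub_zero, sub_zero]
    have hwI : ∀ y : plus 𝒜, (y : A) ∈ I' → w (Fin.snoc b y) = 0 := fun y hy => by
      rw [hw, sub_apply, hug b y hy, hhI b y hy, sub_zero]
    have hwx : evalLast w X = 0 := by ext a; exact hhx a
    obtain ⟨y', hy', a, hya⟩ := hI y hy
    let a' : plus 𝒜 := ⟨a - ε a • 1, hε a⟩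
    have hy'p : y' ∈ plus 𝒜 := by
      have : y' = y - a * x := by rw [hya, add_sub_cancel_right]
      rw [this]
      exact sub_mem y.2 ((HomogeneousIdeal.irrelevant 𝒜).toIdeal.mul_mem_left a X.2)
    have hyd : y = ⟨y', hy'p⟩ + (ε a • X + mulPlus 𝒜 a' X) := by
      refine Subtype.ext ?_
      change (y : A) = y' + (ε a • x + (a - ε a • 1) * x)
      rw [sub_mul, smul_mul_assoc, one_mul, add_sub_cancel, hya]
    have h3 : w (Fin.snoc b (mulPlus 𝒜 a' X)) = 0 := by
      have := hdu (Fin.snoc b a') X hxI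
      rw [← hdw, d_snoc, hwx, map_zero, zero_apply, zero_add, Fin.init_snoc,
        Fin.snoc_last] at this
      exact (mul_eq_zero.1 this).resolve_left (pow_ne_zero _ (neg_ne_zero.2 one_ne_zero))
    change w.curryRight b y = 0
    rw [hyd, map_add, map_add, map_smul]
    change w (Fin.snoc b _) + (ε a • w (Fin.snoc b X) + w (Fin.snoc b _)) = 0
    rw [hwI _ hy', h3, show w (Fin.snoc b X) = 0 from hhx b, smul_zero, add_zero, add_zero]
  set w := u - d 𝒜 n g with hw
  have hwi : w ∈ homogeneous 𝒜 (n + 1) i := sub_mem hu (d_mem_homogeneous hg)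
  have hdw : d 𝒜 (n + 1) w = d 𝒜 (n + 1) u := by rw [hw, map_sub, d_d, sub_zero]
  cases i with
  | zero =>
    have hw0 : w = 0 := by
      refine eq_zero_of_homogeneous w fun a e h => ?_
      by_cases h0 : ∑ j, e j = 0
      · have h1 : e 0 = 0 := Finset.sum_eq_zero_iff.1 h0 0 (Finset.mem_univ _)
        refine MultilinearMap.map_coord_zero _ 0 (Subtype.ext ?_)
        exact eq_zero_of_mem_plus (by simpa only [h1] using h 0) (a 0).2
      · exact hwi a e h h0
    refine ⟨0, zero_mem _, fun a y hy => ?_, fun a => ?_⟩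
    · rw [map_zero]; rfl
    · rw [map_zero, sub_zero, hw0]; rfl
  | succ i =>
    have hw' : evalLast w X ∈ homogeneous 𝒜 n i := fun a e h hs => by
      refine hwi _ (Fin.snoc e 1) (fun j => ?_) ?_
      · refine Fin.lastCases ?_ (fun j => ?_) j
        · simpa using hx
        · simpa using h j
      · rw [Fin.sum_univ_castSucc]
        simpa using hs
    cases n with
    | zero =>
      refine ⟨0, zero_mem _, fun a y hy => ?_, fun a => ?_⟩
      · rw [map_zero]; rfl
      · rw [map_zero, sub_zero]
        exact hw' a Fin.elim0 (fun j => j.elim0) (by simpa [eq_comm] using hi)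
    | succ m =>
      obtain ⟨g', hg', hv⟩ := h₂ m rfl i (by omega) (evalLast w X) hw' fun a y hy => by
        have := hdu (Fin.snoc a y) X hxI
        rw [← hdw, d_snoc, Fin.init_snoc, Fin.snoc_last,
          hug _ _ (hL _ hy), mul_zero, add_zero] at this
        exact this
      set v := evalLast w X - d 𝒜 m g' with hvdef
      -- the linear part of `θ`
      let θp : plus 𝒜 →ₗ[k] plus 𝒜 :=
        ((θ - (ε ∘ₗ θ).smulRight 1).codRestrict (plus 𝒜) fun a => hε (θ a)) ∘ₗ (plus 𝒜).subtype
      let θ0 : plus 𝒜 →ₗ[k] k := ε ∘ₗ θ ∘ₗ (plus 𝒜).subtype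
      have hθp : ∀ y : plus 𝒜, (θp y : A) = θ y - ε (θ y) • 1 := fun y => rfl
      let h : Cochain 𝒜 (m + 1) := MultilinearMap.uncurryRight
        ((LinearMap.toSpanSingleton k (plus 𝒜 →ₗ[k] k) θ0).compMultilinearMap g' +
          (-1 : k) ^ (m + 1) • (LinearMap.lcomp k k θp).compMultilinearMap v.curryRight)
      have hh : ∀ a y, h (Fin.snoc a y) =
          g' a * ε (θ y) + (-1) ^ (m + 1) * v (Fin.snoc a (θp y)) := fun a y => by
        simp [h, MultilinearMap.uncurryRight_apply, θ0]
      have hhL : ∀ a (y : plus 𝒜), θ y ∈ L → h (Fin.snoc a y) = 0 := fun a y hy => by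
        have h0 : ε (θ y) = 0 := hε0 _ (hLp hy)
        rw [hh, h0, mul_zero, zero_add, hv, mul_zero]
        rw [hθp, h0, zero_smul, sub_zero]
        exact hy
      refine ⟨h, fun a e he hs => ?_, fun a y hy => ?_, fun a => ?_⟩
      · obtain ⟨b, y, rfl⟩ : ∃ (b : Fin m → plus 𝒜) (y : plus 𝒜), a = Fin.snoc b y :=
          ⟨Fin.init a, a (Fin.last _), (Fin.snoc_init_self a).symm⟩
        have hb : ∀ j, (b j : A) ∈ 𝒜 (e j.castSucc) := fun j => by
          simpa using he j.castSucc
        have hy : (y : A) ∈ 𝒜 (e (Fin.last m)) := by simpa using he (Fin.last m)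
        rw [Fin.sum_univ_castSucc] at hs
        cases hel : e (Fin.last m) with
        | zero =>
          rw [hel] at hy
          exact MultilinearMap.map_coord_zero _ (Fin.last m)
            (by rw [Fin.snoc_last]; exact Subtype.ext (eq_zero_of_mem_plus hy y.2))
        | succ q =>
          rw [hel] at hy hs
          have hθy := hθ q y hy
          have hvi : v ∈ homogeneous 𝒜 (m + 1) i := sub_mem hw' (d_mem_homogeneous hg')
          have hεq : q ≠ 0 → ε (θ y) = 0 := fun hq =>
            hε0 _ (mem_plus_of_mem (Nat.pos_of_ne_zero hq) hθy)
          have hθpy : (θp y : A) ∈ 𝒜 q := by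
            rw [hθp]
            rcases eq_or_ne q 0 with rfl | hq
            · exact sub_mem hθy (Submodule.smul_mem _ _ (SetLike.one_mem_graded 𝒜))
            · rwa [hεq hq, zero_smul, sub_zero]
          rw [hh, hvi _ (Fin.snoc (fun j => e j.castSucc) q), mul_zero, add_zero]
          · rcases eq_or_ne q 0 with rfl | hq
            · rw [hg' _ _ hb (by omega), zero_mul]
            · rw [hεq hq, mul_zero]
          · intro j
            refine Fin.lastCases ?_ (fun j => ?_) j
            · simpa using hθpy
            · simpa using hb j
          · rw [Fin.sum_univ_castSucc]
            simp only [Fin.snoc_castSucc, Fin.snoc_last]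
            omega
      · have h0 : evalLast h y = 0 := by ext b; exact hhL b y (hθI _ hy)
        rw [d_snoc, h0, map_zero, hhL _ _ (hθI _ (hI' _ _ hy))]
        simp
      · have h1 : θ x - 1 ∈ L := by simpa using hθx 1
        have h0 : evalLast h X = g' := by
          ext b
          have h2 : ε (θ x) = 1 := by
            have := hε0 _ (hLp h1)
            rwa [map_sub, sub_eq_zero, hε1] at this
          rw [evalLast_apply, hh]
          change g' b * ε (θ x) + _ = _
          rw [h2, mul_one, hv, mul_zero, add_zero]
          rw [hθp]
          change θ x - ε (θ x) • 1 ∈ L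
          rwa [h2, one_smul]
        have h5 : h (Fin.snoc (Fin.init a) (mulPlus 𝒜 (a (Fin.last m)) X)) =
            (-1) ^ (m + 1) * v a := by
          have h6 := hθx (a (Fin.last m))
          have h7 : ε (θ (a (Fin.last m) * x)) = 0 := by
            have := hε0 _ (hLp h6)
            rwa [map_sub, hε0 _ (a (Fin.last m)).2, sub_zero] at this
          rw [hh]
          change _ * ε (θ (a (Fin.last m) * x)) + _ = _
          rw [h7, mul_zero, zero_add]
          congr 1
          have h8 : θp (mulPlus 𝒜 (a (Fin.last m)) X) - a (Fin.last m) =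
              (⟨_, hLp h6⟩ : plus 𝒜) := by
            refine Subtype.ext ?_
            change θ (a (Fin.last m) * x) - ε (θ (a (Fin.last m) * x)) • 1 - _ = _
            rw [h7, zero_smul, sub_zero]
          conv_rhs => rw [← Fin.snoc_init_self a]
          rw [← sub_eq_zero]
          change v.curryRight (Fin.init a) _ - v.curryRight (Fin.init a) _ = 0
          rw [← map_sub, h8]
          exact hv _ _ h6
        have h9 : d 𝒜 (m + 1) h (Fin.snoc a X) = w (Fin.snoc a X) := by
          rw [d_snoc, h0, h5, ← mul_assoc, ← pow_add, Even.neg_one_pow ⟨m + 1, rfl⟩, one_mul]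
          exact add_sub_cancel (d 𝒜 m g' a) (w (Fin.snoc a X))
        exact sub_eq_zero.2 h9.symm

/-- Right multiplication by a linear form `x`, seen as an injection `A / (I' : x) → A / I'`, has a
graded retraction. -/
theorem exists_graded_retraction {I' L : Submodule k A} {x : A} (hx : x ∈ 𝒜 1)
    (hI'h : ∀ i, ∀ y ∈ I', (DirectSum.decompose 𝒜 y i : A) ∈ I')
    (hLh : ∀ i, ∀ y ∈ L, (DirectSum.decompose 𝒜 y i : A) ∈ L)
    (hL : ∀ a, a * x ∈ I' ↔ a ∈ L) :
    ∃ θ : A →ₗ[k] A, (∀ i, ∀ a ∈ 𝒜 (i + 1), θ a ∈ 𝒜 i) ∧ (∀ y ∈ I', θ y ∈ L) ∧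
      ∀ a, θ (a * x) - a ∈ L := by
  classical
  let r : (A ⧸ L) →ₗ[k] (A ⧸ I') := L.mapQ I' (LinearMap.mulRight k x) fun a ha => (hL a).2 ha
  have hr : LinearMap.ker r = ⊥ := by
    rw [LinearMap.ker_eq_bot']
    intro a
    obtain ⟨a, rfl⟩ := L.mkQ_surjective a
    intro ha
    rw [Submodule.mkQ_apply] at ha
    replace ha := (Submodule.Quotient.mk_eq_zero I').1 ha
    exact (Submodule.Quotient.mk_eq_zero L).2 ((hL a).1 ha)
  obtain ⟨l, hl⟩ := r.exists_leftInverse_of_injective hr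
  obtain ⟨s, hs⟩ := L.mkQ.exists_rightInverse_of_surjective (LinearMap.range_eq_top.2 L.mkQ_surjective)
  have hs' : ∀ q, L.mkQ (s q) = q := fun q => LinearMap.congr_fun hs q
  let θ₀ : A →ₗ[k] A := s ∘ₗ l ∘ₗ I'.mkQ
  have hθ₀I : ∀ y ∈ I', θ₀ y ∈ L := fun y hy => by
    rw [← Submodule.Quotient.mk_eq_zero L]
    have : I'.mkQ y = 0 := (Submodule.Quotient.mk_eq_zero I').2 hy
    exact (hs' _).trans (by rw [LinearMap.comp_apply, this, map_zero])
  have hθ₀x : ∀ a, θ₀ (a * x) - a ∈ L := fun a => by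
    rw [← Submodule.Quotient.mk_eq_zero L, Submodule.Quotient.mk_sub, sub_eq_zero]
    exact (hs' _).trans (LinearMap.congr_fun hl (L.mkQ a))
  -- the component of degree `-1` of `θ₀`
  let φ : ∀ i, 𝒜 i →ₗ[k] A := fun i => i.casesOn 0 fun i =>
    GradedAlgebra.proj 𝒜 i ∘ₗ θ₀ ∘ₗ (𝒜 (i + 1)).subtype
  let θ : A →ₗ[k] A := DirectSum.toModule k ℕ A φ ∘ₗ
    (DirectSum.decomposeLinearEquiv 𝒜).toLinearMap
  have hθ : ∀ i, ∀ a (ha : a ∈ 𝒜 i), θ a = φ i ⟨a, ha⟩ := fun i a ha => by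
    change DirectSum.toModule k ℕ A φ (DirectSum.decompose 𝒜 a) = _
    rw [DirectSum.decompose_of_mem 𝒜 ha]
    exact DirectSum.toModule_lof k i _
  have hθs : ∀ i, ∀ a ∈ 𝒜 (i + 1), θ a = (DirectSum.decompose 𝒜 (θ₀ a) i : A) := fun i a ha =>
    hθ (i + 1) a ha
  refine ⟨θ, fun i a ha => hθs i a ha ▸ SetLike.coe_mem _, fun y hy => ?_, fun a => ?_⟩
  · rw [← DirectSum.sum_support_decompose 𝒜 y, map_sum]
    refine sum_mem fun i _ => ?_
    have hi := hI'h i y hy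
    cases i with
    | zero => rw [hθ 0 _ (SetLike.coe_mem _)]; exact zero_mem _
    | succ i =>
      rw [hθs i _ (SetLike.coe_mem _)]
      exact hLh _ _ (hθ₀I _ hi)
  · rw [← DirectSum.sum_support_decompose 𝒜 a, Finset.sum_mul, map_sum, ← Finset.sum_sub_distrib]
    refine sum_mem fun i _ => ?_
    set b := (DirectSum.decompose 𝒜 a i : A) with hb
    have hbi : b ∈ 𝒜 i := SetLike.coe_mem _
    rw [hθs i _ (SetLike.mul_mem_graded hbi hx)]
    have := hLh i _ (hθ₀x b)
    rwa [DirectSum.decompose_sub, DirectSum.sub_apply, AddSubgroupClass.coe_sub,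
      DirectSum.decompose_of_mem_same 𝒜 hbi] at this

theorem isKoszul_of_linearAt (h : ∀ n, LinearAt 𝒜 (plus 𝒜) n) : IsKoszul 𝒜 := by
  intro n j hnj
  rw [gradedExt, eq_bot_iff, Submodule.map_le_iff_le_comap, ← LinearMap.ker, Submodule.ker_mkQ]
  rintro f ⟨hf, hfj⟩
  cases n with
  | zero =>
    have : f = 0 := by
      ext a
      exact hfj a Fin.elim0 (fun i => i.elim0) (by simpa using hnj)
    rw [this]
    exact zero_mem _
  | succ n =>
    obtain ⟨g, hg, hfg⟩ := h n j hnj.symm f hfj fun a y _ => by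
      rw [LinearMap.mem_ker.1 hf]; rfl
    refine ⟨g, hg, ?_⟩
    ext a
    have := hfg (Fin.init a) (a (Fin.last n)) (a (Fin.last n)).2
    rw [Fin.snoc_init_self, sub_apply, sub_eq_zero] at this
    exact this.symm

/-- A graded algebra is Koszul if its augmentation ideal is generated by linear forms `x i` which
come with a level such that, after all forms of smaller level and some of the same level have been
divided out, the annihilator of `x s` is generated by all the forms of level at most that of
`x s`. (This is a Koszul filtration of a particular shape.) -/
theorem isKoszul_of_colon (ε : A →ₗ[k] k) (hε1 : ε 1 = 1) (hε : ∀ a, a - ε a • 1 ∈ plus 𝒜)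
    (hε0 : ∀ a ∈ plus 𝒜, ε a = 0) {ι : Type*} [Finite ι] (x : ι → A) (hx : ∀ i, x i ∈ 𝒜 1)
    (lvl : ι → ℕ) (hgen : ∀ a ∈ plus 𝒜, a ∈ Ideal.span (Set.range x))
    (hcolon : ∀ (s : ι) (T : Set ι), s ∉ T → (∀ t, lvl t < lvl s → t ∈ T) →
      (∀ t ∈ T, lvl t ≤ lvl s) → ∀ a, a * x s ∈ Ideal.span (x '' T) ↔
        a ∈ Ideal.span (x '' {t | lvl t ≤ lvl s})) : IsKoszul 𝒜 := by
  classical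
  have := Fintype.ofFinite ι
  let J : Set ι → Submodule k A := fun T => (Ideal.span (x '' T)).restrictScalars k
  have hJh : ∀ (T : Set ι) i, ∀ y ∈ J T, (DirectSum.decompose 𝒜 y i : A) ∈ J T := fun T i y hy =>
    Ideal.homogeneous_span 𝒜 (x '' T) (by rintro _ ⟨t, -, rfl⟩; exact ⟨1, hx t⟩) i hy
  have hJp : ∀ T, J T ≤ plus 𝒜 := fun T => by
    change Ideal.span (x '' T) ≤ (HomogeneousIdeal.irrelevant 𝒜).toIdeal
    rw [Ideal.span_le]
    rintro _ ⟨t, -, rfl⟩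
    exact mem_plus_of_mem one_pos (hx t)
  -- induction on the cohomological degree, then along the filtration
  have key : ∀ n, ∀ T : Finset ι, (∀ t ∈ T, ∀ t', lvl t' < lvl t → t' ∈ T) →
      LinearAt 𝒜 (J T) n := by
    intro n
    induction n using Nat.strong_induction_on with
    | _ n ihn =>
    intro T
    induction hN : T.card generalizing T with
    | zero =>
      intro _
      rw [Finset.card_eq_zero] at hN
      subst hN
      have : J (∅ : Finset ι) = ⊥ := by
        simp [J]
      rw [this]
      exact linearAt_bot n
    | succ N ihN =>
      intro hT
      obtain ⟨s, hsT, hs⟩ := T.exists_max_image lvl (Finset.card_pos.1 (by omega))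
      let T' := T.erase s
      have hT'T : (T' : Set ι) ⊆ T := Finset.coe_subset.2 (Finset.erase_subset _ _)
      have hc := hcolon s T' (by simp [T'])
        (fun t ht => by
          have : t ≠ s := by rintro rfl; exact lt_irrefl _ ht
          simpa [T', this] using hT s hsT t ht)
        (fun t ht => hs t (hT'T ht))
      obtain ⟨θ, hθ, hθI, hθx⟩ := exists_graded_retraction (I' := J T')
        (L := J {t | lvl t ≤ lvl s}) (hx s) (hJh _) (hJh _) hc
      have hxsT : x s ∈ J T := Ideal.subset_span ⟨s, hsT, rfl⟩
      refine LinearAt.step (hx s) ε hε1 hε hε0 (fun a y hy => Ideal.mul_mem_left _ a hy)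
        (Ideal.span_mono (Set.image_mono hT'T)) hxsT (fun y hy => ?_) (fun a ha => (hc a).2 ha)
        (hJp _) θ hθ hθI hθx
        (ihN T' (by simp [T', Finset.card_erase_of_mem hsT, hN]) fun t ht t' htt' => ?_) ?_
      · have h1 : (x '' (T : Set ι)) = insert (x s) (x '' (T' : Set ι)) := by
          rw [← Set.image_insert_eq, ← Finset.coe_insert, Finset.insert_erase hsT]
        change y ∈ Ideal.span _ at hy
        rw [h1, Ideal.span_insert, Submodule.mem_sup] at hy
        obtain ⟨y₁, hy₁, y₂, hy₂, rfl⟩ := hy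
        obtain ⟨a, rfl⟩ := Ideal.mem_span_singleton'.1 hy₁
        exact ⟨y₂, hy₂, a, add_comm _ _⟩
      · have h1 := Finset.mem_erase.1 ht
        refine Finset.mem_erase.2 ⟨?_, hT t h1.2 t' htt'⟩
        rintro rfl
        exact absurd htt' (not_lt.2 (hs t h1.2))
      · rintro m rfl
        have := ihn m (Nat.lt_succ_self m) (Finset.univ.filter fun t => lvl t ≤ lvl s)
          (fun t ht t' htt' => by
            simp only [Finset.mem_filter, Finset.mem_univ, true_and] at ht ⊢
            omega)
        simpa using this
  refine isKoszul_of_linearAt fun n => ?_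
  have h1 : J (Finset.univ : Finset ι) = plus 𝒜 := by
    refine le_antisymm (hJp _) fun a ha => ?_
    have := hgen a ha
    rw [← Set.image_univ] at this
    simpa [J] using this
  rw [← h1]
  exact key n _ fun _ _ _ _ => Finset.mem_univ _

end BarComplex


/-! ### Generators and relations of the Orlik–Solomon algebra -/

namespace CentralArrangement

open scoped ExteriorAlgebra

variable {V : Type*} [AddCommGroup V] [Module ℂ V]

section Generators

variable (k : Type*) [Field k] (𝒜 : CentralArrangement V)

/-- The generator `e_H` of the exterior algebra. -/
noncomputable def extGen (H : 𝒜.hyperplanes) : 𝒜.Exterior k := ExteriorAlgebra.ι k (Finsupp.single H 1)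

/-- The quotient map from the exterior algebra to the Orlik–Solomon algebra. -/
noncomputable def osMk : 𝒜.Exterior k →ₐ[k] 𝒜.OSAlgebra k := (𝒜.osIdeal k).ringCon.mkₐ (α := k)

/-- The class of `e_H` in the Orlik–Solomon algebra. -/
noncomputable def osGen (H : 𝒜.hyperplanes) : 𝒜.OSAlgebra k := 𝒜.osMk k (𝒜.extGen k H)

theorem osMk_surjective : Function.Surjective (𝒜.osMk k) :=
  RingCon.mkₐ_surjective _

theorem osMk_eq_zero_iff {x : 𝒜.Exterior k} : 𝒜.osMk k x = 0 ↔ x ∈ 𝒜.osIdeal k := by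
  rw [TwoSidedIdeal.mem_iff, ← RingCon.eq]
  exact Iff.rfl

theorem extGen_mul_self (H : 𝒜.hyperplanes) : 𝒜.extGen k H * 𝒜.extGen k H = 0 :=
  ExteriorAlgebra.ι_sq_zero _

theorem extGen_mul_comm (H H' : 𝒜.hyperplanes) :
    𝒜.extGen k H * 𝒜.extGen k H' = -(𝒜.extGen k H' * 𝒜.extGen k H) :=
  eq_neg_of_add_eq_zero_left (ExteriorAlgebra.ι_add_mul_swap _ _)

theorem osGen_mul_self (H : 𝒜.hyperplanes) : 𝒜.osGen k H * 𝒜.osGen k H = 0 := by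
  rw [osGen, ← map_mul, extGen_mul_self, map_zero]

theorem osGen_mul_comm (H H' : 𝒜.hyperplanes) :
    𝒜.osGen k H * 𝒜.osGen k H' = -(𝒜.osGen k H' * 𝒜.osGen k H) := by
  rw [osGen, osGen, ← map_mul, extGen_mul_comm, map_neg, map_mul]

theorem linearCombination_single_mem (v : 𝒜.hyperplanes →₀ k) :
    ExteriorAlgebra.ι k v = v.sum fun H c => c • 𝒜.extGen k H := by
  conv_lhs => rw [← Finsupp.sum_single v]
  rw [Finsupp.sum, map_sum]
  refine Finset.sum_congr rfl fun H _ => ?_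
  change _ = v H • ExteriorAlgebra.ι k (Finsupp.single H 1)
  rw [← map_smul, Finsupp.smul_single, smul_eq_mul, mul_one]

theorem ext_induction {P : 𝒜.Exterior k → Prop} (one : P 1)
    (add : ∀ x y, P x → P y → P (x + y)) (smul : ∀ (c : k) x, P x → P (c • x))
    (gen_mul : ∀ H x, P x → P (𝒜.extGen k H * x)) (x : 𝒜.Exterior k) : P x := by
  induction x using CliffordAlgebra.left_induction with
  | algebraMap r => rw [Algebra.algebraMap_eq_smul_one]; exact smul _ _ one
  | add x y hx hy => exact add x y hx hy
  | ι_mul x m hx =>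
    have : ∀ s : Finset 𝒜.hyperplanes, P ((∑ H ∈ s, m H • 𝒜.extGen k H) * x) := fun s => by
      classical
      induction s using Finset.induction_on with
      | empty =>
        rw [Finset.sum_empty, zero_mul, ← zero_smul k x]
        exact smul _ _ hx
      | insert H s hH ih =>
        rw [Finset.sum_insert hH, add_mul, smul_mul_assoc]
        exact add _ _ (smul _ _ (gen_mul H x hx)) ih
    change P (ExteriorAlgebra.ι k m * x)
    rw [linearCombination_single_mem]
    exact this _

theorem os_induction {P : 𝒜.OSAlgebra k → Prop} (one : P 1)
    (add : ∀ x y, P x → P y → P (x + y)) (smul : ∀ (c : k) x, P x → P (c • x))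
    (gen_mul : ∀ H x, P x → P (𝒜.osGen k H * x)) (x : 𝒜.OSAlgebra k) : P x := by
  obtain ⟨x, rfl⟩ := 𝒜.osMk_surjective k x
  refine 𝒜.ext_induction k (P := fun x => P (𝒜.osMk k x)) ?_ ?_ ?_ ?_ x
  · rwa [map_one]
  · intro x y hx hy; rw [map_add]; exact add _ _ hx hy
  · intro c x hx; rw [map_smul]; exact smul _ _ hx
  · intro H x hx; rw [map_mul]; exact gen_mul _ _ hx

theorem os_hom_ext {R : Type*} [Ring R] [Algebra k R] {f g : 𝒜.OSAlgebra k →ₐ[k] R}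
    (h : ∀ H, f (𝒜.osGen k H) = g (𝒜.osGen k H)) : f = g := by
  refine AlgHom.ext fun x => ?_
  refine 𝒜.os_induction k (P := fun x => f x = g x) ?_ ?_ ?_ ?_ x
  · rw [map_one, map_one]
  · intro x y hx hy; rw [map_add, map_add, hx, hy]
  · intro c x hx; rw [map_smul, map_smul, hx]
  · intro H x hx; rw [map_mul, map_mul, h, hx]

end Generators

section Lift

variable {k : Type*} [Field k] {𝒜 : CentralArrangement V}

theorem linearCombination_mul_self {ι R : Type*} [Ring R] [Algebra k R] (f : ι → R)
    (h2 : ∀ i, f i * f i = 0) (ha : ∀ i j, f i * f j + f j * f i = 0) (v : ι →₀ k) :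
    Finsupp.linearCombination k f v * Finsupp.linearCombination k f v = 0 := by
  have key : ∀ u w : ι →₀ k, Finsupp.linearCombination k f u * Finsupp.linearCombination k f w +
      Finsupp.linearCombination k f w * Finsupp.linearCombination k f u = 0 := by
    intro u w
    induction u using Finsupp.induction_linear with
    | zero => simp
    | add u u' hu hu' =>
      rw [map_add, add_mul, mul_add, add_add_add_comm, hu, hu', add_zero]
    | single i a =>
      induction w using Finsupp.induction_linear with
      | zero => simp
      | add u u' hu hu' =>
        rw [map_add, add_mul, mul_add, add_add_add_comm, hu, hu', add_zero]
      | single j b =>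
        rw [Finsupp.linearCombination_single, Finsupp.linearCombination_single, smul_mul_smul_comm,
          smul_mul_smul_comm, mul_comm b, ← smul_add, ha, smul_zero]
  induction v using Finsupp.induction_linear with
  | zero => simp
  | add u u' hu hu' =>
    rw [map_add, add_mul, mul_add, mul_add, hu, hu', zero_add, add_zero]
    exact key u u'
  | single i a =>
    rw [Finsupp.linearCombination_single, smul_mul_smul_comm, h2, smul_zero]

/-- The algebra homomorphism from the exterior algebra given by an anticommuting family of
elements of square zero. -/
noncomputable def extLift {R : Type*} [Ring R] [Algebra k R] (f : 𝒜.hyperplanes → R)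
    (h2 : ∀ H, f H * f H = 0) (ha : ∀ H H', f H * f H' + f H' * f H = 0) :
    𝒜.Exterior k →ₐ[k] R :=
  ExteriorAlgebra.lift k ⟨Finsupp.linearCombination k f, linearCombination_mul_self f h2 ha⟩

@[simp] theorem extLift_extGen {R : Type*} [Ring R] [Algebra k R] (f : 𝒜.hyperplanes → R)
    (h2 : ∀ H, f H * f H = 0) (ha : ∀ H H', f H * f H' + f H' * f H = 0) (H : 𝒜.hyperplanes) :
    extLift (k := k) f h2 ha (𝒜.extGen k H) = f H := by
  rw [extLift, extGen, ExteriorAlgebra.lift_ι_apply, Finsupp.linearCombination_single, one_smul]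

/-- An algebra homomorphism from the exterior algebra which vanishes on generators of the
Orlik–Solomon ideal descends to the Orlik–Solomon algebra. -/
noncomputable def osLift {R : Type*} [Ring R] [Algebra k R] (g : 𝒜.Exterior k →ₐ[k] R)
    (s : Set (𝒜.Exterior k)) (hs : 𝒜.osIdeal k ≤ TwoSidedIdeal.span s) (hg : ∀ x ∈ s, g x = 0) :
    𝒜.OSAlgebra k →ₐ[k] R :=
  (𝒜.osIdeal k).ringCon.liftₐ g (by
    have h : TwoSidedIdeal.span s ≤ TwoSidedIdeal.ker g.toRingHom :=
      TwoSidedIdeal.span_le.2 fun x hx => (TwoSidedIdeal.mem_ker _).2 (hg x hx)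
    intro x y hxy
    have := (TwoSidedIdeal.mem_ker _).1 (h (hs ((TwoSidedIdeal.rel_iff _ x y).1 hxy)))
    rw [map_sub, sub_eq_zero] at this
    exact this)

theorem osLift_osMk {R : Type*} [Ring R] [Algebra k R] (g : 𝒜.Exterior k →ₐ[k] R)
    (s : Set (𝒜.Exterior k)) (hs : 𝒜.osIdeal k ≤ TwoSidedIdeal.span s) (hg : ∀ x ∈ s, g x = 0)
    (x : 𝒜.Exterior k) : osLift g s hs hg (𝒜.osMk k x) = g x := rfl

end Lift

section Boundary

variable (k : Type*) [Field k] (𝒜 : CentralArrangement V)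

theorem boundary_extGen_mul (H : 𝒜.hyperplanes) (x : 𝒜.Exterior k) :
    𝒜.boundary k (𝒜.extGen k H * x) = x - 𝒜.extGen k H * 𝒜.boundary k x := by
  rw [boundary, extGen]
  refine (CliffordAlgebra.contractLeft_ι_mul _ _ _).trans ?_
  rw [Finsupp.linearCombination_single, one_smul, one_smul]

@[simp] theorem boundary_one : 𝒜.boundary k 1 = 0 :=
  CliffordAlgebra.contractLeft_one _ _

@[simp] theorem boundary_extGen (H : 𝒜.hyperplanes) : 𝒜.boundary k (𝒜.extGen k H) = 1 := by
  simpa using 𝒜.boundary_extGen_mul k H 1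

/-- The grade involution of the exterior algebra. -/
noncomputable def gradeInvolution : 𝒜.Exterior k →ₐ[k] 𝒜.Exterior k := CliffordAlgebra.involute

@[simp] theorem gradeInvolution_extGen (H : 𝒜.hyperplanes) :
    𝒜.gradeInvolution k (𝒜.extGen k H) = -𝒜.extGen k H :=
  CliffordAlgebra.involute_ι _

theorem boundary_mul (x y : 𝒜.Exterior k) : 𝒜.boundary k (x * y) =
    𝒜.boundary k x * y + 𝒜.gradeInvolution k x * 𝒜.boundary k y := by
  refine 𝒜.ext_induction k (P := fun x => 𝒜.boundary k (x * y) =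
    𝒜.boundary k x * y + 𝒜.gradeInvolution k x * 𝒜.boundary k y) ?_ ?_ ?_ ?_ x
  · simp
  · intro x x' hx hx'
    simp only [add_mul, map_add, hx, hx']
    abel
  · intro c x hx
    simp only [smul_mul_assoc, map_smul, hx, smul_add]
  · intro H x hx
    rw [mul_assoc, boundary_extGen_mul, hx, boundary_extGen_mul, map_mul, gradeInvolution_extGen]
    noncomm_ring

/-- The relation `∂ (e_a e_b e_c)`. -/
noncomputable def triangle (a b c : 𝒜.hyperplanes) : 𝒜.Exterior k :=
  𝒜.extGen k b * 𝒜.extGen k c - 𝒜.extGen k a * 𝒜.extGen k c + 𝒜.extGen k a * 𝒜.extGen k b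

theorem monomial_succ {m : ℕ} (S : Fin (m + 1) → 𝒜.hyperplanes) :
    𝒜.monomial k S = 𝒜.extGen k (S 0) * 𝒜.monomial k (Fin.tail S) :=
  ExteriorAlgebra.ιMulti_succ_apply _

@[simp] theorem monomial_zero (S : Fin 0 → 𝒜.hyperplanes) : 𝒜.monomial k S = 1 :=
  ExteriorAlgebra.ιMulti_zero_apply _

theorem boundary_monomial_three (S : Fin 3 → 𝒜.hyperplanes) :
    𝒜.boundary k (𝒜.monomial k S) = 𝒜.triangle k (S 0) (S 1) (S 2) := by
  have h1 : Fin.tail S 0 = S 1 := rfl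
  have h2 : Fin.tail (Fin.tail S) 0 = S 2 := rfl
  rw [monomial_succ, monomial_succ, monomial_succ, monomial_zero, mul_one, h1, h2,
    boundary_extGen_mul, boundary_extGen_mul, boundary_extGen, triangle]
  noncomm_ring

theorem boundary_triangle (a b c : 𝒜.hyperplanes) : 𝒜.boundary k (𝒜.triangle k a b c) = 0 := by
  simp only [triangle, map_add, map_sub, boundary_extGen_mul, boundary_extGen, mul_one]
  abel

theorem gradeInvolution_triangle (a b c : 𝒜.hyperplanes) :
    𝒜.gradeInvolution k (𝒜.triangle k a b c) = 𝒜.triangle k a b c := by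
  simp only [triangle, map_add, map_sub, map_mul, gradeInvolution_extGen, neg_mul_neg]

theorem monomial_eq_zero {m : ℕ} {S : Fin m → 𝒜.hyperplanes} (hS : ¬ Function.Injective S) :
    𝒜.monomial k S = 0 :=
  ExteriorAlgebra.ιMulti_eq_zero_of_not_inj fun h => hS fun i j hij =>
    h (by simp only [hij])

/-- Here the hyperplanes of the dependent family may be repeated. -/
theorem boundary_monomial_mem {m : ℕ} (S : Fin m → 𝒜.hyperplanes)
    (hS : Module.finrank ℂ (V ⧸ (⨅ i, (S i : Submodule ℂ V))) < m) :
    𝒜.boundary k (𝒜.monomial k S) ∈ 𝒜.osIdeal k := by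
  by_cases h : Function.Injective S
  · exact TwoSidedIdeal.subset_span ⟨m, S, h, hS, rfl⟩
  · rw [monomial_eq_zero k 𝒜 h, map_zero]
    exact zero_mem _

theorem triangle_mem (a b c : 𝒜.hyperplanes)
    (h : Module.finrank ℂ (V ⧸ ((a : Submodule ℂ V) ⊓ (b ⊓ c))) < 3) :
    𝒜.triangle k a b c ∈ 𝒜.osIdeal k := by
  have := 𝒜.boundary_monomial_mem k ![a, b, c] (by
    have : (⨅ i, ((![a, b, c] i : 𝒜.hyperplanes) : Submodule ℂ V)) = (a : Submodule ℂ V) ⊓ (b ⊓ c) := by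
      refine le_antisymm (le_inf (iInf_le _ 0) (le_inf (iInf_le _ 1) (iInf_le _ 2)))
        (le_iInf fun i => ?_)
      fin_cases i
      · exact inf_le_left
      · exact inf_le_right.trans inf_le_left
      · exact inf_le_right.trans inf_le_right
    rwa [this])
  rwa [boundary_monomial_three] at this

/-- Exchange of two factors: modulo the relations `∂ (e_a e_b e_c)`, a monomial which contains
`e_b` and `e_c` is the sum of the monomials obtained by replacing one of them by `e_a`. -/
theorem monomial_sub_mem {T : TwoSidedIdeal (𝒜.Exterior k)} {a b c : 𝒜.hyperplanes}
    (hT : 𝒜.triangle k a b c ∈ T) {m : ℕ} (S : Fin m → 𝒜.hyperplanes) {p q : Fin m} (hpq : p ≠ q)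
    (hp : S p = b) (hq : S q = c) :
    𝒜.monomial k S - 𝒜.monomial k (Function.update S p a) -
      𝒜.monomial k (Function.update S q a) ∈ T := by
  classical
  obtain ⟨m, rfl⟩ : ∃ n, m = n + 2 := by
    have : 1 < Fintype.card (Fin m) := Fintype.one_lt_card_iff.2 ⟨p, q, hpq⟩
    rw [Fintype.card_fin] at this
    exact ⟨m - 2, by omega⟩
  -- the case in which the two factors come first
  have key : ∀ S : Fin (m + 2) → 𝒜.hyperplanes, S 0 = b → S 1 = c →
      𝒜.monomial k S - 𝒜.monomial k (Function.update S 0 a) -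
        𝒜.monomial k (Function.update S 1 a) ∈ T := by
    intro S h0 h1
    simp only [monomial_succ]
    have e1 : Fin.tail (Function.update S 0 a) = Fin.tail S := by
      ext i; simp [Fin.tail]
    have e2 : Fin.tail (Fin.tail (Function.update S 1 a)) = Fin.tail (Fin.tail S) := by
      ext i
      have : (i.succ.succ : Fin (m + 2)) ≠ 1 := by simp [Fin.ext_iff]
      simp [Fin.tail, this]
    have e3 : Fin.tail (Function.update S 1 a) 0 = a := by simp [Fin.tail]
    have e4 : Fin.tail S 0 = c := h1
    have e5 : Function.update S 1 a 0 = b := by simp [h0]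
    rw [e1, e2, e3, e4, e5, h0, Function.update_self]
    have h2 : 𝒜.extGen k b * 𝒜.extGen k a = -(𝒜.extGen k a * 𝒜.extGen k b) :=
      𝒜.extGen_mul_comm k b a
    have h3 := T.mul_mem_right _ (𝒜.monomial k (Fin.tail (Fin.tail S))) hT
    convert h3 using 1
    simp only [triangle, ← mul_assoc, h2, add_mul, sub_mul, neg_mul, sub_neg_eq_add]
  obtain ⟨σ, h0, h1⟩ : ∃ σ : Equiv.Perm (Fin (m + 2)), σ 0 = p ∧ σ 1 = q := by
    refine ⟨Equiv.swap 1 (Equiv.swap 0 p q) |>.trans (Equiv.swap 0 p), ?_, ?_⟩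
    · have h : (0 : Fin (m + 2)) ≠ Equiv.swap 0 p q := fun h => hpq (by
        have := congrArg (Equiv.swap 0 p) h
        rwa [Equiv.swap_apply_left, Equiv.swap_apply_self] at this)
      rw [Equiv.trans_apply, Equiv.swap_apply_of_ne_of_ne (a := 1) (x := 0) (by simp) h,
        Equiv.swap_apply_left]
    · rw [Equiv.trans_apply, Equiv.swap_apply_left, Equiv.swap_apply_self]
  have hσ : ∀ S : Fin (m + 2) → 𝒜.hyperplanes,
      𝒜.monomial k S = Equiv.Perm.sign σ • 𝒜.monomial k (S ∘ σ) := fun S => by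
    have h := (ExteriorAlgebra.ιMulti k (m + 2)).map_perm
      (fun i => (Finsupp.single (S i) 1 : 𝒜.hyperplanes →₀ k)) σ
    change 𝒜.monomial k (S ∘ σ) = Equiv.Perm.sign σ • 𝒜.monomial k S at h
    rw [h, smul_smul, Int.units_mul_self, one_smul]
  have h3 := key (S ∘ σ) (by simp [h0, hp]) (by simp [h1, hq])
  rw [hσ S, hσ (Function.update S p a), hσ (Function.update S q a), ← smul_sub, ← smul_sub,
    Function.update_comp_equiv, Function.update_comp_equiv, ← h0, ← h1, Equiv.symm_apply_apply,
    Equiv.symm_apply_apply]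
  rcases Int.units_eq_one_or (Equiv.Perm.sign σ) with h | h
  · rw [h, one_smul]; exact h3
  · rw [h, Units.neg_smul, one_smul]; exact neg_mem h3

/-- An ideal generated by relations `∂ (e_a e_b e_c)` is stable under `∂`. -/
theorem boundary_mem_span {s : Set (𝒜.Exterior k)} (hs : ∀ x ∈ s, ∃ a b c, x = 𝒜.triangle k a b c)
    {x : 𝒜.Exterior k} (hx : x ∈ TwoSidedIdeal.span s) :
    𝒜.boundary k x ∈ TwoSidedIdeal.span s := by
  set T := TwoSidedIdeal.span s with hT
  let K : TwoSidedIdeal (𝒜.Exterior k) := TwoSidedIdeal.mk'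
    {x | x ∈ T ∧ 𝒜.gradeInvolution k x ∈ T ∧ 𝒜.boundary k x ∈ T}
    ⟨zero_mem _, by rw [map_zero]; exact zero_mem _, by rw [map_zero]; exact zero_mem _⟩
    (fun {x y} hx hy => ⟨add_mem hx.1 hy.1, by rw [map_add]; exact add_mem hx.2.1 hy.2.1,
      by rw [map_add]; exact add_mem hx.2.2 hy.2.2⟩)
    (fun {x} hx => ⟨neg_mem hx.1, by rw [map_neg]; exact neg_mem hx.2.1,
      by rw [map_neg]; exact neg_mem hx.2.2⟩)
    (fun {x y} hy => ⟨T.mul_mem_left _ _ hy.1,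
      by rw [map_mul]; exact T.mul_mem_left _ _ hy.2.1,
      by rw [boundary_mul]
         exact add_mem (T.mul_mem_left _ _ hy.1) (T.mul_mem_left _ _ hy.2.2)⟩)
    (fun {x y} hx => ⟨T.mul_mem_right _ _ hx.1,
      by rw [map_mul]; exact T.mul_mem_right _ _ hx.2.1,
      by rw [boundary_mul]
         exact add_mem (T.mul_mem_right _ _ hx.2.2) (T.mul_mem_right _ _ hx.2.1)⟩)
  have hTK : T ≤ K := TwoSidedIdeal.span_le.2 fun x hx => by
    obtain ⟨a, b, c, rfl⟩ := hs x hx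
    refine (TwoSidedIdeal.mem_mk' _ _ _ _ _ _ _).2 ⟨TwoSidedIdeal.subset_span hx, ?_, ?_⟩
    · rw [gradeInvolution_triangle]; exact TwoSidedIdeal.subset_span hx
    · rw [boundary_triangle]; exact zero_mem _
  exact ((TwoSidedIdeal.mem_mk' _ _ _ _ _ _ _).1 (hTK hx)).2.2

end Boundary

section Grading

variable (k : Type*) [Field k] (𝒜 : CentralArrangement V)

theorem extGen_mem (H : 𝒜.hyperplanes) :
    𝒜.extGen k H ∈ ⋀[k]^1 (𝒜.hyperplanes →₀ k) := by
  rw [ExteriorAlgebra.exteriorPower, pow_one]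
  exact LinearMap.mem_range_self _ _

theorem osMk_mem {i : ℕ} {x : 𝒜.Exterior k} (hx : x ∈ ⋀[k]^i (𝒜.hyperplanes →₀ k)) :
    𝒜.osMk k x ∈ 𝒜.osGrading k i := Submodule.mem_map_of_mem hx

theorem osGen_mem (H : 𝒜.hyperplanes) : 𝒜.osGen k H ∈ 𝒜.osGrading k 1 :=
  𝒜.osMk_mem k (𝒜.extGen_mem k H)

theorem osGen_mem_plus (H : 𝒜.hyperplanes) : 𝒜.osGen k H ∈ BarComplex.plus (𝒜.osGrading k) :=
  BarComplex.mem_plus_of_mem one_pos (𝒜.osGen_mem k H)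

end Grading

end CentralArrangement


/-! ### Levelings of an arrangement -/

namespace CentralArrangement

open scoped ExteriorAlgebra

variable {V : Type*} [AddCommGroup V] [Module ℂ V] {𝒜 : CentralArrangement V}

section Codimension

variable [FiniteDimensional ℂ V]

theorem codim_lt_of_lt {P Q : Submodule ℂ V} (h : P < Q) :
    Module.finrank ℂ (V ⧸ Q) < Module.finrank ℂ (V ⧸ P) := by
  have h1 := Submodule.finrank_lt_finrank_of_lt h
  have h2 := P.finrank_quotient_add_finrank
  have h3 := Q.finrank_quotient_add_finrank
  omega

theorem codim_le_of_le {P Q : Submodule ℂ V} (h : P ≤ Q) :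
    Module.finrank ℂ (V ⧸ Q) ≤ Module.finrank ℂ (V ⧸ P) := by
  rcases h.eq_or_lt with rfl | h
  · exact le_rfl
  · exact (codim_lt_of_lt h).le

theorem codim_inf_le (P : Submodule ℂ V) {H : Submodule ℂ V} (hH : IsCoatom H) :
    Module.finrank ℂ (V ⧸ (P ⊓ H)) ≤ Module.finrank ℂ (V ⧸ P) + 1 := by
  have h1 : Module.finrank ℂ (V ⧸ H) = 1 := by
    have := isSimpleModule_iff_isCoatom.2 hH
    exact isSimpleModule_iff_finrank_eq_one.1 this
  have h2 := P.finrank_quotient_add_finrank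
  have h3 := H.finrank_quotient_add_finrank
  have h4 := (P ⊓ H).finrank_quotient_add_finrank
  have h5 := Submodule.finrank_sup_add_finrank_inf_eq P H
  have h6 := Submodule.finrank_le (P ⊔ H)
  omega

theorem codim_inf_inf_le {P Q R : Submodule ℂ V} (hP : IsCoatom P) (hQ : IsCoatom Q)
    (hR : IsCoatom R) : Module.finrank ℂ (V ⧸ (P ⊓ Q ⊓ R)) ≤ 3 := by
  have h1 := codim_inf_le (P ⊓ Q) hR
  have h2 := codim_inf_le P hQ
  have h3 := codim_inf_le ⊤ hP
  rw [top_inf_eq] at h3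
  have h4 : Module.finrank ℂ (V ⧸ (⊤ : Submodule ℂ V)) = 0 := Module.finrank_zero_of_subsingleton
  omega

theorem codim_inf_le_two {P Q : Submodule ℂ V} (hP : IsCoatom P) (hQ : IsCoatom Q) :
    Module.finrank ℂ (V ⧸ (P ⊓ Q)) ≤ 2 := by
  have h2 := codim_inf_le P hQ
  have h3 := codim_inf_le ⊤ hP
  rw [top_inf_eq] at h3
  have h4 : Module.finrank ℂ (V ⧸ (⊤ : Submodule ℂ V)) = 0 := Module.finrank_zero_of_subsingleton
  omega

end Codimension

theorem inf_eq_of_inf_le {a b c : 𝒜.hyperplanes} (hbc : b ≠ c) (hac : a ≠ c)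
    (h : (b : Submodule ℂ V) ⊓ c ≤ a) : (a : Submodule ℂ V) ⊓ c = (b : Submodule ℂ V) ⊓ c := by
  have ha := 𝒜.isCoatom a a.2
  have hb := 𝒜.isCoatom b b.2
  have hc := 𝒜.isCoatom c c.2
  have hne : (b : Submodule ℂ V) ≠ c := fun h => hbc (Subtype.ext h)
  have hne' : (a : Submodule ℂ V) ≠ c := fun h => hac (Subtype.ext h)
  have h1 : (b : Submodule ℂ V) ⊓ c ⋖ c := by
    refine inf_covBy_of_covBy_sup_left ?_
    rw [hb.sup_eq_top_of_ne hc hne]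
    exact hb.covBy_top
  rcases h1.eq_or_eq (le_inf h inf_le_right) inf_le_right with h2 | h2
  · exact h2
  · exact absurd (hc.le_iff_eq ha.1 |>.1 (inf_eq_right.1 h2)) hne'

variable (𝒜) in
/-- A partition of the hyperplanes into levels such that the intersection of two hyperplanes of
the same level lies in a hyperplane of smaller level, while no hyperplane contains the intersection
of all hyperplanes of smaller level. The levels come from a maximal chain of modular flats: the
level of a hyperplane is the position of the first flat of the chain which it contains. -/
structure Leveling where
  /-- The level of a hyperplane. -/
  lvl : 𝒜.hyperplanes → ℕ
  exists_low : ∀ b c, b ≠ c → lvl b = lvl c → ∃ a, lvl a < lvl b ∧ (b : Submodule ℂ V) ⊓ c ≤ a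
  exists_not_le : ∀ b, ∃ X : Submodule ℂ V, (∀ H, lvl H < lvl b → X ≤ H) ∧ ¬ X ≤ b

namespace Leveling

variable (L : 𝒜.Leveling)

open Classical in
/-- The hyperplane of smaller level which contains the intersection of two distinct hyperplanes
of the same level; a junk value for all other pairs. -/
noncomputable def low (b c : 𝒜.hyperplanes) : 𝒜.hyperplanes :=
  if h : b ≠ c ∧ L.lvl b = L.lvl c then (L.exists_low b c h.1 h.2).choose else b

theorem lvl_low {b c : 𝒜.hyperplanes} (hbc : b ≠ c) (h : L.lvl b = L.lvl c) :
    L.lvl (L.low b c) < L.lvl b := by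
  rw [low, dif_pos ⟨hbc, h⟩]
  exact (L.exists_low b c hbc h).choose_spec.1

theorem inf_le_low {b c : 𝒜.hyperplanes} (hbc : b ≠ c) (h : L.lvl b = L.lvl c) :
    (b : Submodule ℂ V) ⊓ c ≤ L.low b c := by
  rw [low, dif_pos ⟨hbc, h⟩]
  exact (L.exists_low b c hbc h).choose_spec.2

theorem eq_low {a b c : 𝒜.hyperplanes} (hbc : b ≠ c) (h : L.lvl b = L.lvl c)
    (ha : L.lvl a < L.lvl b) (hle : (b : Submodule ℂ V) ⊓ c ≤ a) : a = L.low b c := by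
  by_contra hne
  set a' := L.low b c with ha'
  have hab : a ≠ b := by rintro rfl; exact lt_irrefl _ ha
  have hac : a ≠ c := by rintro rfl; exact lt_irrefl _ (h ▸ ha)
  have h1 := inf_eq_of_inf_le hbc hac hle
  -- `a ⊓ c ≤ a'`, hence `a' ⊓ a = b ⊓ c ≤ b`, although no hyperplane of the level of `b` contains
  -- the intersection of all hyperplanes of smaller level
  have h2 : (c : Submodule ℂ V) ⊓ a ≤ a' := by
    rw [inf_comm, h1]; exact L.inf_le_low hbc h
  have h3 := inf_eq_of_inf_le hac.symm (Ne.symm hne) h2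
  obtain ⟨X, hX, hXb⟩ := L.exists_not_le b
  refine hXb ((le_inf (hX a' (L.lvl_low hbc h)) (hX a ha)).trans ?_)
  rw [h3, inf_comm, h1]
  exact inf_le_left

theorem low_comm {b c : 𝒜.hyperplanes} (hbc : b ≠ c) (h : L.lvl b = L.lvl c) :
    L.low b c = L.low c b :=
  L.eq_low hbc.symm h.symm (h ▸ L.lvl_low hbc h) (inf_comm (b : Submodule ℂ V) c ▸ L.inf_le_low hbc h)

variable [FiniteDimensional ℂ V]

/-- Hyperplanes of pairwise different levels are independent. -/
theorem card_le_codim {ι : Type*} (S : ι → 𝒜.hyperplanes) (s : Finset ι)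
    (hs : Set.InjOn (fun i => L.lvl (S i)) s) :
    s.card ≤ Module.finrank ℂ (V ⧸ (⨅ i ∈ s, (S i : Submodule ℂ V))) := by
  classical
  induction s using Finset.induction_on_max_value (fun i => L.lvl (S i)) with
  | empty => simp
  | insert a s has hmax ih =>
    rw [Finset.card_insert_of_notMem has]
    have hs' : Set.InjOn (fun i => L.lvl (S i)) s :=
      hs.mono (Finset.coe_subset.2 (Finset.subset_insert a s))
    refine Nat.succ_le_of_lt ((ih hs').trans_lt (codim_lt_of_lt ?_))
    rw [Finset.iInf_insert]
    refine inf_le_right.lt_of_not_ge fun hle => ?_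
    obtain ⟨X, hX, hXa⟩ := L.exists_not_le (S a)
    refine hXa (le_trans (le_iInf₂ fun i hi => hX _ ?_) (hle.trans inf_le_left))
    refine lt_of_le_of_ne (hmax i hi) fun he => has ?_
    have := hs (Finset.mem_coe.2 (Finset.mem_insert_of_mem hi))
      (Finset.mem_coe.2 (Finset.mem_insert_self a s)) he
    exact this ▸ hi

section

variable (k : Type*) [Field k]

/-- The quadratic relations attached to pairs of hyperplanes of the same level. -/
def relations : Set (𝒜.Exterior k) :=
  {x | ∃ a b c, b ≠ c ∧ L.lvl b = L.lvl c ∧ L.lvl a < L.lvl b ∧ (b : Submodule ℂ V) ⊓ c ≤ a ∧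
    x = 𝒜.triangle k a b c}

/-- The quadratic relations of a leveling generate the Orlik–Solomon ideal: by exchanges one lowers
the sum of the levels of a dependent monomial until two factors coincide. -/
theorem osIdeal_le_span : 𝒜.osIdeal k ≤ TwoSidedIdeal.span (L.relations k) := by
  set T := TwoSidedIdeal.span (L.relations k) with hT
  have hbd : ∀ x ∈ T, 𝒜.boundary k x ∈ T := fun x hx => 𝒜.boundary_mem_span k
    (by rintro x ⟨a, b, c, -, -, -, -, rfl⟩; exact ⟨a, b, c, rfl⟩) hx
  have key : ∀ N m, ∀ S : Fin m → 𝒜.hyperplanes, ∑ i, L.lvl (S i) = N →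
      Module.finrank ℂ (V ⧸ (⨅ i, (S i : Submodule ℂ V))) < m →
      𝒜.boundary k (𝒜.monomial k S) ∈ T := by
    intro N
    induction N using Nat.strong_induction_on with
    | _ N ih =>
    intro m S hN hm
    by_cases hinj : Function.Injective fun i => L.lvl (S i)
    · have := L.card_le_codim S Finset.univ hinj.injOn
      have e : (⨅ i ∈ Finset.univ, (S i : Submodule ℂ V)) = ⨅ i, (S i : Submodule ℂ V) := by simp
      rw [e, Finset.card_univ, Fintype.card_fin] at this
      omega
    by_cases hS : Function.Injective S
    swap
    · rw [monomial_eq_zero k 𝒜 hS, map_zero]; exact zero_mem _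
    obtain ⟨p, q, hl, hpq⟩ : ∃ p q, L.lvl (S p) = L.lvl (S q) ∧ p ≠ q := by
      simpa [Function.Injective] using hinj
    have hne : S p ≠ S q := fun h => hpq (hS h)
    set a := L.low (S p) (S q) with ha
    have hal := L.lvl_low hne hl
    have hle := L.inf_le_low hne hl
    have htri : 𝒜.triangle k a (S p) (S q) ∈ T :=
      TwoSidedIdeal.subset_span ⟨a, S p, S q, hne, hl, hal, hle, rfl⟩
    have step : ∀ p q, L.lvl a < L.lvl (S p) →
        (S p : Submodule ℂ V) ⊓ S q ≤ a →
        𝒜.boundary k (𝒜.monomial k (Function.update S p a)) ∈ T := by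
      intro p q hlt hinf
      refine ih _ ?_ m _ rfl ?_
      · rw [← hN]
        refine Finset.sum_lt_sum (fun i _ => ?_) ⟨p, Finset.mem_univ _, by simpa using hlt⟩
        by_cases hi : i = p
        · subst hi; simpa using hlt.le
        · simp [hi]
      · refine lt_of_le_of_lt (codim_le_of_le (le_iInf fun i => ?_)) hm
        by_cases hi : i = p
        · subst hi
          rw [Function.update_self]
          exact (le_inf (iInf_le _ i) (iInf_le _ q)).trans hinf
        · rw [Function.update_of_ne hi]
          exact iInf_le _ i
    have h1 := step p q hal hle
    have h2 := step q p (hl ▸ hal) (by rwa [inf_comm])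
    have h3 := hbd _ (monomial_sub_mem k 𝒜 htri S hpq rfl rfl)
    rw [map_sub, map_sub] at h3
    have := add_mem (add_mem h3 h1) h2
    convert this using 1
    abel
  refine TwoSidedIdeal.span_le.2 ?_
  rintro _ ⟨m, S, -, hm, rfl⟩
  exact key _ m S rfl hm

theorem triangle_mem_osIdeal {a b c : 𝒜.hyperplanes} (hle : (b : Submodule ℂ V) ⊓ c ≤ a) :
    𝒜.triangle k a b c ∈ 𝒜.osIdeal k := by
  refine 𝒜.triangle_mem k a b c ?_
  rw [inf_eq_right.2 hle]
  have := codim_inf_le_two (𝒜.isCoatom b b.2) (𝒜.isCoatom c c.2)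
  omega

theorem triangle_low_mem_osIdeal {b c e : 𝒜.hyperplanes} (hbc : b ≠ c) (hbe : b ≠ e) (hce : c ≠ e)
    (hlc : L.lvl b = L.lvl c) (hle : L.lvl b = L.lvl e) :
    𝒜.triangle k (L.low b c) (L.low b e) (L.low c e) ∈ 𝒜.osIdeal k := by
  refine 𝒜.triangle_mem k _ _ _ ?_
  set X := (L.low b c : Submodule ℂ V) ⊓ (L.low b e ⊓ L.low c e) with hX
  have hlce : L.lvl c = L.lvl e := hlc ▸ hle
  have h1 := codim_inf_inf_le (𝒜.isCoatom b b.2) (𝒜.isCoatom c c.2) (𝒜.isCoatom e e.2)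
  have h2 : (b : Submodule ℂ V) ⊓ c ⊓ e < X := by
    refine lt_of_le_of_ne (le_inf ?_ (le_inf ?_ ?_)) fun h => ?_
    · exact inf_le_left.trans (L.inf_le_low hbc hlc)
    · exact (le_inf (inf_le_left.trans inf_le_left) inf_le_right).trans (L.inf_le_low hbe hle)
    · exact (le_inf (inf_le_left.trans inf_le_right) inf_le_right).trans (L.inf_le_low hce hlce)
    · obtain ⟨Y, hY, hYb⟩ := L.exists_not_le b
      refine hYb (le_trans ?_ ((h ▸ inf_le_left.trans inf_le_left : X ≤ b)))
      exact le_inf (hY _ (L.lvl_low hbc hlc)) (le_inf (hY _ (L.lvl_low hbe hle))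
        (hY _ (hlc ▸ L.lvl_low hce hlce)))
  have h3 := codim_lt_of_lt h2
  omega

end

end Leveling

end CentralArrangement


/-! ### The Orlik–Solomon algebra as a free module over its lower levels -/

namespace CentralArrangement

namespace Leveling

variable {V : Type*} [AddCommGroup V] [Module ℂ V] {𝒜 : CentralArrangement V}
  (L : 𝒜.Leveling) (k : Type*) [Field k]

/-- The hyperplanes of level `i`. -/
abbrev Fiber (i : ℕ) : Type _ := {b : 𝒜.hyperplanes // L.lvl b = i}

instance (i : ℕ) : Finite (L.Fiber i) :=
  have : Finite 𝒜.hyperplanes := 𝒜.finite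
  inferInstance

noncomputable instance (i : ℕ) : Fintype (L.Fiber i) := Fintype.ofFinite _

open Classical in
/-- For `b`, `c` of the same level, the class of the hyperplane of smaller level through
`b ∩ c`, and zero if `b = c`. -/
noncomputable def lowGen {i : ℕ} (b c : L.Fiber i) : 𝒜.OSAlgebra k :=
  if b = c then 0 else 𝒜.osGen k (L.low b.1 c.1)

/-- The module `A ⊕ ⨁_b e_b A`, where `b` runs through the hyperplanes of level `i`. -/
abbrev FreeModel (i : ℕ) : Type _ := 𝒜.OSAlgebra k × (L.Fiber i → 𝒜.OSAlgebra k)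

/-- Left multiplication by a generator of smaller level on `A ⊕ ⨁_b e_b A`. -/
noncomputable def lowAct (i : ℕ) (H : 𝒜.hyperplanes) : Module.End k (L.FreeModel k i) :=
  LinearMap.prodMap (LinearMap.mulLeft k (𝒜.osGen k H))
    (-LinearMap.compLeft (LinearMap.mulLeft k (𝒜.osGen k H)) (L.Fiber i))

open Classical in
/-- Left multiplication by `e_b` on `A ⊕ ⨁_c e_c A`, dictated by the relation
`e_b e_c = e_a (e_c - e_b)`, where `a` is the hyperplane of smaller level through `b ∩ c`. -/
noncomputable def fiberAct {i : ℕ} (b : L.Fiber i) : Module.End k (L.FreeModel k i) where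
  toFun x := (0, fun d => (if d = b then x.1 + ∑ c, L.lowGen k b c * x.2 c else 0) -
    L.lowGen k b d * x.2 d)
  map_add' x y := by
    refine Prod.ext (add_zero 0).symm (funext fun d => ?_)
    simp only [Prod.fst_add, Prod.snd_add, Pi.add_apply, mul_add, Finset.sum_add_distrib]
    split_ifs <;> abel
  map_smul' r x := by
    refine Prod.ext (smul_zero r).symm (funext fun d => ?_)
    simp only [Prod.smul_fst, Prod.smul_snd, Pi.smul_apply, mul_smul_comm, ← Finset.smul_sum,
      ← smul_add, RingHom.id_apply, smul_sub]
    split_ifs <;> simp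

theorem lowAct_fst (i : ℕ) (H : 𝒜.hyperplanes) (x : L.FreeModel k i) :
    (L.lowAct k i H x).1 = 𝒜.osGen k H * x.1 := rfl

theorem lowAct_snd (i : ℕ) (H : 𝒜.hyperplanes) (x : L.FreeModel k i) (d : L.Fiber i) :
    (L.lowAct k i H x).2 d = -(𝒜.osGen k H * x.2 d) := rfl

theorem fiberAct_fst {i : ℕ} (b : L.Fiber i) (x : L.FreeModel k i) :
    (L.fiberAct k b x).1 = 0 := rfl

open Classical in
theorem fiberAct_snd {i : ℕ} (b : L.Fiber i) (x : L.FreeModel k i) (d : L.Fiber i) :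
    (L.fiberAct k b x).2 d = (if d = b then x.1 + ∑ c, L.lowGen k b c * x.2 c else 0) -
      L.lowGen k b d * x.2 d := rfl

@[simp] theorem lowGen_self {i : ℕ} (b : L.Fiber i) : L.lowGen k b b = 0 := if_pos rfl

theorem lowGen_of_ne {i : ℕ} {b c : L.Fiber i} (h : b ≠ c) :
    L.lowGen k b c = 𝒜.osGen k (L.low b.1 c.1) := if_neg h

theorem lowGen_comm {i : ℕ} (b c : L.Fiber i) : L.lowGen k b c = L.lowGen k c b := by
  by_cases h : b = c
  · rw [h]
  · rw [lowGen_of_ne L k h, lowGen_of_ne L k (Ne.symm h),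
      L.low_comm (fun h' => h (Subtype.ext h')) (b.2.trans c.2.symm)]

@[simp] theorem lowGen_mul_self {i : ℕ} (b c : L.Fiber i) :
    L.lowGen k b c * L.lowGen k b c = 0 := by
  by_cases h : b = c
  · rw [h, lowGen_self, zero_mul]
  · rw [lowGen_of_ne L k h, osGen_mul_self]

theorem osGen_mul_lowGen {i : ℕ} (H : 𝒜.hyperplanes) (b c : L.Fiber i) :
    𝒜.osGen k H * L.lowGen k b c = -(L.lowGen k b c * 𝒜.osGen k H) := by
  by_cases h : b = c
  · rw [h, lowGen_self, zero_mul, mul_zero, neg_zero]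
  rw [lowGen_of_ne L k h, osGen_mul_comm]

theorem sum_lowGen_mul_fiberAct {i : ℕ} (b c : L.Fiber i) (x : L.FreeModel k i) :
    ∑ e, L.lowGen k b e * (L.fiberAct k c x).2 e =
      L.lowGen k b c * (x.1 + ∑ e, L.lowGen k c e * x.2 e) -
        ∑ e, L.lowGen k b e * L.lowGen k c e * x.2 e := by
  classical
  simp only [fiberAct_snd, mul_sub, Finset.sum_sub_distrib, mul_ite, mul_zero, Finset.sum_ite_eq',
    Finset.mem_univ, if_true, mul_assoc]

theorem lowAct_mul_fiberAct {i : ℕ} (H : 𝒜.hyperplanes) (b : L.Fiber i) :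
    L.lowAct k i H * L.fiberAct k b + L.fiberAct k b * L.lowAct k i H = 0 := by
  classical
  refine LinearMap.ext fun x => Prod.ext ?_ (funext fun d => ?_)
  · change 𝒜.osGen k H * 0 + (0 : 𝒜.OSAlgebra k) = 0
    rw [mul_zero, zero_add]
  change -(𝒜.osGen k H * (L.fiberAct k b x).2 d) + (L.fiberAct k b (L.lowAct k i H x)).2 d = 0
  simp only [fiberAct_snd, lowAct_fst, lowAct_snd]
  have h : ∀ c, L.lowGen k b c * -(𝒜.osGen k H * x.2 c) =
      𝒜.osGen k H * (L.lowGen k b c * x.2 c) := fun c => by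
    rw [← mul_assoc (𝒜.osGen k H), osGen_mul_lowGen, mul_neg, ← mul_assoc, neg_mul]
  simp only [h, ← Finset.mul_sum, mul_sub]
  split_ifs
  · rw [mul_add]; abel
  · rw [mul_zero]; abel

theorem lowAct_mul_lowAct (i : ℕ) (H H' : 𝒜.hyperplanes) (x : L.FreeModel k i) :
    (L.lowAct k i H * L.lowAct k i H') x =
      (𝒜.osGen k H * 𝒜.osGen k H' * x.1, fun d => 𝒜.osGen k H * 𝒜.osGen k H' * x.2 d) := by
  refine Prod.ext (mul_assoc (𝒜.osGen k H) (𝒜.osGen k H') x.1).symm (funext fun d => ?_)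
  change -(𝒜.osGen k H * -(𝒜.osGen k H' * x.2 d)) = _
  rw [mul_neg, neg_neg]
  exact (mul_assoc _ _ _).symm

open Classical in
/-- The action of the generators on `A ⊕ ⨁_b e_b A`; those of level larger than `i` act
by zero. -/
noncomputable def genAct (i : ℕ) (H : 𝒜.hyperplanes) : Module.End k (L.FreeModel k i) :=
  if L.lvl H < i then L.lowAct k i H else if h : L.lvl H = i then L.fiberAct k ⟨H, h⟩ else 0

theorem genAct_of_lt {i : ℕ} {H : 𝒜.hyperplanes} (h : L.lvl H < i) :
    L.genAct k i H = L.lowAct k i H := if_pos h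

theorem genAct_coe {i : ℕ} (b : L.Fiber i) : L.genAct k i b.1 = L.fiberAct k b := by
  rw [genAct, if_neg (by rw [b.2]; exact lt_irrefl _), dif_pos b.2]

theorem genAct_of_gt {i : ℕ} {H : 𝒜.hyperplanes} (h : i < L.lvl H) : L.genAct k i H = 0 := by
  rw [genAct, if_neg h.not_gt, dif_neg h.ne']

theorem fiberAct_mul_self {i : ℕ} (b : L.Fiber i) : L.fiberAct k b * L.fiberAct k b = 0 := by
  classical
  refine LinearMap.ext fun x => Prod.ext rfl (funext fun d => ?_)
  change (L.fiberAct k b (L.fiberAct k b x)).2 d = 0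
  rw [fiberAct_snd, sum_lowGen_mul_fiberAct, fiberAct_fst]
  simp only [lowGen_mul_self, zero_mul, Finset.sum_const_zero, lowGen_self, sub_zero, zero_add,
    ite_self, zero_sub]
  rw [fiberAct_snd]
  by_cases h : d = b
  · rw [h, lowGen_self, zero_mul, neg_zero]
  · rw [if_neg h, zero_sub, mul_neg, ← mul_assoc, lowGen_mul_self, zero_mul, neg_zero, neg_zero]

theorem genAct_mul_self (i : ℕ) (H : 𝒜.hyperplanes) : L.genAct k i H * L.genAct k i H = 0 := by
  rcases lt_trichotomy (L.lvl H) i with h | h | h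
  · rw [genAct_of_lt L k h]
    refine LinearMap.ext fun x => ?_
    rw [lowAct_mul_lowAct, osGen_mul_self]
    exact Prod.ext (zero_mul _) (funext fun _ => zero_mul _)
  · rw [show H = (⟨H, h⟩ : L.Fiber i).1 from rfl, genAct_coe, fiberAct_mul_self]
  · rw [genAct_of_gt L k h, zero_mul]

variable [FiniteDimensional ℂ V]

/-- The three hyperplanes of smaller level obtained from three hyperplanes of the same level are
dependent. -/
theorem lowGen_relation {i : ℕ} {b c : L.Fiber i} (hbc : b ≠ c) (e : L.Fiber i) :
    L.lowGen k b c * L.lowGen k c e =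
      L.lowGen k b e * L.lowGen k c e + L.lowGen k b c * L.lowGen k b e := by
  by_cases hbe : b = e
  · subst hbe
    rw [lowGen_comm L k c b, lowGen_mul_self, lowGen_self, zero_mul, mul_zero, add_zero]
  by_cases hce : c = e
  · subst hce
    rw [lowGen_self, mul_zero, lowGen_mul_self, add_zero]
  have h := L.triangle_low_mem_osIdeal k (b := b.1) (c := c.1) (e := e.1)
    (fun h => hbc (Subtype.ext h)) (fun h => hbe (Subtype.ext h)) (fun h => hce (Subtype.ext h))
    (b.2.trans c.2.symm) (b.2.trans e.2.symm)
  rw [← osMk_eq_zero_iff, triangle, map_add, map_sub, map_mul, map_mul, map_mul] at h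
  rw [lowGen_of_ne L k hbc, lowGen_of_ne L k hbe, lowGen_of_ne L k hce]
  change 𝒜.osGen k _ * 𝒜.osGen k _ - 𝒜.osGen k _ * 𝒜.osGen k _ +
    𝒜.osGen k _ * 𝒜.osGen k _ = 0 at h
  rw [← sub_eq_zero, ← neg_eq_zero, ← h]
  abel

/-- The product `e_b e_c` of two generators of level `i` acts like `e_a (e_c - e_b)`. -/
theorem fiberAct_mul_fiberAct {i : ℕ} {b c : L.Fiber i} (hbc : b ≠ c) :
    L.fiberAct k b * L.fiberAct k c = L.lowAct k i (L.low b.1 c.1) * L.fiberAct k c -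
      L.lowAct k i (L.low b.1 c.1) * L.fiberAct k b := by
  classical
  refine LinearMap.ext fun x => Prod.ext ?_ (funext fun d => ?_)
  · change (0 : 𝒜.OSAlgebra k) = 𝒜.osGen k _ * 0 - 𝒜.osGen k _ * 0
    rw [mul_zero, sub_zero]
  change (L.fiberAct k b (L.fiberAct k c x)).2 d =
    -(𝒜.osGen k (L.low b.1 c.1) * (L.fiberAct k c x).2 d) -
      -(𝒜.osGen k (L.low b.1 c.1) * (L.fiberAct k b x).2 d)
  rw [← lowGen_of_ne L k hbc, fiberAct_snd, sum_lowGen_mul_fiberAct, fiberAct_fst, zero_add,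
    fiberAct_snd, fiberAct_snd]
  have hrel : ∀ e, L.lowGen k b e * (L.lowGen k c e * x.2 e) =
      L.lowGen k b c * (L.lowGen k c e * x.2 e) - L.lowGen k b c * (L.lowGen k b e * x.2 e) := by
    intro e
    have := congrArg (· * x.2 e) (lowGen_relation L k hbc e)
    simp only [add_mul, mul_assoc] at this
    rw [this, add_sub_cancel_right]
  by_cases hdb : d = b
  · subst hdb
    rw [if_pos rfl, if_neg hbc, if_pos rfl, lowGen_self, lowGen_comm L k c d]
    simp only [mul_assoc, hrel, Finset.sum_sub_distrib, ← Finset.mul_sum, mul_add,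
      zero_mul, zero_sub, mul_neg, sub_zero]
    rw [← mul_assoc (L.lowGen k d c) (L.lowGen k d c), lowGen_mul_self, zero_mul]
    abel
  by_cases hdc : d = c
  · subst hdc
    rw [if_neg hdb, if_pos rfl, if_neg hdb, lowGen_self]
    simp only [zero_mul, sub_zero, zero_sub, mul_neg]
    rw [← mul_assoc (L.lowGen k b d) (L.lowGen k b d), lowGen_mul_self, zero_mul]
    abel
  · rw [if_neg hdb, if_neg hdc, if_neg hdb]
    simp only [zero_sub, mul_neg, neg_neg, hrel]

theorem fiberAct_anticomm {i : ℕ} (b c : L.Fiber i) :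
    L.fiberAct k b * L.fiberAct k c + L.fiberAct k c * L.fiberAct k b = 0 := by
  by_cases h : b = c
  · subst h; rw [fiberAct_mul_self, add_zero]
  · rw [fiberAct_mul_fiberAct L k h, fiberAct_mul_fiberAct L k (Ne.symm h),
      ← L.low_comm (fun h' => h (Subtype.ext h')) (b.2.trans c.2.symm)]
    abel

theorem genAct_anticomm (i : ℕ) (H H' : 𝒜.hyperplanes) :
    L.genAct k i H * L.genAct k i H' + L.genAct k i H' * L.genAct k i H = 0 := by
  rcases lt_trichotomy (L.lvl H) i with h | h | h
  · rcases lt_trichotomy (L.lvl H') i with h' | h' | h'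
    · rw [genAct_of_lt L k h, genAct_of_lt L k h']
      refine LinearMap.ext fun x => ?_
      rw [LinearMap.add_apply, lowAct_mul_lowAct, lowAct_mul_lowAct, osGen_mul_comm k 𝒜 H H']
      refine Prod.ext ?_ (funext fun _ => ?_)
      · change -(_ * _) * _ + _ * _ * _ = (0 : 𝒜.OSAlgebra k)
        rw [neg_mul, neg_add_cancel]
      · change -(_ * _) * _ + _ * _ * _ = (0 : 𝒜.OSAlgebra k)
        rw [neg_mul, neg_add_cancel]
    · rw [show H' = (⟨H', h'⟩ : L.Fiber i).1 from rfl, genAct_coe, genAct_of_lt L k h,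
        lowAct_mul_fiberAct]
    · rw [genAct_of_gt L k h', mul_zero, zero_mul, add_zero]
  · rcases lt_trichotomy (L.lvl H') i with h' | h' | h'
    · rw [show H = (⟨H, h⟩ : L.Fiber i).1 from rfl, genAct_coe, genAct_of_lt L k h', add_comm,
        lowAct_mul_fiberAct]
    · rw [show H = (⟨H, h⟩ : L.Fiber i).1 from rfl, show H' = (⟨H', h'⟩ : L.Fiber i).1 from rfl,
        genAct_coe, genAct_coe, fiberAct_anticomm]
    · rw [genAct_of_gt L k h', mul_zero, zero_mul, add_zero]
  · rw [genAct_of_gt L k h, mul_zero, zero_mul, add_zero]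

theorem genAct_relation (i : ℕ) {a b c : 𝒜.hyperplanes} (hbc : b ≠ c) (h : L.lvl b = L.lvl c)
    (ha : L.lvl a < L.lvl b) (hle : (b : Submodule ℂ V) ⊓ c ≤ a) :
    L.genAct k i b * L.genAct k i c - L.genAct k i a * L.genAct k i c +
      L.genAct k i a * L.genAct k i b = 0 := by
  rcases lt_trichotomy (L.lvl b) i with hb | hb | hb
  · rw [genAct_of_lt L k hb, genAct_of_lt L k (h ▸ hb), genAct_of_lt L k (ha.trans hb)]
    have h1 := triangle_mem_osIdeal k hle
    rw [← osMk_eq_zero_iff, triangle, map_add, map_sub, map_mul, map_mul, map_mul] at h1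
    change 𝒜.osGen k _ * 𝒜.osGen k _ - 𝒜.osGen k _ * 𝒜.osGen k _ +
      𝒜.osGen k _ * 𝒜.osGen k _ = 0 at h1
    refine LinearMap.ext fun x => ?_
    rw [LinearMap.add_apply, LinearMap.sub_apply, lowAct_mul_lowAct, lowAct_mul_lowAct,
      lowAct_mul_lowAct]
    refine Prod.ext ?_ (funext fun d => ?_)
    · change _ * _ - _ * _ + _ * _ = (0 : 𝒜.OSAlgebra k)
      rw [← sub_mul, ← add_mul, h1, zero_mul]
    · change _ * _ - _ * _ + _ * _ = (0 : 𝒜.OSAlgebra k)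
      rw [← sub_mul, ← add_mul, h1, zero_mul]
  · have hne : (⟨b, hb⟩ : L.Fiber i) ≠ ⟨c, h ▸ hb⟩ := fun h => hbc (congrArg Subtype.val h)
    have h1 := fiberAct_mul_fiberAct L k hne
    rw [← genAct_coe, ← genAct_coe, ← L.eq_low hbc h ha hle, ← genAct_of_lt L k (hb ▸ ha)] at h1
    rw [h1]
    abel
  · rw [genAct_of_gt L k hb, genAct_of_gt L k (h ▸ hb)]
    simp

/-- An anticommuting family satisfying the quadratic relations of a leveling defines a
homomorphism from the Orlik–Solomon algebra. -/
noncomputable def hom {R : Type*} [Ring R] [Algebra k R] (f : 𝒜.hyperplanes → R)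
    (h2 : ∀ H, f H * f H = 0) (ha : ∀ H H', f H * f H' + f H' * f H = 0)
    (hf : ∀ a b c, b ≠ c → L.lvl b = L.lvl c → L.lvl a < L.lvl b → (b : Submodule ℂ V) ⊓ c ≤ a →
      f b * f c - f a * f c + f a * f b = 0) : 𝒜.OSAlgebra k →ₐ[k] R :=
  osLift (extLift f h2 ha) (L.relations k) (L.osIdeal_le_span k) (by
    rintro _ ⟨a, b, c, hbc, h, hlt, hle, rfl⟩
    simp only [triangle, map_add, map_sub, map_mul, extLift_extGen]
    exact hf a b c hbc h hlt hle)

theorem hom_osGen {R : Type*} [Ring R] [Algebra k R] (f : 𝒜.hyperplanes → R)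
    (h2 : ∀ H, f H * f H = 0) (ha : ∀ H H', f H * f H' + f H' * f H = 0)
    (hf : ∀ a b c, b ≠ c → L.lvl b = L.lvl c → L.lvl a < L.lvl b → (b : Submodule ℂ V) ⊓ c ≤ a →
      f b * f c - f a * f c + f a * f b = 0) (H : 𝒜.hyperplanes) :
    L.hom k f h2 ha hf (𝒜.osGen k H) = f H :=
  (osLift_osMk _ _ _ _ _).trans (extLift_extGen f h2 ha H)

/-- The action of the Orlik–Solomon algebra on `A ⊕ ⨁_b e_b A`. -/
noncomputable def act (i : ℕ) : 𝒜.OSAlgebra k →ₐ[k] Module.End k (L.FreeModel k i) :=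
  L.hom k (L.genAct k i) (L.genAct_mul_self k i) (L.genAct_anticomm k i)
    fun _ _ _ => L.genAct_relation k i

@[simp] theorem act_osGen (i : ℕ) (H : 𝒜.hyperplanes) :
    L.act k i (𝒜.osGen k H) = L.genAct k i H := L.hom_osGen k _ _ _ _ H

open Classical in
/-- The retraction of the Orlik–Solomon algebra onto the subalgebra generated by the hyperplanes
of level less than `i`. -/
noncomputable def trunc (i : ℕ) : 𝒜.OSAlgebra k →ₐ[k] 𝒜.OSAlgebra k :=
  L.hom k (fun H => if L.lvl H < i then 𝒜.osGen k H else 0)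
    (fun H => by split_ifs <;> simp [osGen_mul_self])
    (fun H H' => by
      split_ifs
      · rw [osGen_mul_comm, neg_add_cancel]
      all_goals simp)
    (fun a b c hbc h ha hle => by
      by_cases hb : L.lvl b < i
      · rw [if_pos hb, if_pos (h ▸ hb), if_pos (ha.trans hb)]
        have h1 := triangle_mem_osIdeal k hle
        rw [← osMk_eq_zero_iff, triangle, map_add, map_sub, map_mul, map_mul, map_mul] at h1
        exact h1
      · rw [if_neg hb, if_neg (h ▸ hb)]
        simp)

theorem trunc_osGen_of_lt {i : ℕ} {H : 𝒜.hyperplanes} (h : L.lvl H < i) :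
    L.trunc k i (𝒜.osGen k H) = 𝒜.osGen k H := (L.hom_osGen k _ _ _ _ H).trans (if_pos h)

theorem trunc_osGen_of_ge {i : ℕ} {H : 𝒜.hyperplanes} (h : i ≤ L.lvl H) :
    L.trunc k i (𝒜.osGen k H) = 0 := (L.hom_osGen k _ _ _ _ H).trans (if_neg h.not_gt)

/-- The augmentation of the Orlik–Solomon algebra. -/
noncomputable def aug : 𝒜.OSAlgebra k →ₐ[k] k :=
  L.hom k (fun _ => 0) (fun _ => by simp) (fun _ _ => by simp) (fun _ _ _ _ _ _ _ => by simp)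

@[simp] theorem aug_osGen (H : 𝒜.hyperplanes) : L.aug k (𝒜.osGen k H) = 0 :=
  L.hom_osGen k _ _ _ _ H

/-- The coefficient of `e_b` in the decomposition of the Orlik–Solomon algebra. -/
noncomputable def coeff {i : ℕ} (b : L.Fiber i) (a : 𝒜.OSAlgebra k) : 𝒜.OSAlgebra k :=
  (L.act k i a (1, 0)).2 b

/-- A subspace of `A ⊕ ⨁_b e_b A` which is stable under the generators is stable under `A`. -/
theorem act_mem {i : ℕ} (N : Submodule k (L.FreeModel k i))
    (hN : ∀ H, ∀ x ∈ N, L.genAct k i H x ∈ N) (a : 𝒜.OSAlgebra k) {x : L.FreeModel k i}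
    (hx : x ∈ N) : L.act k i a x ∈ N := by
  refine 𝒜.os_induction k (P := fun a => L.act k i a x ∈ N) ?_ ?_ ?_ ?_ a
  · rwa [map_one]
  · intro a b ha hb; rw [map_add]; exact add_mem ha hb
  · intro c a ha; rw [map_smul]; exact N.smul_mem c ha
  · intro H a ha
    rw [map_mul, act_osGen]
    exact hN H _ ha

/-- The action commutes with right multiplication. -/
theorem act_mul_right {i : ℕ} (a r : 𝒜.OSAlgebra k) (x : L.FreeModel k i) :
    L.act k i a (x.1 * r, fun d => x.2 d * r) =
      ((L.act k i a x).1 * r, fun d => (L.act k i a x).2 d * r) := by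
  classical
  let R : Module.End k (L.FreeModel k i) :=
    LinearMap.prodMap (LinearMap.mulRight k r) (LinearMap.compLeft (LinearMap.mulRight k r) _)
  change L.act k i a (R x) = R (L.act k i a x)
  refine 𝒜.os_induction k (P := fun a => L.act k i a (R x) = R (L.act k i a x)) ?_ ?_ ?_ ?_ a
  · simp
  · intro a b ha hb
    rw [map_add, LinearMap.add_apply, LinearMap.add_apply, map_add, ha, hb]
  · intro c a ha
    rw [map_smul, LinearMap.smul_apply, LinearMap.smul_apply, map_smul, ha]
  · intro H a ha
    rw [map_mul, act_osGen, Module.End.mul_apply, Module.End.mul_apply, ha]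
    generalize L.act k i a x = y
    rcases lt_trichotomy (L.lvl H) i with h | h | h
    · rw [genAct_of_lt L k h]
      refine Prod.ext (mul_assoc (𝒜.osGen k H) y.1 r).symm (funext fun d => ?_)
      change -(𝒜.osGen k H * (y.2 d * r)) = -(𝒜.osGen k H * y.2 d) * r
      rw [neg_mul, mul_assoc]
    · rw [show H = (⟨H, h⟩ : L.Fiber i).1 from rfl, genAct_coe]
      refine Prod.ext (zero_mul r).symm (funext fun d => ?_)
      change (if _ then _ * r + ∑ c, _ * (_ * r) else 0) - _ * (_ * r) =
        ((if _ then _ + ∑ c, _ * _ else 0) - _ * _) * r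
      simp only [← mul_assoc, ← Finset.sum_mul, ← add_mul, sub_mul, ite_mul, zero_mul,
        LinearMap.fst_apply, LinearMap.snd_apply]
    · rw [genAct_of_gt L k h]
      simp

theorem act_fst (i : ℕ) (a : 𝒜.OSAlgebra k) : (L.act k i a (1, 0)).1 = L.trunc k i a := by
  refine 𝒜.os_induction k (P := fun a => (L.act k i a (1, 0)).1 = L.trunc k i a) ?_ ?_ ?_ ?_ a
  · simp
  · intro a b ha hb
    rw [map_add, map_add, LinearMap.add_apply, Prod.fst_add, ha, hb]
  · intro c a ha
    rw [map_smul, map_smul, LinearMap.smul_apply, Prod.smul_fst, ha]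
  · intro H a ha
    rw [map_mul, act_osGen, Module.End.mul_apply, map_mul, ← ha]
    rcases lt_trichotomy (L.lvl H) i with h | h | h
    · rw [genAct_of_lt L k h, trunc_osGen_of_lt L k h]; rfl
    · rw [show H = (⟨H, h⟩ : L.Fiber i).1 from rfl, genAct_coe, trunc_osGen_of_ge L k h.ge, zero_mul]
      rfl
    · rw [genAct_of_gt L k h, trunc_osGen_of_ge L k h.le, zero_mul]; rfl

/-- The coefficients lie in the subalgebra generated by the hyperplanes of smaller level. -/
theorem trunc_coeff {i : ℕ} (b : L.Fiber i) (a : 𝒜.OSAlgebra k) :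
    L.trunc k i (L.coeff k b a) = L.coeff k b a := by
  classical
  let N : Submodule k (L.FreeModel k i) :=
    { carrier := {x | L.trunc k i x.1 = x.1 ∧ ∀ d, L.trunc k i (x.2 d) = x.2 d}
      zero_mem' := ⟨map_zero _, fun _ => map_zero _⟩
      add_mem' := fun {x y} hx hy => ⟨(map_add _ _ _).trans (congrArg₂ _ hx.1 hy.1),
        fun d => (map_add _ _ _).trans (congrArg₂ _ (hx.2 d) (hy.2 d))⟩
      smul_mem' := fun c x hx => ⟨(map_smul _ _ _).trans (congrArg _ hx.1),
        fun d => (map_smul _ _ _).trans (congrArg _ (hx.2 d))⟩ }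
  have hlow : ∀ b c : L.Fiber i, L.trunc k i (L.lowGen k b c) = L.lowGen k b c := fun b c => by
    by_cases h : b = c
    · rw [h, lowGen_self, map_zero]
    · rw [lowGen_of_ne L k h, trunc_osGen_of_lt]
      conv_rhs => rw [← b.2]
      exact L.lvl_low (fun h' => h (Subtype.ext h')) (b.2.trans c.2.symm)
  refine (L.act_mem k N (fun H x hx => ?_) a (x := (1, 0))
    ⟨map_one _, fun _ => map_zero _⟩).2 b
  rcases lt_trichotomy (L.lvl H) i with h | h | h
  · rw [genAct_of_lt L k h]
    refine ⟨?_, fun d => ?_⟩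
    · rw [lowAct_fst, map_mul, trunc_osGen_of_lt L k h, hx.1]
    · rw [lowAct_snd, map_neg, map_mul, trunc_osGen_of_lt L k h, hx.2]
  · rw [show H = (⟨H, h⟩ : L.Fiber i).1 from rfl, genAct_coe]
    refine ⟨map_zero _, fun d => ?_⟩
    rw [fiberAct_snd, map_sub, map_mul, hlow, hx.2]
    split_ifs
    · simp only [map_add, map_sum, map_mul, hlow, hx.1, hx.2]
    · rw [map_zero]
  · rw [genAct_of_gt L k h]
    exact zero_mem N

/-- The decomposition of the subalgebra generated by the levels up to `i` as a free module over the
subalgebra generated by the levels less than `i`. -/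
theorem trunc_succ (i : ℕ) (a : 𝒜.OSAlgebra k) : L.trunc k (i + 1) a =
    L.trunc k i a + ∑ b : L.Fiber i, 𝒜.osGen k b.1 * L.coeff k b a := by
  classical
  let Φ : L.FreeModel k i → 𝒜.OSAlgebra k := fun x => x.1 + ∑ b : L.Fiber i, 𝒜.osGen k b.1 * x.2 b
  suffices H : L.trunc k (i + 1) a = Φ (L.act k i a (1, 0)) by
    rw [H, ← act_fst]; rfl
  refine 𝒜.os_induction k (P := fun a => L.trunc k (i + 1) a = Φ (L.act k i a (1, 0)))
    ?_ ?_ ?_ ?_ a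
  · simp [Φ]
  · intro a b ha hb
    rw [map_add, map_add, LinearMap.add_apply, ha, hb]
    simp only [Φ, Prod.fst_add, Prod.snd_add, Pi.add_apply, mul_add, Finset.sum_add_distrib]
    abel
  · intro c a ha
    rw [map_smul, map_smul, LinearMap.smul_apply, ha]
    simp only [Φ, Prod.smul_fst, Prod.smul_snd, Pi.smul_apply, mul_smul_comm, ← Finset.smul_sum,
      smul_add]
  · intro H a ha
    rw [map_mul, map_mul, ha, act_osGen, Module.End.mul_apply]
    generalize L.act k i a (1, 0) = x
    simp only [Φ]
    rcases lt_trichotomy (L.lvl H) i with h | h | h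
    · rw [genAct_of_lt L k h, trunc_osGen_of_lt L k (by omega), lowAct_fst, mul_add,
        Finset.mul_sum]
      congr 1
      refine Finset.sum_congr rfl fun b _ => ?_
      rw [lowAct_snd, ← mul_assoc, osGen_mul_comm, mul_neg, neg_mul, mul_assoc]
    · rw [trunc_osGen_of_lt L k (by omega)]
      obtain ⟨b, rfl⟩ : ∃ b : L.Fiber i, b.1 = H := ⟨⟨H, h⟩, rfl⟩
      rw [genAct_coe, fiberAct_fst, zero_add]
      simp only [fiberAct_snd, mul_sub, mul_ite, mul_zero, Finset.sum_sub_distrib,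
        Finset.sum_ite_eq', Finset.mem_univ, if_true, mul_add, Finset.mul_sum]
      rw [add_sub_assoc, ← Finset.sum_sub_distrib]
      congr 1
      refine Finset.sum_congr rfl fun c _ => ?_
      by_cases hbc : b = c
      · subst hbc
        rw [← mul_assoc, osGen_mul_self, lowGen_self]
        simp
      · have hne : b.1 ≠ c.1 := fun h => hbc (Subtype.ext h)
        have h1 := triangle_mem_osIdeal k (L.inf_le_low hne (b.2.trans c.2.symm))
        rw [← osMk_eq_zero_iff, triangle, map_add, map_sub, map_mul, map_mul, map_mul] at h1
        change 𝒜.osGen k _ * 𝒜.osGen k _ - 𝒜.osGen k _ * 𝒜.osGen k _ +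
          𝒜.osGen k _ * 𝒜.osGen k _ = 0 at h1
        rw [lowGen_of_ne L k hbc]
        simp only [← mul_assoc, ← sub_mul]
        congr 1
        rw [sub_mul, osGen_mul_comm k 𝒜 b.1 (L.low _ _), osGen_mul_comm k 𝒜 c.1 (L.low _ _),
          ← sub_eq_zero, ← h1]
        abel
    · rw [genAct_of_gt L k h, trunc_osGen_of_ge L k (by omega)]
      simp

end Leveling

end CentralArrangement


/-! ### Colon ideals and Koszulness of leveled arrangements -/

namespace CentralArrangement

namespace Leveling

variable {V : Type*} [AddCommGroup V] [Module ℂ V] {𝒜 : CentralArrangement V}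
  (L : 𝒜.Leveling) (k : Type*) [Field k] [FiniteDimensional ℂ V]

theorem sub_aug_mem (J : Ideal (𝒜.OSAlgebra k)) (hJ : ∀ H, 𝒜.osGen k H ∈ J)
    (a : 𝒜.OSAlgebra k) : a - L.aug k a • 1 ∈ J := by
  refine 𝒜.os_induction k (P := fun a => a - L.aug k a • 1 ∈ J) ?_ ?_ ?_ ?_ a
  · rw [map_one, one_smul, sub_self]; exact J.zero_mem
  · intro x y hx hy
    rw [map_add, add_smul, add_sub_add_comm]
    exact J.add_mem hx hy
  · intro c x hx
    rw [map_smul, smul_assoc, ← smul_sub]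
    exact (J.restrictScalars k).smul_mem c hx
  · intro H x hx
    rw [map_mul, aug_osGen, zero_mul, zero_smul, sub_zero]
    have h1 : 𝒜.osGen k H * x = 𝒜.osGen k H * (x - L.aug k x • 1) + L.aug k x • 𝒜.osGen k H := by
      rw [mul_sub, mul_smul_comm, mul_one, sub_add_cancel]
    rw [h1]
    exact J.add_mem (J.mul_mem_left _ hx) ((J.restrictScalars k).smul_mem _ (hJ H))

theorem trunc_sub_aug_mem (i : ℕ) (a : 𝒜.OSAlgebra k) : L.trunc k i a - L.aug k a • 1 ∈
    Ideal.span (𝒜.osGen k '' {H | L.lvl H < i}) := by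
  set J := Ideal.span (𝒜.osGen k '' {H | L.lvl H < i})
  refine 𝒜.os_induction k (P := fun a => L.trunc k i a - L.aug k a • 1 ∈ J) ?_ ?_ ?_ ?_ a
  · rw [map_one, map_one, one_smul, sub_self]; exact J.zero_mem
  · intro x y hx hy
    rw [map_add, map_add, add_smul, add_sub_add_comm]
    exact J.add_mem hx hy
  · intro c x hx
    rw [map_smul, map_smul, smul_assoc, ← smul_sub]
    exact (J.restrictScalars k).smul_mem c hx
  · intro H x hx
    rw [map_mul, map_mul, aug_osGen, zero_mul, zero_smul, sub_zero]
    by_cases h : L.lvl H < i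
    · rw [trunc_osGen_of_lt L k h]
      have h1 : 𝒜.osGen k H * L.trunc k i x =
          𝒜.osGen k H * (L.trunc k i x - L.aug k x • 1) + L.aug k x • 𝒜.osGen k H := by
        rw [mul_sub, mul_smul_comm, mul_one, sub_add_cancel]
      rw [h1]
      exact J.add_mem (J.mul_mem_left _ hx)
        ((J.restrictScalars k).smul_mem _ (Ideal.subset_span ⟨H, h, rfl⟩))
    · rw [trunc_osGen_of_ge L k (not_lt.1 h), zero_mul]
      exact J.zero_mem

theorem trunc_of_forall_lt {i : ℕ} (hi : ∀ H, L.lvl H < i) : L.trunc k i = AlgHom.id k _ :=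
  𝒜.os_hom_ext k fun H => L.trunc_osGen_of_lt k (hi H)

/-- Membership in a left ideal generated by hyperplanes of level less than `i` can be tested on
the components of the decomposition of the Orlik–Solomon algebra. -/
theorem act_one_mem {i : ℕ} {T : Set 𝒜.hyperplanes} (hT : ∀ t ∈ T, L.lvl t < i)
    {y : 𝒜.OSAlgebra k} (hy : y ∈ Ideal.span (𝒜.osGen k '' T)) :
    L.trunc k i y ∈ Ideal.span (𝒜.osGen k '' T) ∧
      ∀ b : L.Fiber i, L.coeff k b y ∈ Ideal.span (𝒜.osGen k '' T) := by
  classical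
  set J := Ideal.span (𝒜.osGen k '' T)
  let N : Submodule k (L.FreeModel k i) :=
    { carrier := {x | x.1 ∈ J ∧ ∀ d, x.2 d ∈ J}
      zero_mem' := ⟨J.zero_mem, fun _ => J.zero_mem⟩
      add_mem' := fun hx hy => ⟨J.add_mem hx.1 hy.1, fun d => J.add_mem (hx.2 d) (hy.2 d)⟩
      smul_mem' := fun c x hx => ⟨(J.restrictScalars k).smul_mem c hx.1,
        fun d => (J.restrictScalars k).smul_mem c (hx.2 d)⟩ }
  have hN : ∀ H, ∀ x ∈ N, L.genAct k i H x ∈ N := by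
    intro H x hx
    rcases lt_trichotomy (L.lvl H) i with h | h | h
    · rw [genAct_of_lt L k h]
      exact ⟨J.mul_mem_left (𝒜.osGen k H) hx.1, fun d => J.neg_mem (J.mul_mem_left (𝒜.osGen k H) (hx.2 d))⟩
    · rw [show H = (⟨H, h⟩ : L.Fiber i).1 from rfl, genAct_coe]
      refine ⟨J.zero_mem, fun d => ?_⟩
      rw [fiberAct_snd]
      refine J.sub_mem ?_ (J.mul_mem_left _ (hx.2 d))
      split_ifs
      · exact J.add_mem hx.1 (J.sum_mem fun c _ => J.mul_mem_left _ (hx.2 c))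
      · exact J.zero_mem
    · rw [genAct_of_gt L k h]
      exact zero_mem N
  have key : L.act k i y (1, 0) ∈ N := by
    refine Submodule.span_induction (p := fun y _ => L.act k i y (1, 0) ∈ N) ?_ ?_ ?_ ?_ hy
    · rintro _ ⟨t, ht, rfl⟩
      rw [act_osGen, genAct_of_lt L k (hT t ht)]
      refine ⟨?_, fun d => ?_⟩
      · rw [lowAct_fst]
        rw [mul_one]; exact Ideal.subset_span ⟨t, ht, rfl⟩
      · rw [lowAct_snd]
        simp
    · rw [map_zero]; exact zero_mem N
    · intro x y _ _ hx hy; rw [map_add]; exact add_mem hx hy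
    · intro a x _ hx
      rw [smul_eq_mul, map_mul]
      exact L.act_mem k N hN a hx
  exact ⟨by rw [← act_fst]; exact key.1, key.2⟩

/-- A generator does not lie in the left ideal of other generators of at most the same level: its
coefficient in the decomposition has augmentation one, and those of the ideal have augmentation
zero. -/
theorem smul_osGen_mem_imp {s : 𝒜.hyperplanes} {T : Set 𝒜.hyperplanes} (hs : s ∉ T)
    (hT : ∀ t ∈ T, L.lvl t ≤ L.lvl s) {c : k}
    (hc : c • 𝒜.osGen k s ∈ Ideal.span (𝒜.osGen k '' T)) : c = 0 := by
  classical
  set i := L.lvl s with hi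
  let s' : L.Fiber i := ⟨s, rfl⟩
  let J : Ideal (𝒜.OSAlgebra k) := RingHom.ker (L.aug k)
  have hJg : ∀ H, 𝒜.osGen k H ∈ J := fun H => L.aug_osGen k H
  have hJl : ∀ b c : L.Fiber i, ∀ x, L.lowGen k b c * x ∈ J := fun b c x => by
    by_cases h : b = c
    · rw [h, lowGen_self, zero_mul]; exact J.zero_mem
    · rw [lowGen_of_ne L k h, RingHom.mem_ker, map_mul, aug_osGen, zero_mul]
  let N : Submodule k (L.FreeModel k i) :=
    { carrier := {x | x.1 ∈ J ∧ x.2 s' ∈ J}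
      zero_mem' := ⟨J.zero_mem, J.zero_mem⟩
      add_mem' := fun hx hy => ⟨J.add_mem hx.1 hy.1, J.add_mem hx.2 hy.2⟩
      smul_mem' := fun c x hx => ⟨(J.restrictScalars k).smul_mem c hx.1,
        (J.restrictScalars k).smul_mem c hx.2⟩ }
  have hN : ∀ H, ∀ x ∈ N, L.genAct k i H x ∈ N := by
    intro H x hx
    rcases lt_trichotomy (L.lvl H) i with h | h | h
    · rw [genAct_of_lt L k h]
      exact ⟨J.mul_mem_left (𝒜.osGen k H) hx.1, J.neg_mem (J.mul_mem_left (𝒜.osGen k H) hx.2)⟩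
    · rw [show H = (⟨H, h⟩ : L.Fiber i).1 from rfl, genAct_coe]
      refine ⟨J.zero_mem, ?_⟩
      rw [fiberAct_snd]
      refine J.sub_mem ?_ (hJl _ _ _)
      split_ifs
      · exact J.add_mem hx.1 (J.sum_mem fun c _ => hJl _ _ _)
      · exact J.zero_mem
    · rw [genAct_of_gt L k h]
      exact zero_mem N
  have key : L.act k i (c • 𝒜.osGen k s) (1, 0) ∈ N := by
    refine Submodule.span_induction (p := fun y _ => L.act k i y (1, 0) ∈ N) ?_ ?_ ?_ ?_ hc
    · rintro _ ⟨t, ht, rfl⟩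
      rw [act_osGen]
      rcases (hT t ht).lt_or_eq with h | h
      · rw [genAct_of_lt L k h]
        refine ⟨?_, ?_⟩
        · rw [lowAct_fst, mul_one]; exact hJg t
        · rw [lowAct_snd]
          simp
      · rw [show t = (⟨t, h⟩ : L.Fiber i).1 from rfl, genAct_coe]
        refine ⟨J.zero_mem, ?_⟩
        have hne : s' ≠ ⟨t, h⟩ := fun h => hs (by rw [show s = t from congrArg Subtype.val h]; exact ht)
        rw [fiberAct_snd, if_neg hne]
        simp
    · rw [map_zero]; exact zero_mem N
    · intro x y _ _ hx hy; rw [map_add]; exact add_mem hx hy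
    · intro a x _ hx
      rw [smul_eq_mul, map_mul]
      exact L.act_mem k N hN a hx
  have h2 : (L.act k i (c • 𝒜.osGen k s) (1, 0)).2 s' = c • 1 := by
    rw [map_smul, act_osGen, show s = s'.1 from rfl, genAct_coe, LinearMap.smul_apply,
      Prod.smul_snd, Pi.smul_apply, fiberAct_snd, if_pos rfl]
    simp
  have h3 := key.2
  rw [h2, RingHom.mem_ker, map_smul, map_one, smul_eq_mul, mul_one] at h3
  exact h3

theorem mul_osGen_mem {s : 𝒜.hyperplanes} {T : Set 𝒜.hyperplanes}
    (hlow : ∀ t, L.lvl t < L.lvl s → t ∈ T) {a : 𝒜.OSAlgebra k}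
    (ha : a ∈ Ideal.span (𝒜.osGen k '' {t | L.lvl t ≤ L.lvl s})) :
    a * 𝒜.osGen k s ∈ Ideal.span (𝒜.osGen k '' T) := by
  set J := Ideal.span (𝒜.osGen k '' T)
  have hJ : ∀ t ∈ T, 𝒜.osGen k t ∈ J := fun t ht => Ideal.subset_span ⟨t, ht, rfl⟩
  refine Submodule.span_induction (p := fun y _ => y * 𝒜.osGen k s ∈ J) ?_ ?_ ?_ ?_ ha
  · rintro _ ⟨t, ht, rfl⟩
    by_cases hlt : L.lvl t < L.lvl s
    · rw [osGen_mul_comm]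
      exact J.neg_mem (J.mul_mem_left _ (hJ t (hlow t hlt)))
    have heq : L.lvl t = L.lvl s := le_antisymm ht (not_lt.1 hlt)
    by_cases hts : t = s
    · rw [hts, osGen_mul_self]; exact J.zero_mem
    · have h1 := triangle_mem_osIdeal k (L.inf_le_low hts heq)
      rw [← osMk_eq_zero_iff, triangle, map_add, map_sub, map_mul, map_mul, map_mul] at h1
      change 𝒜.osGen k _ * 𝒜.osGen k _ - 𝒜.osGen k _ * 𝒜.osGen k _ +
        𝒜.osGen k _ * 𝒜.osGen k _ = 0 at h1
      have h2 := hJ _ (hlow _ (heq ▸ L.lvl_low hts heq))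
      rw [osGen_mul_comm k 𝒜 (L.low t s) s, osGen_mul_comm k 𝒜 (L.low t s) t] at h1
      have h3 : 𝒜.osGen k t * 𝒜.osGen k s = 𝒜.osGen k t * 𝒜.osGen k (L.low t s) -
          𝒜.osGen k s * 𝒜.osGen k (L.low t s) := by
        rw [← sub_eq_zero, ← h1]; abel
      rw [h3]
      exact J.sub_mem (J.mul_mem_left _ h2) (J.mul_mem_left _ h2)
  · rw [zero_mul]; exact J.zero_mem
  · intro x y _ _ hx hy; rw [add_mul]; exact J.add_mem hx hy
  · intro r x _ hx
    rw [smul_eq_mul, mul_assoc]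
    exact J.mul_mem_left _ hx

/-- The colon ideals of a leveled arrangement. For elements of the subalgebra generated by the
levels up to that of `s` this is a computation with the augmentation, and the general case is
reduced to it by comparing coefficients level by level. -/
theorem mul_osGen_mem_iff {s : 𝒜.hyperplanes} {T : Set 𝒜.hyperplanes} (hs : s ∉ T)
    (hlow : ∀ t, L.lvl t < L.lvl s → t ∈ T) (hT : ∀ t ∈ T, L.lvl t ≤ L.lvl s)
    (a : 𝒜.OSAlgebra k) : a * 𝒜.osGen k s ∈ Ideal.span (𝒜.osGen k '' T) ↔
      a ∈ Ideal.span (𝒜.osGen k '' {t | L.lvl t ≤ L.lvl s}) := by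
  refine ⟨?_, L.mul_osGen_mem k hlow⟩
  set J := Ideal.span (𝒜.osGen k '' T)
  set K := Ideal.span (𝒜.osGen k '' {t | L.lvl t ≤ L.lvl s})
  have key : ∀ i, L.lvl s + 1 ≤ i → ∀ a, L.trunc k i a = a → a * 𝒜.osGen k s ∈ J → a ∈ K := by
    intro i hi
    induction i, hi using Nat.le_induction with
    | base =>
      intro a ha has
      have h1 := L.trunc_sub_aug_mem k (L.lvl s + 1) a
      simp only [ha, Nat.lt_succ_iff] at h1
      have h2 : L.aug k a • 𝒜.osGen k s ∈ J := by
        have h3 := J.sub_mem has (L.mul_osGen_mem k hlow h1)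
        rwa [sub_mul, sub_sub_cancel, smul_mul_assoc, one_mul] at h3
      rwa [L.smul_osGen_mem_imp k hs hT h2, zero_smul, sub_zero] at h1
    | succ i hi ih =>
      intro a ha has
      have hTi : ∀ t ∈ T, L.lvl t < i := fun t ht => lt_of_le_of_lt (hT t ht) hi
      obtain ⟨h1, h2⟩ := L.act_one_mem k hTi has
      rw [map_mul, trunc_osGen_of_lt L k hi] at h1
      have h3 : ∀ b : L.Fiber i, L.coeff k b (a * 𝒜.osGen k s) =
          L.coeff k b a * 𝒜.osGen k s := fun b => by
        have h4 := L.act_mul_right k a (𝒜.osGen k s) ((1, 0) : L.FreeModel k i)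
        have h5 : L.act k i (𝒜.osGen k s) (1, 0) = (1 * 𝒜.osGen k s, fun _ => 0 * 𝒜.osGen k s) := by
          rw [act_osGen, genAct_of_lt L k hi]
          refine Prod.ext ?_ (funext fun d => ?_)
          · rw [lowAct_fst, mul_one, one_mul]
          · rw [lowAct_snd]; simp
        rw [coeff, map_mul, Module.End.mul_apply, h5]
        exact congrFun (congrArg Prod.snd h4) b
      have htt : L.trunc k i (L.trunc k i a) = L.trunc k i a := by
        refine DFunLike.congr_fun (f := (L.trunc k i).comp (L.trunc k i)) (𝒜.os_hom_ext k fun H => ?_) a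
        rw [AlgHom.comp_apply]
        by_cases h : L.lvl H < i
        · rw [trunc_osGen_of_lt L k h, trunc_osGen_of_lt L k h]
        · rw [trunc_osGen_of_ge L k (not_lt.1 h), map_zero]
      rw [← ha, trunc_succ]
      refine K.add_mem (ih _ htt h1) (K.sum_mem fun b _ => K.mul_mem_left _ (ih _ ?_ ?_))
      · exact L.trunc_coeff k b a
      · rw [← h3]; exact h2 b
  intro has
  have hfin : (Set.range L.lvl).Finite :=
    have : Finite 𝒜.hyperplanes := 𝒜.finite
    Set.finite_range _
  obtain ⟨N, hN⟩ := hfin.bddAbove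
  refine key (N + 1) (Nat.succ_le_succ (hN ⟨s, rfl⟩)) a ?_ has
  rw [trunc_of_forall_lt L k fun H => Nat.lt_succ_of_le (hN ⟨H, rfl⟩)]
  rfl

/-- The Orlik–Solomon algebra of an arrangement with a leveling is Koszul. -/
theorem isKoszul (L : 𝒜.Leveling) : IsKoszul (𝒜.osGrading k) := by
  have : Finite 𝒜.hyperplanes := 𝒜.finite
  have hε : ∀ a, a - L.aug k a • 1 ∈ BarComplex.plus (𝒜.osGrading k) := fun a =>
    L.sub_aug_mem k (HomogeneousIdeal.irrelevant (𝒜.osGrading k)).toIdeal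
      (𝒜.osGen_mem_plus k) a
  have hε0 : ∀ a ∈ BarComplex.plus (𝒜.osGrading k), L.aug k a = 0 := fun a ha => by
    by_contra hne
    have h1 : L.aug k a • (1 : 𝒜.OSAlgebra k) ∈ BarComplex.plus (𝒜.osGrading k) := by
      have := sub_mem ha (hε a)
      rwa [sub_sub_cancel] at this
    have h2 : (1 : 𝒜.OSAlgebra k) ∈ BarComplex.plus (𝒜.osGrading k) := by
      have := Submodule.smul_mem _ (L.aug k a)⁻¹ h1
      rwa [smul_smul, inv_mul_cancel₀ hne, one_smul] at this
    have h3 := BarComplex.eq_zero_of_mem_plus (SetLike.one_mem_graded (𝒜.osGrading k)) h2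
    have h4 := congrArg (L.aug k) h3
    rw [map_one, map_zero] at h4
    exact one_ne_zero h4
  refine BarComplex.isKoszul_of_colon (L.aug k).toLinearMap (map_one (L.aug k)) hε hε0
    (𝒜.osGen k) (𝒜.osGen_mem k) L.lvl (fun a ha => ?_)
    (fun s T hs hlow hT a => L.mul_osGen_mem_iff k hs hlow hT a)
  have := L.sub_aug_mem k (Ideal.span (Set.range (𝒜.osGen k)))
    (fun H => Ideal.subset_span ⟨H, rfl⟩) a
  rwa [hε0 a ha, zero_smul, sub_zero] at this

end Leveling

end CentralArrangement


/-! ### Levelings from maximal chains of modular flats -/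

namespace CentralArrangement

variable {V : Type*} [AddCommGroup V] [Module ℂ V] {𝒜 : CentralArrangement V}

instance Flat.instFinite : Finite 𝒜.Flat := by
  refine Set.Finite.subset ((𝒜.finite.finite_subsets).image sInf) ?_
  rintro X ⟨ℬ, hℬ, rfl⟩
  exact ⟨ℬ, hℬ, rfl⟩

/-- A hyperplane of the arrangement, as a flat. -/
def atomFlat (H : 𝒜.hyperplanes) : 𝒜.Flat :=
  ⟨H, {H.1}, Set.singleton_subset_iff.2 H.2, sInf_singleton.symm⟩

theorem atomFlat_le_iff {H : 𝒜.hyperplanes} {X : 𝒜.Flat} :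
    atomFlat H ≤ X ↔ X.1 ≤ (H : Submodule ℂ V) := Iff.rfl

theorem eq_of_atomFlat_le {H H' : 𝒜.hyperplanes} (h : atomFlat H ≤ atomFlat H') : H = H' := by
  have h' : (H' : Submodule ℂ V) ≤ H := h
  have h1 := 𝒜.isCoatom H H.2
  have h2 := 𝒜.isCoatom H' H'.2
  exact Subtype.ext ((h2.le_iff_eq h1.1).1 h')

/-- The flats of a chain which, as subspaces, do not lie in a given hyperplane. -/
def flatsBelow (Δ : Flag 𝒜.Flat) (H : 𝒜.hyperplanes) : Set 𝒜.Flat := {X | X ∈ Δ ∧ ¬ atomFlat H ≤ X}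

theorem flatsBelow_nonempty (Δ : Flag 𝒜.Flat) (H : 𝒜.hyperplanes) : (flatsBelow Δ H).Nonempty := by
  refine ⟨⟨⊤, ∅, Set.empty_subset _, sInf_empty.symm⟩, ?_, ?_⟩
  · exact Flag.mem_iff_forall_le_or_ge.2 fun X _ => Or.inl (le_top (a := X.1))
  · intro h
    exact (𝒜.isCoatom H H.2).1 (top_le_iff.1 h)

theorem flatsBelow_subset_of_notMem {Δ : Flag 𝒜.Flat} {H H' : 𝒜.hyperplanes} {X : 𝒜.Flat}
    (hX : X ∈ flatsBelow Δ H) (hX' : X ∉ flatsBelow Δ H') : flatsBelow Δ H' ⊆ flatsBelow Δ H := by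
  have h : atomFlat H' ≤ X := by_contra fun h => hX' ⟨hX.1, h⟩
  rintro Y ⟨hY, hYH⟩
  refine ⟨hY, fun hle => ?_⟩
  rcases Δ.le_or_le hX.1 hY with h1 | h1
  · exact hYH (h.trans h1)
  · exact hX.2 (hle.trans h1)

theorem flatsBelow_eq_of_ncard_eq {Δ : Flag 𝒜.Flat} {H H' : 𝒜.hyperplanes}
    (h : (flatsBelow Δ H).ncard = (flatsBelow Δ H').ncard) : flatsBelow Δ H = flatsBelow Δ H' := by
  by_cases hs : flatsBelow Δ H ⊆ flatsBelow Δ H'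
  · exact Set.eq_of_subset_of_ncard_le hs h.ge (Set.toFinite _)
  · obtain ⟨X, hX, hX'⟩ := Set.not_subset.1 hs
    exact (Set.eq_of_subset_of_ncard_le (flatsBelow_subset_of_notMem hX hX') h.le
      (Set.toFinite _)).symm

/-- The last flat of the chain which, as a subspace, does not lie in the given hyperplane. -/
theorem exists_lastBelow (Δ : Flag 𝒜.Flat) (H : 𝒜.hyperplanes) :
    ∃ X ∈ flatsBelow Δ H, (∀ Y ∈ flatsBelow Δ H, Y ≤ X) ∧
      ∀ Y ∈ Δ, atomFlat H ≤ Y → X ≤ Y := by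
  obtain ⟨X, hX⟩ := (Set.toFinite (flatsBelow Δ H)).exists_maximal (flatsBelow_nonempty Δ H)
  refine ⟨X, hX.1, fun Y hY => ?_, fun Y hY hle => ?_⟩
  · rcases Δ.le_or_le hX.1.1 hY.1 with h | h
    · exact hX.2 hY h
    · exact h
  · rcases Δ.le_or_le hX.1.1 hY with h | h
    · exact h
    · exact absurd (hle.trans h) hX.1.2

/-- A maximal chain of modular flats gives a leveling: the level of a hyperplane counts the flats
of the chain that it does not contain. -/
noncomputable def levelingOfFlag (Δ : Flag 𝒜.Flat) (hΔ : ∀ X ∈ Δ, IsModularElement X) :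
    𝒜.Leveling where
  lvl H := (flatsBelow Δ H).ncard
  exists_low b c hbc h := by
    have hD := flatsBelow_eq_of_ncard_eq h
    obtain ⟨X, hX, hXmax, hXle⟩ := exists_lastBelow Δ b
    -- by maximality of the chain, it contains the join of `b` and `X`
    have hmem : atomFlat b ⊔ X ∈ Δ := by
      refine Flag.mem_iff_forall_le_or_ge.2 fun Y hY => ?_
      by_cases hb : atomFlat b ≤ Y
      · exact Or.inl (sup_le hb (hXle Y hY hb))
      · exact Or.inr ((hXmax Y ⟨hY, hb⟩).trans le_sup_right)
    have hc : atomFlat c ≤ atomFlat b ⊔ X := by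
      by_contra hc
      have : atomFlat b ⊔ X ∈ flatsBelow Δ b := hD ▸ ⟨hmem, hc⟩
      exact this.2 le_sup_left
    have hmod := hΔ X hX.1 (atomFlat b ⊔ atomFlat c) (atomFlat b) le_sup_left
    rw [inf_eq_right.2 (sup_le le_sup_left hc)] at hmod
    obtain ⟨a, ha, hXa, hle⟩ : {H | H ∈ 𝒜.hyperplanes ∧ X.1 ≤ H ∧
        (b : Submodule ℂ V) ⊓ c ≤ H}.Nonempty := by
      by_contra hne
      rw [Set.not_nonempty_iff_eq_empty] at hne
      have hbot : X ⊓ (atomFlat b ⊔ atomFlat c) ≤ atomFlat b := by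
        change (b : Submodule ℂ V) ≤ sInf {H | H ∈ 𝒜.hyperplanes ∧ X.1 ≤ H ∧
          (b : Submodule ℂ V) ⊓ c ≤ H}
        rw [hne, sInf_empty]
        exact le_top
      rw [sup_eq_left.2 hbot] at hmod
      exact hbc (eq_of_atomFlat_le (hmod ▸ le_sup_right : atomFlat c ≤ atomFlat b)).symm
    refine ⟨⟨a, ha⟩, Set.ncard_lt_ncard ?_ (Set.toFinite _), hle⟩
    have hX' : X ∉ flatsBelow Δ ⟨a, ha⟩ := fun h => h.2 hXa
    exact ⟨flatsBelow_subset_of_notMem hX hX', fun h => hX' (h hX)⟩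
  exists_not_le b := by
    obtain ⟨X, hX, hXmax, -⟩ := exists_lastBelow Δ b
    refine ⟨X.1, fun H hH => ?_, hX.2⟩
    by_contra hXH
    refine hH.not_ge (Set.ncard_le_ncard (fun Y hY => ⟨hY.1, fun h => hXH ?_⟩) (Set.toFinite _))
    exact atomFlat_le_iff.1 (h.trans (hXmax Y hY))

theorem IsSupersolvable.isKoszul [FiniteDimensional ℂ V] (h : 𝒜.IsSupersolvable)
    (k : Type*) [Field k] : IsKoszul (𝒜.osGrading k) := by
  obtain ⟨Δ, hΔ⟩ := h
  exact Leveling.isKoszul k (levelingOfFlag Δ hΔ)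

end CentralArrangement


/-! ### Quadraticity of Koszul Orlik–Solomon algebras -/

section DegreeGE

open DirectSum

variable {k R : Type*} [Field k] [Ring R] [Algebra k R] (ℛ : ℕ → Submodule k R) [GradedAlgebra ℛ]

/-- The two-sided ideal of elements without components of degree `< n`. -/
def degreeGE (n : ℕ) : TwoSidedIdeal R :=
  .mk' {x | ∀ i < n, (decompose ℛ x i : R) = 0}
    (fun i _ => by rw [decompose_zero]; rfl)
    (fun {x y} hx hy i hi => by
      rw [decompose_add, DirectSum.add_apply, Submodule.coe_add, hx i hi, hy i hi, add_zero])
    (fun {x} hx i hi => by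
      rw [decompose_neg, DFinsupp.neg_apply, Submodule.coe_neg, hx i hi, neg_zero])
    (fun {x y} hy i hi => by
      rw [decompose_mul, coe_mul_apply_eq_sum_antidiagonal]
      refine Finset.sum_eq_zero fun p hp => ?_
      rw [hy p.2 (by have := Finset.HasAntidiagonal.mem_antidiagonal.1 hp; omega), mul_zero])
    (fun {x y} hx i hi => by
      rw [decompose_mul, coe_mul_apply_eq_sum_antidiagonal]
      refine Finset.sum_eq_zero fun p hp => ?_
      rw [hx p.1 (by have := Finset.HasAntidiagonal.mem_antidiagonal.1 hp; omega), zero_mul])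

variable {ℛ}

theorem mem_degreeGE {n : ℕ} {x : R} :
    x ∈ degreeGE ℛ n ↔ ∀ i < n, (decompose ℛ x i : R) = 0 := TwoSidedIdeal.mem_mk' _ _ _ _ _ _ _

theorem mem_degreeGE_of_mem {n m : ℕ} {x : R} (hx : x ∈ ℛ m) (h : n ≤ m) : x ∈ degreeGE ℛ n :=
  mem_degreeGE.2 fun i hi => decompose_of_mem_ne ℛ hx (by omega)

theorem eq_zero_of_mem_degreeGE {n m : ℕ} {x : R} (hx : x ∈ degreeGE ℛ n) (h : m < n)
    (hm : x ∈ ℛ m) : x = 0 := by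
  rw [← decompose_of_mem_same ℛ hm]
  exact mem_degreeGE.1 hx m h

theorem decompose_plus_zero {x : R} (hx : x ∈ BarComplex.plus ℛ) : (decompose ℛ x 0 : R) = 0 := hx

end DegreeGE

namespace CentralArrangement

open DirectSum
open scoped ExteriorAlgebra

variable {V : Type*} [AddCommGroup V] [Module ℂ V] (k : Type*) [Field k] (𝒜 : CentralArrangement V)

/-- The grading of the exterior algebra. -/
noncomputable abbrev extGrading : ℕ → Submodule k (𝒜.Exterior k) := fun i => ⋀[k]^i (𝒜.hyperplanes →₀ k)

theorem boundary_monomial_mem_extGrading {m : ℕ} (S : Fin m → 𝒜.hyperplanes) :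
    𝒜.boundary k (𝒜.monomial k S) ∈ 𝒜.extGrading k (m - 1) :=
  𝒜.boundary_ιMulti_mem k m _

theorem decompose_osMk (x : 𝒜.Exterior k) (i : ℕ) :
    (decompose (𝒜.osGrading k) (𝒜.osMk k x) i : 𝒜.OSAlgebra k) =
      𝒜.osMk k (decompose (𝒜.extGrading k) x i) := by
  induction x using DirectSum.Decomposition.inductionOn (𝒜.extGrading k) with
  | zero => rw [map_zero, decompose_zero, decompose_zero]; exact (map_zero _).symm
  | @homogeneous j x =>
    have hx := 𝒜.osMk_mem k x.2
    by_cases h : j = i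
    · subst h
      rw [decompose_of_mem_same _ hx, decompose_of_mem_same _ x.2]
    · rw [decompose_of_mem_ne _ hx h, decompose_of_mem_ne _ x.2 h, map_zero]
  | add x y hx hy =>
    rw [map_add, decompose_add, decompose_add, DirectSum.add_apply, DirectSum.add_apply,
      Submodule.coe_add, Submodule.coe_add, map_add, hx, hy]

theorem decompose_mem_osIdeal {x : 𝒜.Exterior k} (hx : x ∈ 𝒜.osIdeal k) (i : ℕ) :
    (decompose (𝒜.extGrading k) x i : 𝒜.Exterior k) ∈ 𝒜.osIdeal k := by
  rw [← osMk_eq_zero_iff, ← decompose_osMk, (𝒜.osMk_eq_zero_iff k).2 hx, decompose_zero]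
  rfl

theorem three_le_of_dependent [FiniteDimensional ℂ V] {m : ℕ} {S : Fin m → 𝒜.hyperplanes}
    (hS : Function.Injective S)
    (h : Module.finrank ℂ (V ⧸ (⨅ i, (S i : Submodule ℂ V))) < m) : 3 ≤ m := by
  by_contra hm
  have hlt : ∀ i, (S i : Submodule ℂ V) < ⊤ := fun i => (𝒜.isCoatom _ (S i).2).lt_top
  obtain rfl | rfl | rfl : m = 0 ∨ m = 1 ∨ m = 2 := by omega
  · omega
  · have := codim_lt_of_lt ((iInf_le (fun i => (S i : Submodule ℂ V)) 0).trans_lt (hlt 0))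
    omega
  · have h1 := codim_lt_of_lt (hlt 0)
    have h2 : (⨅ i, (S i : Submodule ℂ V)) < S 0 := by
      refine lt_of_le_of_ne (iInf_le _ 0) fun he => ?_
      have h3 : (S 0 : Submodule ℂ V) ≤ S 1 := he ▸ iInf_le (fun i => (S i : Submodule ℂ V)) 1
      have h4 := ((𝒜.isCoatom _ (S 0).2).le_iff_eq (hlt 1).ne).1 h3
      exact absurd (hS (Subtype.ext h4)) (by decide)
    have := codim_lt_of_lt h2
    omega

theorem osIdeal_le_degreeGE [FiniteDimensional ℂ V] :
    𝒜.osIdeal k ≤ degreeGE (𝒜.extGrading k) 2 := by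
  refine TwoSidedIdeal.span_le.2 ?_
  rintro _ ⟨m, S, hS, hm, rfl⟩
  have := 𝒜.three_le_of_dependent hS hm
  exact mem_degreeGE_of_mem (𝒜.boundary_monomial_mem_extGrading k S) (by omega)

theorem osMk_mem_plus {x : 𝒜.Exterior k} (hx : x ∈ BarComplex.plus (𝒜.extGrading k)) :
    𝒜.osMk k x ∈ BarComplex.plus (𝒜.osGrading k) := by
  change (decompose (𝒜.osGrading k) (𝒜.osMk k x) 0 : 𝒜.OSAlgebra k) = 0
  rw [decompose_osMk, decompose_plus_zero hx, map_zero]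

/-- The quotient map has a linear section on the augmentation ideals. -/
theorem exists_plus_section : ∃ τ : BarComplex.plus (𝒜.osGrading k) →ₗ[k] 𝒜.Exterior k,
    (∀ a, τ a ∈ BarComplex.plus (𝒜.extGrading k)) ∧ ∀ a, 𝒜.osMk k (τ a) = a := by
  let φ := (𝒜.osMk k).toLinearMap.restrict fun _ => 𝒜.osMk_mem_plus k
  have hφ : LinearMap.range φ = ⊤ := by
    refine LinearMap.range_eq_top.2 fun a => ?_
    obtain ⟨x, hx⟩ := 𝒜.osMk_surjective k a
    refine ⟨⟨x - decompose (𝒜.extGrading k) x 0, ?_⟩, Subtype.ext ?_⟩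
    · change (decompose (𝒜.extGrading k) _ 0 : 𝒜.Exterior k) = 0
      rw [decompose_sub, decompose_coe, DFinsupp.sub_apply, of_eq_same, sub_self]
      rfl
    · change 𝒜.osMk k (x - decompose (𝒜.extGrading k) x 0) = a
      rw [map_sub, ← decompose_osMk, hx, decompose_plus_zero a.2, sub_zero]
  obtain ⟨τ, hτ⟩ := φ.exists_rightInverse_of_surjective hφ
  exact ⟨(BarComplex.plus (𝒜.extGrading k)).subtype ∘ₗ τ, fun a => (τ a).2,
    fun a => congrArg Subtype.val (LinearMap.congr_fun hτ a)⟩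

/-- The two-sided ideal generated by the quadratic elements of the Orlik–Solomon ideal. -/
noncomputable def quadIdeal : TwoSidedIdeal (𝒜.Exterior k) :=
  .span {x | x ∈ 𝒜.osIdeal k ∧ x ∈ ⋀[k]^2 (𝒜.hyperplanes →₀ k)}

theorem mem_mul_of_mem_extGrading {j : ℕ} (hj : 2 ≤ j) {x : 𝒜.Exterior k}
    (hx : x ∈ 𝒜.extGrading k j) :
    x ∈ BarComplex.plus (𝒜.extGrading k) * BarComplex.plus (𝒜.extGrading k) := by
  obtain ⟨j, rfl⟩ : ∃ i, j = i + 2 := ⟨j - 2, by omega⟩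
  have h : 𝒜.extGrading k (j + 2) = 𝒜.extGrading k 1 * 𝒜.extGrading k (j + 1) := by
    change LinearMap.range _ ^ (j + 2) = LinearMap.range _ ^ 1 * LinearMap.range _ ^ (j + 1)
    rw [← pow_add]
    congr 1
    omega
  rw [h] at hx
  have h1 : ∀ i, 0 < i → 𝒜.extGrading k i ≤ BarComplex.plus (𝒜.extGrading k) :=
    fun i hi y hy => BarComplex.mem_plus_of_mem hi hy
  exact mul_le_mul' (h1 1 one_pos) (h1 (j + 1) j.succ_pos) hx

section Obstruction

variable {k 𝒜} {j : ℕ} {μ : 𝒜.Exterior k →ₗ[k] k}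

theorem form_mul_eq_zero_left (ih : ∀ i < j, ∀ x ∈ 𝒜.osIdeal k, x ∈ 𝒜.extGrading k i → x ∈ 𝒜.quadIdeal k)
    (hμ : ∀ x ∈ 𝒜.quadIdeal k, x ∈ 𝒜.extGrading k j → μ x = 0)
    (hμj : ∀ x, μ x = μ (decompose (𝒜.extGrading k) x j))
    {y b : 𝒜.Exterior k} (hy : y ∈ 𝒜.osIdeal k)
    (hb : b ∈ BarComplex.plus (𝒜.extGrading k)) : μ (y * b) = 0 := by
  rw [hμj, decompose_mul, coe_mul_apply_eq_sum_antidiagonal, map_sum]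
  refine Finset.sum_eq_zero fun p hp => ?_
  rcases Nat.eq_zero_or_pos p.2 with h0 | h0
  · rw [h0, decompose_plus_zero hb, mul_zero, map_zero]
  · have hpj := Finset.HasAntidiagonal.mem_antidiagonal.1 hp
    refine hμ _ (TwoSidedIdeal.mul_mem_right _ _ _ ?_) ?_
    · exact ih p.1 (by omega) _ (𝒜.decompose_mem_osIdeal k hy _) (SetLike.coe_mem _)
    · rw [← hpj]
      exact SetLike.mul_mem_graded (SetLike.coe_mem _) (SetLike.coe_mem _)

theorem form_mul_eq_zero_right (ih : ∀ i < j, ∀ x ∈ 𝒜.osIdeal k, x ∈ 𝒜.extGrading k i → x ∈ 𝒜.quadIdeal k)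
    (hμ : ∀ x ∈ 𝒜.quadIdeal k, x ∈ 𝒜.extGrading k j → μ x = 0)
    (hμj : ∀ x, μ x = μ (decompose (𝒜.extGrading k) x j))
    {y b : 𝒜.Exterior k} (hy : y ∈ 𝒜.osIdeal k)
    (hb : b ∈ BarComplex.plus (𝒜.extGrading k)) : μ (b * y) = 0 := by
  rw [hμj, decompose_mul, coe_mul_apply_eq_sum_antidiagonal, map_sum]
  refine Finset.sum_eq_zero fun p hp => ?_
  rcases Nat.eq_zero_or_pos p.1 with h0 | h0
  · rw [h0, decompose_plus_zero hb, zero_mul, map_zero]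
  · have hpj := Finset.HasAntidiagonal.mem_antidiagonal.1 hp
    refine hμ _ (TwoSidedIdeal.mul_mem_left _ _ _ ?_) ?_
    · exact ih p.2 (by omega) _ (𝒜.decompose_mem_osIdeal k hy _) (SetLike.coe_mem _)
    · rw [← hpj]
      exact SetLike.mul_mem_graded (SetLike.coe_mem _) (SetLike.coe_mem _)

/-- A form of degree `j` is well defined on products of classes of positive degree: the components
of relations which meet a factor of positive degree have degree `< j`, and these are generated by
quadratic ones. -/
theorem form_mul_congr (ih : ∀ i < j, ∀ x ∈ 𝒜.osIdeal k, x ∈ 𝒜.extGrading k i → x ∈ 𝒜.quadIdeal k)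
    (hμ : ∀ x ∈ 𝒜.quadIdeal k, x ∈ 𝒜.extGrading k j → μ x = 0)
    (hμj : ∀ x, μ x = μ (decompose (𝒜.extGrading k) x j))
    {x y x' y' : 𝒜.Exterior k} (hx : x ∈ BarComplex.plus (𝒜.extGrading k))
    (hy' : y' ∈ BarComplex.plus (𝒜.extGrading k))
    (hxx' : 𝒜.osMk k x = 𝒜.osMk k x') (hyy' : 𝒜.osMk k y = 𝒜.osMk k y') :
    μ (x * y) = μ (x' * y') := by
  have h1 : x * (y - y') + (x - x') * y' = x * y - x' * y' := by noncomm_ring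
  have h2 := form_mul_eq_zero_right ih hμ hμj (y := y - y')
    ((𝒜.osMk_eq_zero_iff k).1 (by rw [map_sub, hyy', sub_self])) hx
  have h3 := form_mul_eq_zero_left ih hμ hμj (y := x - x')
    ((𝒜.osMk_eq_zero_iff k).1 (by rw [map_sub, hxx', sub_self])) hy'
  rw [← sub_eq_zero, ← map_sub, ← h1, map_add, h2, h3, add_zero]

/-- A linear form of degree `j ≥ 3` which vanishes on the relations generated in lower degrees is a
two-cocycle of internal degree `j`. If it bounds, then it vanishes on all relations. -/
theorem form_eq_zero (ih : ∀ i < j, ∀ x ∈ 𝒜.osIdeal k, x ∈ 𝒜.extGrading k i → x ∈ 𝒜.quadIdeal k)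
    (hμ : ∀ x ∈ 𝒜.quadIdeal k, x ∈ 𝒜.extGrading k j → μ x = 0)
    (hμj : ∀ x, μ x = μ (decompose (𝒜.extGrading k) x j))
    (hK : IsKoszul (𝒜.osGrading k)) (hj : 3 ≤ j) {x : 𝒜.Exterior k}
    (hx : x ∈ 𝒜.osIdeal k) (hxj : x ∈ 𝒜.extGrading k j) : μ x = 0 := by
  obtain ⟨τ, hτ, hτA⟩ := 𝒜.exists_plus_section k
  let f : BarComplex.Cochain (𝒜.osGrading k) 2 :=
    μ.compMultilinearMap ((MultilinearMap.mkPiAlgebraFin k 2 (𝒜.Exterior k)).compLinearMap fun _ => τ)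
  have hf : ∀ a, f a = μ (τ (a 0) * τ (a 1)) := fun a => by
    simp [f, MultilinearMap.mkPiAlgebraFin_apply]
  -- the cocycle condition is the associativity of the product
  have hfc : f ∈ BarComplex.cocycles (𝒜.osGrading k) 2 j := by
    refine ⟨LinearMap.mem_ker.2 (MultilinearMap.ext fun a => ?_), fun a e ha he => ?_⟩
    · have e0 : (BarComplex.merge (𝒜.osGrading k) 0 a) = ![BarComplex.mulPlus _ (a 0) (a 1), a 2] := by
        funext i; fin_cases i <;> rfl
      have e1 : (BarComplex.merge (𝒜.osGrading k) 1 a) = ![a 0, BarComplex.mulPlus _ (a 1) (a 2)] := by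
        funext i; fin_cases i <;> rfl
      rw [BarComplex.d_apply, Fin.sum_univ_two, e0, e1, hf, hf]
      have h1 : μ (τ (BarComplex.mulPlus (𝒜.osGrading k) (a 0) (a 1)) * τ (a 2)) =
          μ (τ (a 0) * τ (a 1) * τ (a 2)) := by
        refine form_mul_congr ih hμ hμj (hτ _) (hτ _) ?_ rfl
        rw [hτA, map_mul, hτA, hτA]; rfl
      have h2 : μ (τ (a 0) * τ (BarComplex.mulPlus (𝒜.osGrading k) (a 1) (a 2))) =
          μ (τ (a 0) * (τ (a 1) * τ (a 2))) := by
        refine form_mul_congr ih hμ hμj (hτ _) ?_ rfl ?_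
        · exact Ideal.mul_mem_left _ _ (hτ _)
        · rw [hτA, map_mul, hτA, hτA]; rfl
      simp only [Matrix.cons_val_zero, Matrix.cons_val_one]
      rw [h1, h2, mul_assoc]
      simp
    · obtain ⟨x, hx, hxa⟩ := ha 0
      obtain ⟨y, hy, hya⟩ := ha 1
      rw [Fin.sum_univ_two] at he
      rw [hf]
      rcases Nat.eq_zero_or_pos (e 1) with h0 | h0
      · have : a 1 = 0 := Subtype.ext
          (BarComplex.eq_zero_of_mem_plus (by simpa only [h0] using ha 1) (a 1).2)
        rw [this, map_zero, mul_zero, map_zero]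
      · rw [form_mul_congr ih hμ hμj (hτ _) (BarComplex.mem_plus_of_mem h0 hy)
          ((hτA _).trans hxa.symm) ((hτA _).trans hya.symm), hμj,
          decompose_of_mem_ne (𝒜.extGrading k) (SetLike.mul_mem_graded hx hy) he, map_zero]
  have hfb : f ∈ BarComplex.coboundaries (𝒜.osGrading k) 2 j := by
    have h := Submodule.mem_map_of_mem (f := (BarComplex.coboundaries (𝒜.osGrading k) 2 j).mkQ) hfc
    have hK' := hK 2 j (by omega)
    rw [BarComplex.gradedExt] at hK'
    rw [hK', Submodule.mem_bot] at h
    exact (Submodule.Quotient.mk_eq_zero _).1 h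
  obtain ⟨g, -, hg⟩ := hfb
  -- on decomposable elements `μ` factors through the Orlik–Solomon algebra
  have key : ∀ z ∈ BarComplex.plus (𝒜.extGrading k) * BarComplex.plus (𝒜.extGrading k),
      ∃ h : 𝒜.osMk k z ∈ BarComplex.plus (𝒜.osGrading k), μ z = - g fun _ => ⟨_, h⟩ := by
    intro z hz
    induction hz using Submodule.mul_induction_on' with
    | mem_mul_mem x hx y hy =>
      refine ⟨𝒜.osMk_mem_plus k (Ideal.mul_mem_left _ _ hy), ?_⟩
      have h1 := hf ![⟨_, 𝒜.osMk_mem_plus k hx⟩, ⟨_, 𝒜.osMk_mem_plus k hy⟩]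
      rw [← hg, BarComplex.d_apply, Fin.sum_univ_one] at h1
      rw [form_mul_congr ih hμ hμj hx (hτ ⟨_, 𝒜.osMk_mem_plus k hy⟩) (hτA ⟨_, 𝒜.osMk_mem_plus k hx⟩).symm
        (hτA ⟨_, 𝒜.osMk_mem_plus k hy⟩).symm]
      refine h1.symm.trans ?_
      have e0 : (BarComplex.merge (𝒜.osGrading k) 0
          ![(⟨_, 𝒜.osMk_mem_plus k hx⟩ : BarComplex.plus (𝒜.osGrading k)), ⟨_, 𝒜.osMk_mem_plus k hy⟩]) =
          fun _ => ⟨𝒜.osMk k (x * y), 𝒜.osMk_mem_plus k (Ideal.mul_mem_left _ _ hy)⟩ := by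
        funext i
        fin_cases i
        exact Subtype.ext (map_mul _ _ _).symm
      rw [e0]
      simp
    | add x _ y _ hx hy =>
      obtain ⟨h1, h2⟩ := hx
      obtain ⟨h3, h4⟩ := hy
      have h5 : 𝒜.osMk k (x + y) ∈ BarComplex.plus (𝒜.osGrading k) := by
        rw [map_add]; exact add_mem h1 h3
      refine ⟨h5, ?_⟩
      have := g.map_update_add (fun _ => 0) 0 ⟨_, h1⟩ ⟨_, h3⟩
      rw [map_add, h2, h4, ← neg_add]
      congr 1
      have e : ∀ v, Function.update (fun _ : Fin 1 => (0 : BarComplex.plus (𝒜.osGrading k))) 0 v =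
          fun _ => v := fun v => by funext i; rw [Subsingleton.elim i 0, Function.update_self]
      rw [e, e, e] at this
      rw [← this]
      congr 1
  obtain ⟨h, hz⟩ := key x (𝒜.mem_mul_of_mem_extGrading k (by omega) hxj)
  rw [hz, neg_eq_zero]
  exact g.map_coord_zero 0 (Subtype.ext ((𝒜.osMk_eq_zero_iff k).2 hx))

end Obstruction

theorem isQuadratic_of_isKoszul [FiniteDimensional ℂ V] (hK : IsKoszul (𝒜.osGrading k)) :
    𝒜.IsQuadratic k := by
  have key : ∀ j, ∀ x ∈ 𝒜.osIdeal k, x ∈ 𝒜.extGrading k j → x ∈ 𝒜.quadIdeal k := by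
    intro j
    induction j using Nat.strong_induction_on with
    | _ j ih =>
    intro x hx hxj
    rcases lt_trichotomy j 2 with h | h | h
    · rw [eq_zero_of_mem_degreeGE (𝒜.osIdeal_le_degreeGE k hx) h hxj]
      exact zero_mem _
    · exact TwoSidedIdeal.subset_span ⟨hx, h ▸ hxj⟩
    by_contra hxq
    let Q : Submodule k (𝒜.Exterior k) := {
      carrier := {y | y ∈ 𝒜.quadIdeal k ∧ y ∈ 𝒜.extGrading k j}
      zero_mem' := ⟨zero_mem _, zero_mem _⟩
      add_mem' := fun h h' => ⟨add_mem h.1 h'.1, add_mem h.2 h'.2⟩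
      smul_mem' := fun c y h => ⟨by
        rw [Algebra.smul_def]
        exact TwoSidedIdeal.mul_mem_left _ _ _ h.1, Submodule.smul_mem _ c h.2⟩ }
    obtain ⟨ν, hνx, hν⟩ := Submodule.exists_le_ker_of_notMem (p := Q) (fun h => hxq h.1 : x ∉ Q)
    let μ := ν ∘ₗ GradedAlgebra.proj (𝒜.extGrading k) j
    have hμ : ∀ y, μ y = ν (decompose (𝒜.extGrading k) y j) := fun y => rfl
    refine hνx ?_
    have := form_eq_zero (μ := μ) ih (fun y hy hyj => ?_) (fun y => ?_) hK h hx hxj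
    · rwa [hμ, decompose_of_mem_same _ hxj] at this
    · rw [hμ, decompose_of_mem_same _ hyj]
      exact hν ⟨hy, hyj⟩
    · rw [hμ, hμ, decompose_of_mem_same _ (SetLike.coe_mem _)]
  refine le_antisymm (fun x hx => ?_) (TwoSidedIdeal.span_le.2 fun x hx => hx.1)
  classical
  rw [← sum_support_decompose (𝒜.extGrading k) x]
  exact sum_mem fun i _ => key i _ (𝒜.decompose_mem_osIdeal k hx i) (SetLike.coe_mem _)

end CentralArrangement


/-! ### Rainbow cycles in graphs with quadratic Orlik–Solomon algebra -/

namespace CentralArrangement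

variable {V : Type*} [AddCommGroup V] [Module ℂ V]

theorem codim_iInf_le_card [FiniteDimensional ℂ V] (𝒜 : CentralArrangement V) {ι : Type*}
    (S : ι → 𝒜.hyperplanes) (s : Finset ι) :
    Module.finrank ℂ (V ⧸ (⨅ i ∈ s, (S i : Submodule ℂ V))) ≤ s.card := by
  classical
  induction s using Finset.induction_on with
  | empty =>
    have h : (⨅ i ∈ (∅ : Finset ι), (S i : Submodule ℂ V)) = ⊤ := by simp
    rw [h]
    exact Module.finrank_zero_of_subsingleton.le
  | insert a s ha ih =>
    rw [Finset.card_insert_of_notMem ha, Finset.iInf_insert, inf_comm]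
    exact (codim_inf_le _ (𝒜.isCoatom _ (S a).2)).trans (Nat.succ_le_succ ih)

end CentralArrangement

namespace GraphicArrangement

open CentralArrangement
open scoped ExteriorAlgebra

variable {W : Type*}

@[simp] theorem mem_diagonalHyperplane {a b : W} {z : W → ℂ} :
    z ∈ diagonalHyperplane a b ↔ z a = z b := by
  simp [diagonalHyperplane, sub_eq_zero]

theorem diagonalHyperplane_comm (a b : W) : diagonalHyperplane a b = diagonalHyperplane b a := by
  ext z
  rw [mem_diagonalHyperplane, mem_diagonalHyperplane, eq_comm]

open Classical in
theorem iff_of_inf_le {a b c d e f : W}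
    (h : diagonalHyperplane a b ⊓ diagonalHyperplane c d ≤ diagonalHyperplane e f)
    (T : W → Prop) (h1 : T a ↔ T b) (h2 : T c ↔ T d) : T e ↔ T f := by
  have h3 := @h (fun w => if T w then 1 else 0) ⟨by simp [h1], by simp [h2]⟩
  rw [mem_diagonalHyperplane] at h3
  by_cases h4 : T e <;> by_cases h5 : T f <;> simp_all

theorem eq_or_eq_of_diagonalHyperplane_le {a b c d : W} (hcd : c ≠ d)
    (h : diagonalHyperplane a b ≤ diagonalHyperplane c d) : (c = a ∧ d = b) ∨ (c = b ∧ d = a) := by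
  have h' := iff_of_inf_le ((inf_le_left.trans h : diagonalHyperplane a b ⊓
    diagonalHyperplane a b ≤ diagonalHyperplane c d))
  have hc : c = a ∨ c = b := by
    by_contra! hc
    have h1 := h' (· = c) (iff_of_false hc.1.symm hc.2.symm) (iff_of_false hc.1.symm hc.2.symm)
    exact hcd (h1.1 rfl).symm
  have hd : d = a ∨ d = b := by
    by_contra! hd
    have h1 := h' (· = d) (iff_of_false hd.1.symm hd.2.symm) (iff_of_false hd.1.symm hd.2.symm)
    exact hcd (h1.2 rfl)
  grind

/-- Three distinct dependent edges form a triangle. -/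
theorem triangle_of_inf_le {a b c d e f : W} (hcd : c ≠ d) (hef : e ≠ f)
    (h13 : diagonalHyperplane a b ≠ diagonalHyperplane e f)
    (h23 : diagonalHyperplane c d ≠ diagonalHyperplane e f)
    (h : diagonalHyperplane a b ⊓ diagonalHyperplane c d ≤ diagonalHyperplane e f) :
    ∃ x y z, ((a = x ∧ b = y) ∨ (a = y ∧ b = x)) ∧ ((c = y ∧ d = z) ∨ (c = z ∧ d = y)) ∧
      ((e = x ∧ f = z) ∨ (e = z ∧ f = x)) := by
  have he : e = a ∨ e = b ∨ e = c ∨ e = d := by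
    by_contra! he
    have h1 := iff_of_inf_le h (· = e) (iff_of_false he.1.symm he.2.1.symm)
      (iff_of_false he.2.2.1.symm he.2.2.2.symm)
    exact hef (h1.1 rfl).symm
  have hf : f = a ∨ f = b ∨ f = c ∨ f = d := by
    by_contra! hf
    have h1 := iff_of_inf_le h (· = f) (iff_of_false hf.1.symm hf.2.1.symm)
      (iff_of_false hf.2.2.1.symm hf.2.2.2.symm)
    exact hef (h1.2 rfl)
  have e1 : ∀ x y : W, diagonalHyperplane x y = diagonalHyperplane y x := diagonalHyperplane_comm
  by_cases hac : a = c
  · exact ⟨b, a, d, by grind⟩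
  by_cases had : a = d
  · exact ⟨b, a, c, by grind⟩
  by_cases hbc : b = c
  · exact ⟨a, b, d, by grind⟩
  by_cases hbd : b = d
  · exact ⟨a, b, c, by grind⟩
  exfalso
  have h3 := iff_of_inf_le h (fun w => w = a ∨ w = b) (by simp)
    (iff_of_false (by grind) (by grind))
  have h4 : (e = a ∨ e = b) → (f = a ∨ f = b) := h3.1
  have h5 : (f = a ∨ f = b) → (e = a ∨ e = b) := h3.2
  clear h3
  grind

variable [Finite W] {G : SimpleGraph W}

/-- The hyperplane of an edge. -/
def edgeHyperplane {a b : W} (h : G.Adj a b) : (graphicArrangement G).hyperplanes :=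
  ⟨diagonalHyperplane a b, a, b, h, rfl⟩

theorem exists_eq_edgeHyperplane (H : (graphicArrangement G).hyperplanes) :
    ∃ (a b : W) (h : G.Adj a b), H = edgeHyperplane h := by
  obtain ⟨_, a, b, h, rfl⟩ := H
  exact ⟨a, b, h, rfl⟩

theorem exists_triangle {S : Fin 3 → (graphicArrangement G).hyperplanes}
    (hS : Function.Injective S)
    (h : Module.finrank ℂ ((W → ℂ) ⧸ (⨅ i, (S i : Submodule ℂ (W → ℂ)))) < 3) {p q : Fin 3}
    (hpq : p ≠ q) : ∃ (x y z : W) (hxy : G.Adj x y) (hyz : G.Adj y z), G.Adj x z ∧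
      S p = edgeHyperplane hxy ∧ S q = edgeHyperplane hyz := by
  obtain ⟨r, hrp, hrq⟩ := (by decide : ∀ p q : Fin 3, ∃ r, r ≠ p ∧ r ≠ q) p q
  have hne : ∀ {i j}, i ≠ j → (S i : Submodule ℂ (W → ℂ)) ≠ S j :=
    fun hij he => hij (hS (Subtype.ext he))
  have hle : (S p : Submodule ℂ (W → ℂ)) ⊓ S q ≤ S r := by
    by_contra hle
    have hp := (graphicArrangement G).isCoatom _ (S p).2
    have hq := (graphicArrangement G).isCoatom _ (S q).2
    have h1 := codim_lt_of_lt hp.lt_top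
    have h2 : (S p : Submodule ℂ (W → ℂ)) ⊓ S q < S p := by
      refine lt_of_le_of_ne inf_le_left fun he => ?_
      exact hne hpq ((hp.le_iff_eq hq.1).1 (inf_eq_left.1 he)).symm
    have h3 : (⨅ i, (S i : Submodule ℂ (W → ℂ))) < (S p : Submodule ℂ (W → ℂ)) ⊓ S q :=
      lt_of_le_of_ne (le_inf (iInf_le _ p) (iInf_le _ q)) fun he => hle (he ▸ iInf_le _ r)
    have h2' := codim_lt_of_lt h2
    have h3' := codim_lt_of_lt h3
    omega
  have hpr' := hne hrp.symm
  have hqr' := hne hrq.symm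
  obtain ⟨a, b, hab, h1⟩ := exists_eq_edgeHyperplane (S p)
  obtain ⟨c, d, hcd, h2⟩ := exists_eq_edgeHyperplane (S q)
  obtain ⟨e, f, hef, h3⟩ := exists_eq_edgeHyperplane (S r)
  rw [h1, h3] at hpr'
  rw [h2, h3] at hqr'
  rw [h1, h2, h3] at hle
  obtain ⟨x, y, z, hx, hy, hz⟩ :=
    triangle_of_inf_le hcd.ne hef.ne hpr' hqr' hle
  have hxy : G.Adj x y := by rcases hx with ⟨rfl, rfl⟩ | ⟨rfl, rfl⟩; exacts [hab, hab.symm]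
  have hyz : G.Adj y z := by rcases hy with ⟨rfl, rfl⟩ | ⟨rfl, rfl⟩; exacts [hcd, hcd.symm]
  have hxz : G.Adj x z := by rcases hz with ⟨rfl, rfl⟩ | ⟨rfl, rfl⟩; exacts [hef, hef.symm]
  refine ⟨x, y, z, hxy, hyz, hxz, h1.trans (Subtype.ext ?_), h2.trans (Subtype.ext ?_)⟩
  · rcases hx with ⟨rfl, rfl⟩ | ⟨rfl, rfl⟩
    exacts [rfl, diagonalHyperplane_comm _ _]
  · rcases hy with ⟨rfl, rfl⟩ | ⟨rfl, rfl⟩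
    exacts [rfl, diagonalHyperplane_comm _ _]

/-- The color of a hyperplane, for a partial coloring of the pairs of vertices. -/
noncomputable def hypColor (c : W → W → Option ℕ) (H : (graphicArrangement G).hyperplanes) :
    Option ℕ :=
  c H.2.choose H.2.choose_spec.choose

theorem hypColor_edgeHyperplane {c : W → W → Option ℕ} (hc : ∀ a b, c a b = c b a) {a b : W}
    (h : G.Adj a b) : hypColor c (edgeHyperplane h) = c a b := by
  obtain ⟨h1, h2⟩ := (edgeHyperplane h).2.choose_spec.choose_spec
  rcases eq_or_eq_of_diagonalHyperplane_le h1.ne h2.le with ⟨h3, h4⟩ | ⟨h3, h4⟩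
  · exact congrArg₂ c h3 h4
  · exact (congrArg₂ c h3 h4).trans (hc b a)

section

variable (k : Type*) [Field k] (n : ℕ)

/-- The basis vector of a color, zero for the color `none` and for the colors `≥ n`. -/
def colorVec (c : Option ℕ) : Fin n → k := fun j => if c = some j.1 then 1 else 0

/-- The map of exterior algebras which sends a hyperplane to the basis vector of its color. -/
noncomputable def colorMap (G : SimpleGraph W) (c : W → W → Option ℕ) :
    (graphicArrangement G).Exterior k →ₐ[k] ExteriorAlgebra k (Fin n → k) :=
  ExteriorAlgebra.map (Finsupp.linearCombination k fun H => colorVec k n (hypColor c H))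

variable {k n}

theorem colorMap_monomial (c : W → W → Option ℕ) {m : ℕ}
    (S : Fin m → (graphicArrangement G).hyperplanes) :
    colorMap k n G c ((graphicArrangement G).monomial k S) =
      ExteriorAlgebra.ιMulti k m fun i => colorVec k n (hypColor c (S i)) := by
  rw [colorMap, monomial, ExteriorAlgebra.map_apply_ιMulti]
  congr 1
  funext i
  simp

theorem colorMap_extGen (c : W → W → Option ℕ) (H : (graphicArrangement G).hyperplanes) :
    colorMap k n G c ((graphicArrangement G).extGen k H) =
      ExteriorAlgebra.ι k (colorVec k n (hypColor c H)) := by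
  rw [colorMap, extGen, ExteriorAlgebra.map_apply_ι]
  simp

theorem colorMap_mem (c : W → W → Option ℕ) {m : ℕ} {x : (graphicArrangement G).Exterior k}
    (hx : x ∈ (graphicArrangement G).extGrading k m) :
    colorMap k n G c x ∈ ⋀[k]^m (Fin n → k) := by
  have h : (graphicArrangement G).extGrading k m ≤
      (⋀[k]^m (Fin n → k)).comap (colorMap k n G c).toLinearMap := by
    change ⋀[k]^m ((graphicArrangement G).hyperplanes →₀ k) ≤ _
    rw [← ExteriorAlgebra.ιMulti_span_fixedDegree, Submodule.span_le]
    rintro _ ⟨v, rfl⟩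
    change ExteriorAlgebra.map (Finsupp.linearCombination k fun H => colorVec k n (hypColor c H))
      (ExteriorAlgebra.ιMulti k m v) ∈ ⋀[k]^m (Fin n → k)
    rw [ExteriorAlgebra.map_apply_ιMulti]
    exact ExteriorAlgebra.ιMulti_range k m (Set.mem_range_self _)
  exact h hx

theorem colorVec_mul_eq_zero {c c' : Option ℕ} (h : ∀ i j, c = some i → c' = some j → i = j) :
    ExteriorAlgebra.ι k (colorVec k n c) * ExteriorAlgebra.ι k (colorVec k n c') = 0 := by
  have h0 : colorVec k n none = 0 := by funext j; simp [colorVec]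
  cases c with
  | none => rw [h0, map_zero, zero_mul]
  | some i =>
    cases c' with
    | none => rw [h0, map_zero, mul_zero]
    | some j => rw [h i j rfl rfl]; exact ExteriorAlgebra.ι_sq_zero _

/-- If no triangle carries two colors, then the coloring map kills the quadratic relations of the
Orlik–Solomon algebra, so the image of the Orlik–Solomon ideal lies in degrees at least three. -/
theorem colorMap_osIdeal {c : W → W → Option ℕ} (hc : ∀ a b, c a b = c b a)
    (htri : ∀ x y z, G.Adj x y → G.Adj y z → G.Adj x z →
      ∀ i j, c x y = some i → c y z = some j → i = j)
    {x : (graphicArrangement G).Exterior k} (hx : x ∈ (graphicArrangement G).osIdeal k) :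
    colorMap k n G c x ∈ degreeGE (fun i => ⋀[k]^i (Fin n → k)) 3 := by
  suffices h : (graphicArrangement G).osIdeal k ≤
      (degreeGE (fun i => ⋀[k]^i (Fin n → k)) 3).comap (colorMap k n G c) from
    (TwoSidedIdeal.mem_comap _).1 (h hx)
  refine TwoSidedIdeal.span_le.2 ?_
  rintro _ ⟨m, S, hS, hm, rfl⟩
  rw [SetLike.mem_coe, TwoSidedIdeal.mem_comap]
  rcases (three_le_of_dependent _ hS hm).eq_or_lt with rfl | h3
  · have hz : ∀ p q : Fin 3, p ≠ q →
        colorMap k n G c ((graphicArrangement G).extGen k (S p)) *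
        colorMap k n G c ((graphicArrangement G).extGen k (S q)) = 0 := by
      intro p q hpq
      obtain ⟨x, y, z, hxy, hyz, hxz, h1, h2⟩ := exists_triangle hS hm hpq
      rw [colorMap_extGen, colorMap_extGen, h1, h2, hypColor_edgeHyperplane hc,
        hypColor_edgeHyperplane hc]
      exact colorVec_mul_eq_zero (htri x y z hxy hyz hxz)
    rw [boundary_monomial_three, triangle, map_add, map_sub, map_mul, map_mul, map_mul,
      hz 1 2 (by decide), hz 0 2 (by decide), hz 0 1 (by decide), sub_zero, add_zero]
    exact zero_mem _
  · exact mem_degreeGE_of_mem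
      (colorMap_mem c ((graphicArrangement G).boundary_monomial_mem_extGrading k S)) (by omega)

theorem ιMulti_single_ne_zero :
    ExteriorAlgebra.ιMulti k n (fun i : Fin n => (Pi.single i 1 : Fin n → k)) ≠ 0 := by
  intro h
  have h1 := ExteriorAlgebra.liftAlternating_apply_ιMulti (R := k) (M := Fin n → k) (N := k)
    (Pi.single n (Pi.basisFun k (Fin n)).det) (fun i : Fin n => (Pi.single i 1 : Fin n → k))
  rw [h, map_zero, Pi.single_eq_same] at h1
  have h2 := (Pi.basisFun k (Fin n)).det_self
  have h3 : ⇑(Pi.basisFun k (Fin n)) = fun i : Fin n => (Pi.single i 1 : Fin n → k) := by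
    funext i; simp
  rw [h3, ← h1] at h2
  exact zero_ne_one h2

/-- A graph with quadratic Orlik–Solomon algebra has no partial edge coloring with a cycle of
pairwise different colors, all of whose triangles are unicolored: the coloring map kills the
quadratic relations, but not the relation of the cycle. -/
theorem not_rainbow (hq : (graphicArrangement G).IsQuadratic k) {c : W → W → Option ℕ}
    (hc : ∀ a b, c a b = c b a)
    (htri : ∀ x y z, G.Adj x y → G.Adj y z → G.Adj x z →
      ∀ i j, c x y = some i → c y z = some j → i = j)
    (p : ℕ → W) (hn : 0 < n) (hp : p n = p 0) (hadj : ∀ i < n, G.Adj (p i) (p (i + 1)))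
    (hcol : ∀ i < n, c (p i) (p (i + 1)) = some i) : False := by
  obtain ⟨n, rfl⟩ : ∃ l, n = l + 1 := ⟨n - 1, by omega⟩
  have hker : ∀ x ∈ (graphicArrangement G).osIdeal k, colorMap k (n + 1) G c x = 0 := by
    intro x hx
    rw [hq] at hx
    have h : TwoSidedIdeal.span {x | x ∈ (graphicArrangement G).osIdeal k ∧
        x ∈ ⋀[k]^2 ((graphicArrangement G).hyperplanes →₀ k)} ≤
        TwoSidedIdeal.ker (colorMap k (n + 1) G c) := by
      refine TwoSidedIdeal.span_le.2 fun y hy => ?_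
      rw [SetLike.mem_coe, TwoSidedIdeal.mem_ker]
      exact eq_zero_of_mem_degreeGE (colorMap_osIdeal hc htri hy.1) (by norm_num)
        (colorMap_mem c hy.2)
    exact (TwoSidedIdeal.mem_ker _).1 (h hx)
  let S : Fin (n + 1) → (graphicArrangement G).hyperplanes :=
    fun i => edgeHyperplane (hadj i.1 i.2)
  have hdep : Module.finrank ℂ ((W → ℂ) ⧸ (⨅ i, (S i : Submodule ℂ (W → ℂ)))) < n + 1 := by
    have h1 := codim_iInf_le_card (graphicArrangement G) S (Finset.univ.erase (Fin.last n))
    rw [Finset.card_erase_of_mem (Finset.mem_univ _), Finset.card_univ, Fintype.card_fin] at h1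
    refine (lt_of_le_of_lt (codim_le_of_le (le_iInf fun i => ?_)) (Nat.lt_succ_of_le h1))
    by_cases hi : i = Fin.last n
    swap
    · exact iInf₂_le i (Finset.mem_erase.2 ⟨hi, Finset.mem_univ _⟩)
    subst hi
    intro z hz
    have hz' : ∀ i, i < n → z (p i) = z (p (i + 1)) := fun i hi => by
      have h2 : (⨅ i ∈ Finset.univ.erase (Fin.last n), (S i : Submodule ℂ (W → ℂ))) ≤
          S ⟨i, by omega⟩ :=
        iInf₂_le _ (Finset.mem_erase.2 ⟨by simp [Fin.ext_iff]; omega, Finset.mem_univ _⟩)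
      exact mem_diagonalHyperplane.1 (h2 hz)
    have hz0 : ∀ i, i ≤ n → z (p 0) = z (p i) := by
      intro i
      induction i with
      | zero => intro _; rfl
      | succ i ih => intro hi; rw [ih (by omega), hz' i (by omega)]
    refine mem_diagonalHyperplane.2 ?_
    change z (p n) = z (p (n + 1))
    rw [hp, hz0 n le_rfl]
  have hI := (graphicArrangement G).boundary_monomial_mem k S hdep
  -- multiplying the relation by one of its factors gives back the monomial
  have hmon : (graphicArrangement G).monomial k S ∈ (graphicArrangement G).osIdeal k := by
    have h2 := TwoSidedIdeal.mul_mem_left _ ((graphicArrangement G).extGen k (S 0)) _ hI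
    rw [monomial_succ, boundary_extGen_mul, mul_sub, ← mul_assoc, extGen_mul_self, zero_mul,
      sub_zero, ← monomial_succ] at h2
    exact h2
  refine ιMulti_single_ne_zero (k := k) (n := n + 1) ?_
  rw [← hker _ hmon, colorMap_monomial]
  congr 1
  funext i
  rw [hypColor_edgeHyperplane hc, hcol i.1 i.2]
  funext j
  simp [colorVec, Pi.single_apply, Fin.ext_iff, eq_comm]

end

end GraphicArrangement


/-! ### Simplicial vertices and perfect elimination orders -/

namespace GraphicArrangement

variable {W : Type*}

/-- The edges of a graph within a set of vertices, as a graph on all vertices. -/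
def within (G : SimpleGraph W) (P : Set W) : SimpleGraph W where
  Adj a b := G.Adj a b ∧ a ∈ P ∧ b ∈ P
  symm := ⟨fun _ _ h => ⟨h.1.symm, h.2.2, h.2.1⟩⟩
  loopless := ⟨fun _ h => h.1.ne rfl⟩

/-- Two neighbors of `v` are adjacent as soon as they are joined by a path whose inner vertices are
different from `v` and not adjacent to `v`. -/
def NoDetour (G : SimpleGraph W) : Prop :=
  ∀ (v x y : W) (C : Set W), G.Adj v x → G.Adj v y → x ≠ y → (∀ c ∈ C, c ≠ v ∧ ¬ G.Adj v c) →
    (within G (C ∪ {x, y})).Reachable x y → G.Adj x y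

open Classical in
/-- The coloring of a detour from `x` to `y` around `v`, where `K` is the graph of the detour: an
edge of `K` that leads away from `x` has the distance of its first vertex as color, the edges from
`v` to `y` and to `x` have the colors `m` and `m + 1`. -/
noncomputable def detourColor (K : SimpleGraph W) (v x y : W) (m : ℕ) (a b : W) : Option ℕ :=
  if K.Adj a b ∧ K.Reachable x a then
    if K.dist x a = K.dist x b then none else some (min (K.dist x a) (K.dist x b))
  else if (a = v ∧ b = x) ∨ (a = x ∧ b = v) then some (m + 1)
  else if (a = v ∧ b = y) ∨ (a = y ∧ b = v) then some m
  else none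

section detourColor

variable {K : SimpleGraph W} {v x y : W} {m : ℕ}

theorem adj_and_reachable_symm {a b : W} (h : K.Adj a b ∧ K.Reachable x a) :
    K.Adj b a ∧ K.Reachable x b := ⟨h.1.symm, h.2.trans h.1.reachable⟩

theorem dist_le_dist_add_one {a b : W} (hab : K.Adj a b) (ha : K.Reachable x a) :
    K.dist x b ≤ K.dist x a + 1 := by
  have := ha.dist_triangle_left b
  rwa [SimpleGraph.dist_eq_one_iff_adj.2 hab] at this

theorem detourColor_comm (a b : W) : detourColor K v x y m a b = detourColor K v x y m b a := by
  have h1 : (K.Adj a b ∧ K.Reachable x a) ↔ (K.Adj b a ∧ K.Reachable x b) :=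
    ⟨adj_and_reachable_symm, adj_and_reachable_symm⟩
  have h2 : ∀ c : W, ((a = v ∧ b = c) ∨ (a = c ∧ b = v)) ↔ ((b = v ∧ a = c) ∨ (b = c ∧ a = v)) :=
    fun c => ⟨fun h => h.elim (fun h => Or.inr ⟨h.2, h.1⟩) fun h => Or.inl ⟨h.2, h.1⟩,
      fun h => h.elim (fun h => Or.inr ⟨h.2, h.1⟩) fun h => Or.inl ⟨h.2, h.1⟩⟩
  unfold detourColor
  classical
  exact if_congr h1 (if_congr eq_comm rfl (congrArg some (min_comm _ _)))
    (if_congr (h2 x) rfl (if_congr (h2 y) rfl rfl))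

theorem detourColor_of_adj {a b : W} (h : K.Adj a b ∧ K.Reachable x a) {i : ℕ}
    (hi : detourColor K v x y m a b = some i) :
    K.dist x a ≠ K.dist x b ∧ i = min (K.dist x a) (K.dist x b) := by
  rw [detourColor, if_pos h] at hi
  split_ifs at hi with h1
  exact ⟨h1, (Option.some.inj hi).symm⟩

theorem detourColor_of_not_adj {a b : W} (h : ¬ (K.Adj a b ∧ K.Reachable x a)) {i : ℕ}
    (hi : detourColor K v x y m a b = some i) :
    (i = m + 1 ∧ ((a = v ∧ b = x) ∨ (a = x ∧ b = v))) ∨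
      (i = m ∧ ((a = v ∧ b = y) ∨ (a = y ∧ b = v))) := by
  rw [detourColor, if_neg h] at hi
  split_ifs at hi with h1 h2
  · exact Or.inl ⟨(Option.some.inj hi).symm, h1⟩
  · exact Or.inr ⟨(Option.some.inj hi).symm, h2⟩

/-- An edge of the detour and an edge with one of the colors `m`, `m + 1` do not lie in a common
triangle. -/
theorem not_detourColor_of_triangle {G : SimpleGraph W} (hKG : ∀ a b, K.Adj a b → G.Adj a b)
    (hv : ∀ a, ¬ K.Adj v a) (hnb : ∀ a b, K.Adj a b → G.Adj v a → a = x ∨ a = y)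
    (hxy : ¬ G.Adj x y) {a b d : W} (had : G.Adj a d) (hab : K.Adj a b)
    (hbd : ¬ (K.Adj b d ∧ K.Reachable x b)) (i : ℕ) : detourColor K v x y m b d ≠ some i := by
  intro hi
  have hbv : b ≠ v := by rintro rfl; exact hv a hab.symm
  obtain ⟨hbx, rfl⟩ : (b = x ∨ b = y) ∧ d = v := by
    rcases detourColor_of_not_adj hbd hi with ⟨-, h | h⟩ | ⟨-, h | h⟩
    · exact absurd h.1 hbv
    · exact ⟨Or.inl h.1, h.2⟩
    · exact absurd h.1 hbv
    · exact ⟨Or.inr h.1, h.2⟩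
  have hne := hab.ne
  have hG := hKG a b hab
  rcases hnb a b hab had.symm with rfl | rfl <;> rcases hbx with rfl | rfl
  · exact hne rfl
  · exact hxy hG
  · exact hxy hG.symm
  · exact hne rfl

theorem detourColor_triangle {G : SimpleGraph W} (hKG : ∀ a b, K.Adj a b → G.Adj a b)
    (hK : ∀ a b d, K.Adj a b → K.Adj b d → G.Adj a d → K.Adj a d)
    (hv : ∀ a, ¬ K.Adj v a) (hnb : ∀ a b, K.Adj a b → G.Adj v a → a = x ∨ a = y)
    (hvx : v ≠ x) (hvy : v ≠ y) (hxy' : x ≠ y) (hxy : ¬ G.Adj x y) (a b d : W)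
    (hab : G.Adj a b) (hbd : G.Adj b d) (had : G.Adj a d) (i j : ℕ)
    (hi : detourColor K v x y m a b = some i) (hj : detourColor K v x y m b d = some j) :
    i = j := by
  by_cases h1 : K.Adj a b ∧ K.Reachable x a
  · by_cases h2 : K.Adj b d ∧ K.Reachable x b
    · -- the distances of `a`, `b`, `d` differ by at most one, so the equal ones are those of `a`, `d`
      have h3 := hK a b d h1.1 h2.1 had
      have h4 := detourColor_of_adj h1 hi
      have h5 := detourColor_of_adj h2 hj
      have hd := h1.2.trans h3.reachable
      have e1 := dist_le_dist_add_one h3 h1.2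
      have e2 := dist_le_dist_add_one h3.symm hd
      have e3 := dist_le_dist_add_one h1.1 h1.2
      have e4 := dist_le_dist_add_one h1.1.symm h2.2
      have e5 := dist_le_dist_add_one h2.1 h2.2
      have e6 := dist_le_dist_add_one h2.1.symm hd
      omega
    · exact absurd hj (not_detourColor_of_triangle hKG hv hnb hxy had h1.1 h2 j)
  · by_cases h2 : K.Adj b d ∧ K.Reachable x b
    · refine absurd (detourColor_comm (K := K) a b ▸ hi) (not_detourColor_of_triangle hKG hv hnb hxy
        had.symm h2.1.symm (fun h => h1 (adj_and_reachable_symm h)) i)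
    · have hyx : ¬ G.Adj y x := fun h => hxy h.symm
      have h3 := detourColor_of_not_adj h1 hi
      have h4 := detourColor_of_not_adj h2 hj
      clear hi hj h1 h2 hK hv hnb hKG
      have h5 := hab.ne
      have h6 := hbd.ne
      rcases h3 with ⟨rfl, ⟨rfl, rfl⟩ | ⟨rfl, rfl⟩⟩ | ⟨rfl, ⟨rfl, rfl⟩ | ⟨rfl, rfl⟩⟩ <;>
      rcases h4 with ⟨rfl, ⟨e, rfl⟩ | ⟨e, rfl⟩⟩ | ⟨rfl, ⟨e, rfl⟩ | ⟨e, rfl⟩⟩ <;>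
      first
        | rfl
        | exact absurd had hxy
        | exact absurd had hyx
        | exact absurd e hvx
        | exact absurd e hvy
        | exact absurd e.symm hvx
        | exact absurd e.symm hvy
        | exact absurd e hxy'
        | exact absurd e.symm hxy'

end detourColor

/-- If the ends of a detour around `v` are not adjacent, then a shortest such detour and `v` form a
rainbow cycle for the coloring `detourColor`. -/
theorem noDetour_of_isQuadratic [Finite W] {G : SimpleGraph W} {k : Type*} [Field k]
    (hq : (graphicArrangement G).IsQuadratic k) : NoDetour G := by
  intro v x y C hvx hvy hxy hC hr
  by_contra hnadj
  set K := within G (C ∪ {x, y}) with hK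
  have hv : ∀ a, ¬ K.Adj v a := fun a h => by
    rcases h.2.1 with h | h | h
    · exact (hC v h).1 rfl
    · exact hvx.ne h
    · exact hvy.ne h
  have hnb : ∀ a b, K.Adj a b → G.Adj v a → a = x ∨ a = y := fun a b h hva => by
    rcases h.2.1 with h | h | h
    · exact absurd hva (hC a h).2
    · exact Or.inl h
    · exact Or.inr h
  obtain ⟨p, hp⟩ := hr.exists_walk_length_eq_dist
  set m := p.length with hm
  refine not_rainbow (n := m + 2) (c := detourColor K v x y m) hq detourColor_comm
    (detourColor_triangle (fun a b h => h.1) (fun a b d hab hbd had => ⟨had, hab.2.1, hbd.2.2⟩)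
      hv hnb hvx.ne hvy.ne hxy hnadj)
    (fun i => if i ≤ m then p.getVert i else if i = m + 1 then v else x) (by omega) ?_ ?_ ?_
  · have : ¬ (m + 2 ≤ m) := by omega
    simp [this]
  · intro i hi
    rcases lt_trichotomy i m with h | rfl | h
    · simp only [h.le, if_true, Nat.succ_le_of_lt h]
      exact (p.adj_getVert_succ h).1
    · simpa [hm] using hvy.symm
    · obtain rfl : i = m + 1 := by omega
      simpa using hvx
  · intro i hi
    rcases lt_trichotomy i m with h | rfl | h
    · simp only [h.le, if_true, Nat.succ_le_of_lt h]
      have hd : ∀ j ≤ m, K.dist x (p.getVert j) = j := fun j hj => by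
        have := SimpleGraph.length_eq_dist_of_subwalk hp (p.isSubwalk_take j)
        rw [SimpleGraph.Walk.take_length] at this
        omega
      have h1 : K.Adj (p.getVert i) (p.getVert (i + 1)) ∧ K.Reachable x (p.getVert i) :=
        ⟨p.adj_getVert_succ h, ⟨p.take i⟩⟩
      rw [detourColor, if_pos h1, hd i h.le, hd (i + 1) h]
      simp
    · have h1 : ¬ (K.Adj y v ∧ K.Reachable x y) := fun h => hv y h.1.symm
      simp [detourColor, hm, h1, hvy.ne', hxy.symm]
    · obtain rfl : i = m + 1 := by omega
      have h1 : ¬ (K.Adj v x ∧ K.Reachable x v) := fun h => hv x h.1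
      simp [detourColor, h1]

/-- The neighbors of `t` in `U` are pairwise adjacent. -/
def IsSimplicialIn (G : SimpleGraph W) (U : Finset W) (t : W) : Prop :=
  ∀ a ∈ U, ∀ b ∈ U, G.Adj t a → G.Adj t b → a ≠ b → G.Adj a b

open Classical in
/-- A vertex `v` which is not adjacent to all others has a simplicial vertex among the vertices
which are not adjacent to it. It lies in a component `C` of the graph without the closed
neighborhood of `v`; the vertices outside `C` adjacent to `C` form a clique, and one applies
induction to `C` together with this clique. -/
theorem exists_simplicial {G : SimpleGraph W} (hG : NoDetour G) (U : Finset W) :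
    ∀ v ∈ U, ∀ u ∈ U, u ≠ v → ¬ G.Adj u v →
      ∃ t ∈ U, t ≠ v ∧ ¬ G.Adj t v ∧ IsSimplicialIn G U t := by
  induction U using Finset.strongInduction with
  | _ U ih =>
  intro v hv u hu huv huv'
  let D : Set W := {w | w ∈ U ∧ w ≠ v ∧ ¬ G.Adj w v}
  let K := within G D
  let C : Set W := {w | K.Reachable u w}
  have hCD : ∀ w ∈ C, w ∈ D := by
    intro w hw
    have hw' : K.Reachable u w := hw
    rw [SimpleGraph.reachable_iff_reflTransGen] at hw'
    cases hw' with
    | refl => exact ⟨hu, huv, huv'⟩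
    | tail _ h => exact h.2.2
  have huC : u ∈ C := SimpleGraph.Reachable.refl u
  have hCstep : ∀ c ∈ C, ∀ w ∈ U, G.Adj c w → w ∈ C ∨ G.Adj w v := by
    intro c hc w hw hcw
    by_cases hwv : G.Adj w v
    · exact Or.inr hwv
    refine Or.inl (SimpleGraph.Reachable.trans hc ?_)
    have hne : w ≠ v := by rintro rfl; exact (hCD c hc).2.2 hcw
    exact SimpleGraph.Adj.reachable (G := K) ⟨hcw, hCD c hc, hw, hne, hwv⟩
  -- the vertices outside `C` which are adjacent to `C` form a clique
  have hS : ∀ x y, G.Adj x v → G.Adj y v → (∃ c ∈ C, G.Adj c x) → (∃ c ∈ C, G.Adj c y) →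
      x ≠ y → G.Adj x y := by
    rintro x y hxv hyv ⟨c, hc, hcx⟩ ⟨c', hc', hcy⟩ hxy
    refine hG v x y C hxv.symm hyv.symm hxy
      (fun c hc => ⟨(hCD c hc).2.1, fun h => (hCD c hc).2.2 h.symm⟩) ?_
    have hreach : ∀ w ∈ C, (within G (C ∪ {x, y})).Reachable u w := by
      intro w hw
      have hw' : K.Reachable u w := hw
      rw [SimpleGraph.reachable_iff_reflTransGen] at hw'
      induction hw' with
      | refl => exact SimpleGraph.Reachable.refl u
      | @tail a b ha hab ih =>
        have ha' : a ∈ C := (SimpleGraph.reachable_iff_reflTransGen u a).2 ha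
        exact (ih ha').trans (SimpleGraph.Adj.reachable ⟨hab.1, Or.inl ha', Or.inl hw⟩)
    have h1 : (within G (C ∪ {x, y})).Adj c x := ⟨hcx, Or.inl hc, Or.inr (Or.inl rfl)⟩
    have h2 : (within G (C ∪ {x, y})).Adj c' y := ⟨hcy, Or.inl hc', Or.inr (Or.inr rfl)⟩
    exact h1.symm.reachable.trans ((hreach c hc).symm.trans ((hreach c' hc').trans h2.reachable))
  let U' := U.filter fun w => w ∈ C ∨ (G.Adj w v ∧ ∃ c ∈ C, G.Adj c w)
  have hU' : ∀ w, w ∈ U' ↔ w ∈ U ∧ (w ∈ C ∨ (G.Adj w v ∧ ∃ c ∈ C, G.Adj c w)) := fun w =>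
    Finset.mem_filter
  have hss : U' ⊂ U := by
    refine (Finset.ssubset_iff_of_subset (Finset.filter_subset _ _)).2 ⟨v, hv, fun h => ?_⟩
    rcases ((hU' v).1 h).2 with h | h
    · exact (hCD v h).2.1 rfl
    · exact h.1.ne rfl
  suffices h : ∃ t ∈ C, IsSimplicialIn G U' t by
    obtain ⟨t, ht, hsimp⟩ := h
    have hmem : ∀ a ∈ U, G.Adj t a → a ∈ U' := fun a ha hta =>
      (hU' a).2 ⟨ha, (hCstep t ht a ha hta).imp_right fun h => ⟨h, t, ht, hta⟩⟩
    exact ⟨t, (hCD t ht).1, (hCD t ht).2.1, (hCD t ht).2.2, fun a ha b hb hta htb =>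
      hsimp a (hmem a ha hta) b (hmem b hb htb) hta htb⟩
  by_cases hclique : ∀ a ∈ U', ∀ b ∈ U', a ≠ b → G.Adj a b
  · exact ⟨u, huC, fun a ha b hb _ _ hab => hclique a ha b hb hab⟩
  -- the vertex avoided by the induction hypothesis is chosen such that the simplicial vertex lies
  -- in `C`, in the clique if possible
  by_cases hSU : ∃ s ∈ U', s ∉ C ∧ ∃ w ∈ U', w ≠ s ∧ ¬ G.Adj w s
  · obtain ⟨s, hs, hsC, w, hw, hws, hws'⟩ := hSU
    obtain ⟨t, ht, hts, hts', hsimp⟩ := ih U' hss s hs w hw hws hws'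
    refine ⟨t, by_contra fun htC => ?_, hsimp⟩
    have h1 := ((hU' s).1 hs).2.resolve_left hsC
    have h2 := ((hU' t).1 ht).2.resolve_left htC
    exact hts' (hS t s h2.1 h1.1 h2.2 h1.2 hts)
  · push Not at hclique hSU
    obtain ⟨a, ha, b, hb, hab, hab'⟩ := hclique
    obtain ⟨t, ht, hta, hta', hsimp⟩ := ih U' hss a ha b hb hab.symm fun h => hab' h.symm
    exact ⟨t, by_contra fun htC => hta' (hSU t ht htC a ha hta.symm).symm, hsimp⟩

open Classical in
/-- A ranking of the vertices such that the neighbors of smaller rank of each vertex form a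
clique. -/
theorem exists_elimination_order {G : SimpleGraph W} (hG : NoDetour G) (U : Finset W) :
    ∃ r : W → ℕ, Set.InjOn r U ∧ ∀ t ∈ U, ∀ a ∈ U, ∀ b ∈ U, r a < r t → r b < r t →
      G.Adj t a → G.Adj t b → a ≠ b → G.Adj a b := by
  induction U using Finset.strongInduction with
  | _ U ih =>
  rcases U.eq_empty_or_nonempty with rfl | ⟨v, hv⟩
  · exact ⟨fun _ => 0, by simp, by simp⟩
  obtain ⟨t, ht, hsimp⟩ : ∃ t ∈ U, IsSimplicialIn G U t := by
    by_cases h : ∃ u ∈ U, u ≠ v ∧ ¬ G.Adj u v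
    · obtain ⟨u, hu, huv, huv'⟩ := h
      obtain ⟨t, ht, -, -, h⟩ := exists_simplicial hG U v hv u hu huv huv'
      exact ⟨t, ht, h⟩
    by_cases h' : ∃ a ∈ U, ∃ b ∈ U, b ≠ a ∧ ¬ G.Adj b a
    · obtain ⟨a, ha, b, hb, hab, hab'⟩ := h'
      obtain ⟨t, ht, -, -, h⟩ := exists_simplicial hG U a ha b hb hab hab'
      exact ⟨t, ht, h⟩
    · push Not at h'
      exact ⟨v, hv, fun a ha b hb _ _ hab => h' b hb a ha hab⟩
  obtain ⟨r, hinj, hr⟩ := ih (U.erase t) (Finset.erase_ssubset ht)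
  have hlt : ∀ a ∈ U, r a < U.sup r + 1 := fun a ha => Nat.lt_succ_of_le (Finset.le_sup ha)
  refine ⟨fun w => if w = t then U.sup r + 1 else r w, fun a ha b hb hab => ?_, ?_⟩
  · have ha' := hlt a ha
    have hb' := hlt b hb
    dsimp only at hab
    split_ifs at hab with h1 h2 h2
    · rw [h1, h2]
    · omega
    · omega
    · exact hinj (Finset.mem_coe.2 (Finset.mem_erase.2 ⟨h1, ha⟩))
        (Finset.mem_coe.2 (Finset.mem_erase.2 ⟨h2, hb⟩)) hab
  · intro w hw a ha b hb haw hbw hwa hwb hab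
    have ha' := hlt a ha
    have hb' := hlt b hb
    have hw' := hlt w hw
    by_cases hwt : w = t
    · subst hwt
      exact hsimp a ha b hb hwa hwb hab
    dsimp only at haw hbw
    rw [if_neg hwt] at haw hbw
    by_cases hat : a = t
    · rw [if_pos hat] at haw; omega
    by_cases hbt : b = t
    · rw [if_pos hbt] at hbw; omega
    rw [if_neg hat] at haw
    rw [if_neg hbt] at hbw
    exact hr w (Finset.mem_erase.2 ⟨hwt, hw⟩) a (Finset.mem_erase.2 ⟨hat, ha⟩) b
      (Finset.mem_erase.2 ⟨hbt, hb⟩) haw hbw hwa hwb hab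

/-! ### Modular chains from elimination orders -/

section Flag

variable [Finite W] {G : SimpleGraph W}

theorem mem_flat_iff (Y : (graphicArrangement G).Flat) (z : W → ℂ) :
    z ∈ Y.1 ↔ ∀ a b, G.Adj a b → Y.1 ≤ diagonalHyperplane a b → z a = z b := by
  refine ⟨fun hz a b _ h => mem_diagonalHyperplane.1 (h hz), fun hz => ?_⟩
  obtain ⟨_, ℬ, hℬ, rfl⟩ := Y
  refine (Submodule.mem_sInf).2 fun H hH => ?_
  obtain ⟨a, b, hab, rfl⟩ := hℬ hH
  exact mem_diagonalHyperplane.2 (hz a b hab (sInf_le hH))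

/-- The flat of the edges between the vertices of rank `< j`. -/
def initialFlat (G : SimpleGraph W) (r : W → ℕ) (j : ℕ) : (graphicArrangement G).Flat :=
  ⟨sInf {H | ∃ a b, G.Adj a b ∧ r a < j ∧ r b < j ∧ H = diagonalHyperplane a b},
    {H | ∃ a b, G.Adj a b ∧ r a < j ∧ r b < j ∧ H = diagonalHyperplane a b},
    fun _ ⟨a, b, h, _, _, h'⟩ => ⟨a, b, h, h'⟩, rfl⟩

variable {r : W → ℕ} {j : ℕ}

theorem mem_initialFlat {z : W → ℂ} : z ∈ (initialFlat G r j).1 ↔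
    ∀ a b, G.Adj a b → r a < j → r b < j → z a = z b := by
  refine Submodule.mem_sInf.trans ⟨fun h a b hab ha hb =>
    mem_diagonalHyperplane.1 (h _ ⟨a, b, hab, ha, hb, rfl⟩), ?_⟩
  rintro h _ ⟨a, b, hab, ha, hb, rfl⟩
  exact mem_diagonalHyperplane.2 (h a b hab ha hb)

theorem initialFlat_le {a b : W} (h : G.Adj a b) (ha : r a < j) (hb : r b < j) :
    (initialFlat G r j).1 ≤ diagonalHyperplane a b :=
  fun _ hz => mem_diagonalHyperplane.2 (mem_initialFlat.1 hz a b h ha hb)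

theorem initialFlat_mono : Monotone (initialFlat G r) := fun _ _ hij _ hz =>
  mem_initialFlat.2 fun a b hab ha hb =>
    mem_initialFlat.1 hz a b hab (ha.trans_le hij) (hb.trans_le hij)


open Classical in
/-- A vector which satisfies the equations of a flat between the vertices of small rank agrees
there with a vector of the flat: the remaining coordinates are chosen one by one, and the
equations for a new coordinate are consistent since the earlier neighbors form a clique. -/
theorem exists_extension (hinj : Function.Injective r)
    (hr : ∀ t a b, r a < r t → r b < r t → G.Adj t a → G.Adj t b → a ≠ b → G.Adj a b)
    (Y : (graphicArrangement G).Flat) {z : W → ℂ} (hz : ∀ a b, G.Adj a b → r a < j → r b < j →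
      Y.1 ≤ diagonalHyperplane a b → z a = z b) :
    ∃ y ∈ Y.1, ∀ w, r w < j → y w = z w := by
  have key : ∀ i, ∃ y : W → ℂ, (∀ a b, G.Adj a b → r a < j + i → r b < j + i →
      Y.1 ≤ diagonalHyperplane a b → y a = y b) ∧ ∀ w, r w < j → y w = z w := by
    intro i
    induction i with
    | zero => exact ⟨z, hz, fun _ _ => rfl⟩
    | succ i ih =>
      obtain ⟨y, hy, hyz⟩ := ih
      by_cases h : ∃ t b, r t = j + i ∧ G.Adj t b ∧ r b < j + i ∧ Y.1 ≤ diagonalHyperplane t b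
      · obtain ⟨t, b, ht, htb, hb, hY⟩ := h
        have hnew : ∀ c, G.Adj t c → r c < j + i → Y.1 ≤ diagonalHyperplane t c → y c = y b := by
          intro c htc hc hYc
          by_cases hcb : c = b
          · rw [hcb]
          refine hy c b (hr t c b (ht ▸ hc) (ht ▸ hb) htc htb hcb) hc hb fun w hw => ?_
          have h1 := mem_diagonalHyperplane.1 (hY hw)
          have h2 := mem_diagonalHyperplane.1 (hYc hw)
          exact mem_diagonalHyperplane.2 (h2.symm.trans h1)
        have hlt : ∀ c, c ≠ t → r c < j + (i + 1) → r c < j + i := fun c hct hc => by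
          have : r c ≠ r t := fun h => hct (hinj h)
          omega
        refine ⟨Function.update y t (y b), fun c d hcd hc hd hYcd => ?_, fun w hw => ?_⟩
        · by_cases hct : c = t
          · subst hct
            rw [Function.update_self, Function.update_of_ne hcd.ne']
            exact (hnew d hcd (hlt d hcd.ne' hd) hYcd).symm
          · rw [Function.update_of_ne hct]
            by_cases hdt : d = t
            · subst hdt
              rw [Function.update_self]
              exact hnew c hcd.symm (hlt c hct hc) (diagonalHyperplane_comm c d ▸ hYcd)
            · rw [Function.update_of_ne hdt]
              exact hy c d hcd (hlt c hct hc) (hlt d hdt hd) hYcd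
        · rw [Function.update_of_ne (by rintro rfl; omega)]
          exact hyz w hw
      · push Not at h
        refine ⟨y, fun c d hcd hc hd hYcd => ?_, hyz⟩
        have hne : r c ≠ r d := fun h => hcd.ne (hinj h)
        have h1 := h c d
        have h2 := h d c
        rw [diagonalHyperplane_comm d c] at h2
        refine hy c d hcd ?_ ?_ hYcd
        · by_contra hc'
          exact h1 (by omega) hcd (by omega) hYcd
        · by_contra hd'
          exact h2 (by omega) hcd.symm (by omega) hYcd
  obtain ⟨N, hN⟩ := (Set.finite_range r).bddAbove
  obtain ⟨y, hy, hyz⟩ := key (N + 1)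
  have hlt : ∀ w, r w < j + (N + 1) := fun w => by
    have := hN (Set.mem_range_self w)
    omega
  exact ⟨y, (mem_flat_iff Y y).2 fun a b hab hY => hy a b hab (hlt a) (hlt b) hY, hyz⟩

theorem isModularElement_initialFlat (hinj : Function.Injective r)
    (hr : ∀ t a b, r a < r t → r b < r t → G.Adj t a → G.Adj t b → a ≠ b → G.Adj a b) :
    IsModularElement (initialFlat G r j) := by
  intro Y Z hZY
  refine le_antisymm (le_inf (sup_le_sup_left inf_le_left _) (sup_le hZY inf_le_right)) ?_
  rintro z ⟨hzZ, hzXY⟩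
  -- `z` is the sum of a vector of `Y` and a vector of the initial flat
  obtain ⟨y, hy, hyz⟩ := exists_extension (z := z) (j := j) hinj hr Y fun a b hab ha hb hY => by
    have h1 := (Submodule.mem_sInf.1 hzXY) (diagonalHyperplane a b)
      ⟨⟨a, b, hab, rfl⟩, initialFlat_le hab ha hb, hY⟩
    exact mem_diagonalHyperplane.1 h1
  have hx : z - y ∈ (initialFlat G r j).1 := mem_initialFlat.2 fun a b _ ha hb => by
    rw [Pi.sub_apply, Pi.sub_apply, hyz a ha, hyz b hb, sub_self, sub_self]
  refine Submodule.mem_sInf.2 fun H hH => ?_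
  have h1 : z - y ∈ H := hH.2.1 ⟨Submodule.sub_mem _ hzZ (hZY hy), hx⟩
  have h2 : y ∈ H := hH.2.2 hy
  have := H.add_mem h1 h2
  rwa [sub_add_cancel] at this

/-- Consecutive initial flats have no flat strictly between them: if one edge from the new vertex
`t` to an earlier vertex holds on `Y`, then all do, since the earlier neighbors of `t` form
a clique. -/
theorem eq_initialFlat_of_le_of_le (hinj : Function.Injective r)
    (hr : ∀ t a b, r a < r t → r b < r t → G.Adj t a → G.Adj t b → a ≠ b → G.Adj a b)
    {Y : (graphicArrangement G).Flat} (h1 : initialFlat G r j ≤ Y)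
    (h2 : Y ≤ initialFlat G r (j + 1)) : Y = initialFlat G r j ∨ Y = initialFlat G r (j + 1) := by
  by_cases h : Y ≤ initialFlat G r j
  · exact Or.inl (le_antisymm h h1)
  refine Or.inr (le_antisymm h2 ?_)
  obtain ⟨a, b, hab, hY, hn⟩ : ∃ a b, G.Adj a b ∧ Y.1 ≤ diagonalHyperplane a b ∧
      ¬ (initialFlat G r j).1 ≤ diagonalHyperplane a b := by
    by_contra! hcon
    exact h fun z hz => (mem_flat_iff Y z).2 fun a b hab hY =>
      mem_diagonalHyperplane.1 (hcon a b hab hY hz)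
  have hle : (initialFlat G r (j + 1)).1 ≤ diagonalHyperplane a b := fun z hz => hY (h2 hz)
  have hsmall : ∀ a b, a ≠ b → (initialFlat G r (j + 1)).1 ≤ diagonalHyperplane a b →
      r a < j + 1 := by
    intro a b hab hle
    by_contra ha
    classical
    have hmem : (fun w => if w = a then 1 else 0 : W → ℂ) ∈ (initialFlat G r (j + 1)).1 := by
      refine mem_initialFlat.2 fun c d _ hc hd => ?_
      rw [if_neg (by rintro rfl; exact ha hc), if_neg (by rintro rfl; exact ha hd)]
    have := mem_diagonalHyperplane.1 (hle hmem)
    simp [hab.symm] at this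
  have ha := hsmall a b hab.ne hle
  have hb := hsmall b a hab.ne' (diagonalHyperplane_comm a b ▸ hle)
  obtain ⟨t, b, htb, ht, hb, hY⟩ : ∃ t b, G.Adj t b ∧ r t = j ∧ r b < j ∧
      Y.1 ≤ diagonalHyperplane t b := by
    have hne : r a ≠ r b := fun h => hab.ne (hinj h)
    by_cases haj : r a = j
    · exact ⟨a, b, hab, haj, by omega, hY⟩
    by_cases hbj : r b = j
    · exact ⟨b, a, hab.symm, hbj, by omega, diagonalHyperplane_comm a b ▸ hY⟩
    · exact absurd (initialFlat_le hab (by omega) (by omega)) hn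
  have key : ∀ z ∈ Y.1, ∀ c, G.Adj t c → r c < j → z t = z c := by
    intro z hz c htc hc
    rw [mem_diagonalHyperplane.1 (hY hz)]
    by_cases hbc : b = c
    · rw [hbc]
    exact mem_diagonalHyperplane.1
      (initialFlat_le (hr t b c (ht ▸ hb) (ht ▸ hc) htb htc hbc) hb hc (h1 hz))
  intro z hz
  refine mem_initialFlat.2 fun c d hcd hc hd => ?_
  have hne : r c ≠ r d := fun h => hcd.ne (hinj h)
  by_cases hcj : r c = j
  · obtain rfl : c = t := hinj (hcj.trans ht.symm)
    exact key z hz d hcd (by omega)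
  by_cases hdj : r d = j
  · obtain rfl : d = t := hinj (hdj.trans ht.symm)
    exact (key z hz c hcd.symm (by omega)).symm
  exact mem_initialFlat.1 (h1 hz) c d hcd (by omega) (by omega)

theorem isSupersolvable_of_order (hinj : Function.Injective r)
    (hr : ∀ t a b, r a < r t → r b < r t → G.Adj t a → G.Adj t b → a ≠ b → G.Adj a b) :
    (graphicArrangement G).IsSupersolvable := by
  have hchain : IsChain (· ≤ ·) (Set.range (initialFlat G r)) := initialFlat_mono.isChain_range
  refine ⟨⟨Set.range (initialFlat G r), hchain, fun s hs hss => ?_⟩, ?_⟩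
  · refine Set.Subset.antisymm hss fun Y hY => ?_
    obtain ⟨N, hN⟩ := (Set.finite_range r).bddAbove
    have htop : Y ≤ initialFlat G r (N + 1) := fun z hz => (mem_flat_iff Y z).2 fun a b hab _ =>
      mem_initialFlat.1 hz a b hab (Nat.lt_succ_of_le (hN (Set.mem_range_self a)))
        (Nat.lt_succ_of_le (hN (Set.mem_range_self b)))
    have hex : ∃ n, Y ≤ initialFlat G r n := ⟨N + 1, htop⟩
    classical
    have hn := Nat.find_spec hex
    rcases hf : Nat.find hex with _ | n
    · rw [hf] at hn
      refine ⟨0, le_antisymm (fun z _ => mem_initialFlat.2 fun a b _ ha => ?_) hn⟩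
      omega
    · rw [hf] at hn
      have hlt : ¬ Y ≤ initialFlat G r n := Nat.find_min hex (by omega)
      have hle : initialFlat G r n ≤ Y :=
        (hs.total (hss (Set.mem_range_self n)) hY).resolve_right hlt
      rcases eq_initialFlat_of_le_of_le hinj hr hle hn with h | h
      exacts [⟨n, h.symm⟩, ⟨n + 1, h.symm⟩]
  · rintro _ ⟨j, rfl⟩
    exact isModularElement_initialFlat hinj hr

theorem isSupersolvable_of_isQuadratic {k : Type*} [Field k]
    (hq : (graphicArrangement G).IsQuadratic k) : (graphicArrangement G).IsSupersolvable := by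
  have := Fintype.ofFinite W
  obtain ⟨r, hinj, hr⟩ := exists_elimination_order (noDetour_of_isQuadratic hq) Finset.univ
  refine isSupersolvable_of_order (r := r) (fun a b h => hinj (by simp) (by simp) h) ?_
  exact fun t a b => hr t (by simp) a (by simp) b (by simp)

end Flag

end GraphicArrangement

theorem theorem5p2 {W : Type*} [Finite W] (G : SimpleGraph W) (k : Type*) [Field k] :
    ((graphicArrangement G).IsSupersolvable ↔ IsKoszul ((graphicArrangement G).osGrading k)) ∧
      ((graphicArrangement G).IsSupersolvable ↔ (graphicArrangement G).IsQuadratic k) := by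
  have h1 : (graphicArrangement G).IsSupersolvable →
      IsKoszul ((graphicArrangement G).osGrading k) := fun h => h.isKoszul k
  have h2 : IsKoszul ((graphicArrangement G).osGrading k) → (graphicArrangement G).IsQuadratic k :=
    CentralArrangement.isQuadratic_of_isKoszul k _
  have h3 : (graphicArrangement G).IsQuadratic k → (graphicArrangement G).IsSupersolvable :=
    GraphicArrangement.isSupersolvable_of_isQuadratic
  exact ⟨⟨h1, fun h => h3 (h2 h)⟩, ⟨fun h => h2 (h1 h), h3⟩⟩
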